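/- All-Pairs Shortest-Paths on graphs of clique-width at most $k$ can be solved in $O(k n^2\log n)$ time, when a $k$-expression of the graph is given with it. Precisely: there is a single deterministic algorithm (a word-RAM program with unit-cost operations) that takes as input an $n$-vertex simple unweighted graph $G$ (possibly disconnected), $n\ge 2$, by its adjacency matrix, together with a clique-width $k$-expression generating $G$ of size (number of operations) $L=O(n^2)$, and that outputs the distances $d_G(u,v)$ of all pairs of vertices $u,v$ (with $d_G(u,v)=+\infty$ if $u$ and $v$ lie in different connected components) in time $O(k n^2\log n)$. The constant in the time bound depends only on the constant in $L=O(n^2)$, and words of $O(\log(n+k+L))$ bits suffice. Here a $k$-expression is built from the operations $i(v)$ (a new isolated vertex $v$ with label $i\in\{1,\dots,k\}$), disjoint union, $\eta(i,j)$ with $i\ne j$ (add all edges between the vertices labelled $i$ and those labelled $j$) and $\rho(i,j)$ (change every label $i$ into $j$); it generates the graph obtained by forgetting the labels, and $G$ has clique-width at most $k$ if some $k$-expression generates it. -/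

import Mathlib

/-! ## Clique-width expressions -/

/-- Clique-width `k`-expressions over the vertex names `V`, with labels in `Fin k`. A graph has
clique-width at most `k` iff it is generated (see `CWExpr.Generates`) by some `CWExpr V k`. -/
inductive CWExpr (V : Type*) (k : ℕ) where
  /-- `i(v)`: a new isolated vertex `v` with label `i` -/
  | vertex (i : Fin k) (v : V)
  /-- `t₁ ⊕ t₂`: disjoint union -/
  | union (t₁ t₂ : CWExpr V k)
  /-- `η(i,j)`: all edges between vertices labelled `i` and vertices labelled `j` -/
  | join (i j : Fin k) (t : CWExpr V k)
  /-- `ρ(i,j)`: every label `i` becomes `j` -/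
  | relabel (i j : Fin k) (t : CWExpr V k)

namespace CWExpr

variable {V : Type*} {k : ℕ}

/-- The number of operations of an expression. -/
def size : CWExpr V k → ℕ
  | vertex _ _ => 1
  | union t₁ t₂ => t₁.size + t₂.size + 1
  | join _ _ t => t.size + 1
  | relabel _ _ t => t.size + 1

/-- The vertices of the generated labelled graph. -/
def verts : CWExpr V k → Set V
  | vertex _ v => {v}
  | union t₁ t₂ => t₁.verts ∪ t₂.verts
  | join _ _ t => t.verts
  | relabel _ _ t => t.verts

/-- `t.HasLabel v l`: in the generated labelled graph, `v` is a vertex with label `l`. -/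
def HasLabel : CWExpr V k → V → Fin k → Prop
  | vertex i u, v, l => v = u ∧ l = i
  | union t₁ t₂, v, l => t₁.HasLabel v l ∨ t₂.HasLabel v l
  | join _ _ t, v, l => t.HasLabel v l
  | relabel i j t, v, l => (t.HasLabel v l ∧ l ≠ i) ∨ (t.HasLabel v i ∧ l = j)

/-- Adjacency in the generated labelled graph. -/
def Adj : CWExpr V k → V → V → Prop
  | vertex _ _, _, _ => False
  | union t₁ t₂, u, v => t₁.Adj u v ∨ t₂.Adj u v
  | join i j t, u, v =>
      t.Adj u v ∨ (t.HasLabel u i ∧ t.HasLabel v j) ∨ (t.HasLabel u j ∧ t.HasLabel v i)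
  | relabel _ _ t, u, v => t.Adj u v

/-- Unions are disjoint and joins are between two distinct labels. -/
def WellFormed : CWExpr V k → Prop
  | vertex _ _ => True
  | union t₁ t₂ => t₁.WellFormed ∧ t₂.WellFormed ∧ Disjoint t₁.verts t₂.verts
  | join i j t => t.WellFormed ∧ i ≠ j
  | relabel _ _ t => t.WellFormed

/-- `t` is a `k`-expression of the graph `G`. -/
def Generates (t : CWExpr V k) (G : SimpleGraph V) : Prop :=
  t.WellFormed ∧ t.verts = Set.univ ∧ ∀ u v, G.Adj u v ↔ t.Adj u v

/-- An expression over the vertices `0, …, n - 1` written in postfix order as a sequence of words,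
three words for each operation: an operation code, followed by its two arguments. -/
def code {n : ℕ} : CWExpr (Fin n) k → List ℕ
  | vertex i v => [0, i.val, v.val]
  | union t₁ t₂ => t₁.code ++ t₂.code ++ [1, 0, 0]
  | join i j t => t.code ++ [2, i.val, j.val]
  | relabel i j t => t.code ++ [3, i.val, j.val]

end CWExpr

/-! ## A word RAM with unit-cost operations

A machine has finitely many registers and finitely many arrays in use (those that the program
names), all holding words of `w` bits. Every operation on words, every access to a register or to
a cell of an array, every assignment and every test costs one unit of time. -/

namespace WordRAM

/-- Contents of the registers and of the arrays. -/
structure State where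
  reg : ℕ → ℕ
  arr : ℕ → ℕ → ℕ

/-- The operations on words. -/
inductive Op where
  | add | sub | mul | div | lt | eq

/-- `w`-bit arithmetic: sums and products are taken modulo `2 ^ w`, subtraction is truncated at
zero, division rounds down, and the comparisons return `1` or `0`. -/
def Op.eval (w : ℕ) : Op → ℕ → ℕ → ℕ
  | add, x, y => (x + y) % 2 ^ w
  | sub, x, y => x - y
  | mul, x, y => (x * y) % 2 ^ w
  | div, x, y => x / y
  | lt, x, y => if x < y then 1 else 0
  | eq, x, y => if x = y then 1 else 0

/-- Expressions: constants, registers, array cells `a[e]`, and operations. -/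
inductive Expr where
  | const (c : ℕ)
  | reg (x : ℕ)
  | cell (a : ℕ) (e : Expr)
  | op (o : Op) (e₁ e₂ : Expr)

/-- The value of an expression. -/
def Expr.eval (w : ℕ) (s : State) : Expr → ℕ
  | const c => c % 2 ^ w
  | reg x => s.reg x
  | cell a e => s.arr a (e.eval w s)
  | op o e₁ e₂ => o.eval w (e₁.eval w s) (e₂.eval w s)

/-- The time to evaluate an expression. -/
def Expr.cost : Expr → ℕ
  | const _ => 1
  | reg _ => 1
  | cell _ e => e.cost + 1
  | op _ e₁ e₂ => e₁.cost + e₂.cost + 1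

/-- Programs. -/
inductive Cmd where
  | skip
  /-- register `x := e` -/
  | assign (x : ℕ) (e : Expr)
  /-- array cell `a[i] := e` -/
  | write (a : ℕ) (i e : Expr)
  | seq (p q : Cmd)
  /-- if `e ≠ 0` then `p` else `q` -/
  | cond (e : Expr) (p q : Cmd)
  /-- while `e ≠ 0` do `p` -/
  | loop (e : Expr) (p : Cmd)

/-- `Exec w p s s' T`: on words of `w` bits, the program `p` started in the state `s` halts in the
state `s'` after exactly `T` units of time. -/
inductive Exec (w : ℕ) : Cmd → State → State → ℕ → Prop where
  | skip (s : State) : Exec w .skip s s 1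
  | assign (s : State) (x : ℕ) (e : Expr) :
      Exec w (.assign x e) s ⟨Function.update s.reg x (e.eval w s), s.arr⟩ (e.cost + 1)
  | write (s : State) (a : ℕ) (i e : Expr) :
      Exec w (.write a i e) s
        ⟨s.reg, Function.update s.arr a (Function.update (s.arr a) (i.eval w s) (e.eval w s))⟩
        (i.cost + e.cost + 1)
  | seq {p q : Cmd} {s s' s'' : State} {T T' : ℕ} :
      Exec w p s s' T → Exec w q s' s'' T' → Exec w (.seq p q) s s'' (T + T')
  | cond_true {e : Expr} {p q : Cmd} {s s' : State} {T : ℕ} :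
      e.eval w s ≠ 0 → Exec w p s s' T → Exec w (.cond e p q) s s' (e.cost + 1 + T)
  | cond_false {e : Expr} {p q : Cmd} {s s' : State} {T : ℕ} :
      e.eval w s = 0 → Exec w q s s' T → Exec w (.cond e p q) s s' (e.cost + 1 + T)
  | loop_true {e : Expr} {p : Cmd} {s s' s'' : State} {T T' : ℕ} :
      e.eval w s ≠ 0 → Exec w p s s' T → Exec w (.loop e p) s' s'' T' →
        Exec w (.loop e p) s s'' (e.cost + 1 + T + T')
  | loop_false {e : Expr} {p : Cmd} {s : State} :
      e.eval w s = 0 → Exec w (.loop e p) s s (e.cost + 1)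

end WordRAM

/-! ## All-Pairs Shortest-Paths as a problem for this machine -/

open Classical in
/-- The input: registers `0`, `1`, `2` hold the number `n` of vertices, the number `k` of labels
and the size of the `k`-expression; array `0` holds the adjacency matrix of the graph row by row,
array `1` the code of the `k`-expression. Everything else is zero. -/
noncomputable def apspInput {n k : ℕ} (G : SimpleGraph (Fin n)) (t : CWExpr (Fin n) k) :
    WordRAM.State where
  reg x := if x = 0 then n else if x = 1 then k else if x = 2 then t.size else 0
  arr a p :=
    if a = 0 then (if ∃ u v : Fin n, p = u * n + v ∧ G.Adj u v then 1 else 0)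
    else if a = 1 then t.code.getD p 0
    else 0

open Classical in
/-- The output: array `2` holds the distance matrix of the graph row by row, where the word `n`
stands for an infinite distance (finite distances are less than `n`). -/
def apspSolved {n : ℕ} (G : SimpleGraph (Fin n)) (s : WordRAM.State) : Prop :=
  ∀ u v : Fin n, s.arr 2 (u * n + v) = if G.edist u v = ⊤ then n else (G.edist u v).toNat

/-! The expression is executed bottom-up while a digraph with O(kn) arcs of lengths 0 and 1 is
recorded, whose shortest paths between vertices have the lengths of the distances in G. A
breadth-first search in it costs O(kn), so all n searches cost O(kn²). Building it costs O(L + kn²).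
The factor log n of the bound is therefore only slack.

Two facts keep the digraph small. If a subexpression leaves two vertices nonadjacent, their
adjacency in G depends on their current labels alone (`CWExpr.Refines`). Hence at a disjoint union a
label class of one side and a label class of the other are either completely joined in G or not
joined at all, and a single matrix entry at two representatives tells which
(`CWExpr.Refines.adj_congr`). The two ends of any edge meet in some union, so all edges are found
there and the operations η can be ignored. Secondly, uniting parts with a and b vertices compares at
most min(a,k)·min(b,k) pairs of nonempty classes, and these numbers add up to at most 2kn over the
whole expression (`CWExpr.pairBound_add`, `CWExpr.pairBound_le`).

A class x owns two nodes: the even node x, read as "some member", and the odd node x + 1, read as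
"all members". Arcs of length 0 go up from even nodes to the even nodes of larger classes, and down
from odd nodes to the odd nodes of smaller classes. Two completely joined classes x, y get the arcs
x → y + 1 and y → x + 1 of length 1. Only for a single vertex v, with class 2v + 2, is there an arc
from the odd node 2v + 3 to the even one, so moving from one member of a class to another is never
free. Merging two nonempty classes creates a class and four arcs; it lowers the number of nonempty
classes, so it happens fewer than n times.

Soundness: every arc transports the predicate "is the end of a walk of length d from u" under the
reading `Sem`, so a value at 2v + 3 comes with an actual walk. Completeness: each edge is a path of
length 1, going up, across and down (`Covered`), so no walk of G is shorter than the path found. The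
search uses one queue with two heads, one for each arc length; arcs of length 0 have priority, which
keeps the queue sorted (`runs_searchStep`). -/

namespace WordRAM

/-! ### Total correctness with a time bound -/

/-- Started in `s`, the program `p` halts within `B` units of time in a state satisfying `Q`. -/
def Runs (w : ℕ) (p : Cmd) (s : State) (B : ℕ) (Q : State → Prop) : Prop :=
  ∃ s' T, Exec w p s s' T ∧ T ≤ B ∧ Q s'

/-- Assignment of a value to a register. -/
def State.setReg (s : State) (x v : ℕ) : State := ⟨Function.update s.reg x v, s.arr⟩

/-- Assignment of a value to an array cell. -/
def State.setArr (s : State) (a i v : ℕ) : State :=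
  ⟨s.reg, Function.update s.arr a (Function.update (s.arr a) i v)⟩

@[simp] theorem State.reg_setReg (s : State) (x v y : ℕ) :
    (s.setReg x v).reg y = if y = x then v else s.reg y := by
  simp [State.setReg, Function.update_apply]

@[simp] theorem State.arr_setReg (s : State) (x v : ℕ) : (s.setReg x v).arr = s.arr := rfl

@[simp] theorem State.reg_setArr (s : State) (a i v : ℕ) : (s.setArr a i v).reg = s.reg := rfl

@[simp] theorem State.arr_setArr (s : State) (a i v b : ℕ) :
    (s.setArr a i v).arr b = if b = a then Function.update (s.arr a) i v else s.arr b := by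
  by_cases h : b = a
  · subst h; simp [State.setArr]
  · simp [State.setArr, h]

variable {w : ℕ} {s : State} {B : ℕ} {Q : State → Prop} {p q : Cmd}

theorem Runs.mono {B' : ℕ} {Q' : State → Prop} (h : Runs w p s B Q) (hB : B ≤ B')
    (hQ : ∀ s', Q s' → Q' s') : Runs w p s B' Q' := by
  obtain ⟨s', T, h₁, h₂, h₃⟩ := h
  exact ⟨s', T, h₁, h₂.trans hB, hQ _ h₃⟩

theorem Runs.seq {B₁ B₂ : ℕ} (h : Runs w p s B₁ fun s' => Runs w q s' B₂ Q) :
    Runs w (.seq p q) s (B₁ + B₂) Q := by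
  obtain ⟨s', T, h₁, h₂, s'', T', h₃, h₄, h₅⟩ := h
  exact ⟨s'', T + T', .seq h₁ h₃, by omega, h₅⟩

theorem Runs.cond {e : Expr} (h₁ : e.eval w s ≠ 0 → Runs w p s B Q)
    (h₂ : e.eval w s = 0 → Runs w q s B Q) : Runs w (.cond e p q) s (e.cost + 1 + B) Q := by
  by_cases he : e.eval w s = 0
  · obtain ⟨s', T, h₁, h₂, h₃⟩ := h₂ he
    exact ⟨s', _, .cond_false he h₁, by omega, h₃⟩
  · obtain ⟨s', T, h₁, h₂, h₃⟩ := h₁ he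
    exact ⟨s', _, .cond_true he h₁, by omega, h₃⟩

/-- The effect of a program without loops. -/
def Cmd.run (w : ℕ) : Cmd → State → State
  | .skip, s => s
  | .assign x e, s => s.setReg x (e.eval w s)
  | .write a i e, s => s.setArr a (i.eval w s) (e.eval w s)
  | .seq p q, s => q.run w (p.run w s)
  | .cond e p q, s => if e.eval w s = 0 then q.run w s else p.run w s
  | .loop _ _, s => s

/-- An upper bound for the running time of a program without loops. -/
def Cmd.maxCost : Cmd → ℕ
  | .skip => 1
  | .assign _ e => e.cost + 1
  | .write _ i e => i.cost + e.cost + 1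
  | .seq p q => p.maxCost + q.maxCost
  | .cond e p q => e.cost + 1 + max p.maxCost q.maxCost
  | .loop _ _ => 0

/-- The program has no loops. -/
def Cmd.LoopFree : Cmd → Prop
  | .skip => True
  | .assign _ _ => True
  | .write _ _ _ => True
  | .seq p q => p.LoopFree ∧ q.LoopFree
  | .cond _ p q => p.LoopFree ∧ q.LoopFree
  | .loop _ _ => False

theorem Cmd.LoopFree.runs_run (hp : p.LoopFree) (s : State) :
    Runs w p s p.maxCost fun s' => s' = p.run w s := by
  induction p generalizing s with
  | skip => exact ⟨_, _, .skip s, le_rfl, rfl⟩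
  | assign x e => exact ⟨_, _, .assign s x e, le_rfl, rfl⟩
  | write a i e => exact ⟨_, _, .write s a i e, le_rfl, rfl⟩
  | seq p q hp' hq' =>
    refine Runs.seq ((hp' hp.1 s).mono le_rfl ?_)
    rintro s' rfl
    exact hq' hp.2 _
  | cond e p q hp' hq' =>
    refine Runs.cond (fun he => (hp' hp.1 s).mono (le_max_left _ _) ?_)
      (fun he => (hq' hp.2 s).mono (le_max_right _ _) ?_)
    · rintro s' rfl; simp [Cmd.run, he]
    · rintro s' rfl; simp [Cmd.run, he]
  | loop e p _ => exact hp.elim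

theorem Runs.of_run (hp : p.LoopFree) (hB : p.maxCost ≤ B) (hQ : Q (p.run w s)) :
    Runs w p s B Q :=
  (hp.runs_run s).mono hB (by rintro _ rfl; exact hQ)

/-- The function `φ` is a potential that pays for the loop: an iteration, together with its test,
may cost no more than the drop of `φ`. This allows amortised bounds and gives termination at the
same time, since every drop is positive. -/
theorem Runs.loop {e : Expr} (I : State → Prop) (φ : State → ℕ)
    (step : ∀ s, I s → e.eval w s ≠ 0 →
      ∃ b, Runs w p s b fun s' => I s' ∧ b + e.cost + 1 + φ s' ≤ φ s)
    (hs : I s) :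
    Runs w (.loop e p) s (φ s + e.cost + 1) fun s' => I s' ∧ e.eval w s' = 0 := by
  induction hm : φ s using Nat.strong_induction_on generalizing s with
  | _ m ih =>
    subst hm
    by_cases he : e.eval w s = 0
    · exact ⟨s, _, .loop_false he, by omega, hs, he⟩
    · obtain ⟨b, s', T, h₁, h₂, h₃, h₄⟩ := step s hs he
      obtain ⟨s'', T', k₁, k₂, k₃⟩ := ih (φ s') (by omega) h₃ rfl
      exact ⟨s'', _, .loop_true he h₁ k₁, by omega, k₃⟩

/-- `for i := 0, …, N - 1 do p`, where the register `b` holds the bound `N`. -/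
def forCmd (i b : ℕ) (p : Cmd) : Cmd :=
  .seq (.assign i (.const 0))
    (.loop (.op .lt (.reg i) (.reg b)) (.seq p (.assign i (.op .add (.reg i) (.const 1)))))

/-- The overhead of 8 per round is the test (4) and the increment (4); the final 6 is the
initialisation (2) and the failing test (4). The bound on `N + 1` prevents the counter from wrapping
around. -/
theorem Runs.for {i b N : ℕ} (I : ℕ → State → Prop) (c : ℕ → ℕ) (hib : b ≠ i)
    (hw : N + 1 < 2 ^ w) (hb : s.reg b = N) (h₀ : I 0 (s.setReg i 0))
    (step : ∀ j < N, ∀ s, s.reg i = j → s.reg b = N → I j s →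
      Runs w p s (c j) fun s' => s'.reg i = j ∧ s'.reg b = N ∧ I (j + 1) (s'.setReg i (j + 1))) :
    Runs w (forCmd i b p) s (∑ j ∈ Finset.range N, (c j + 8) + 6)
      fun s' => s'.reg b = N ∧ I N s' := by
  have hone : 1 % 2 ^ w = 1 := Nat.mod_eq_of_lt (by omega)
  have key := Runs.loop (w := w) (p := .seq p (.assign i (.op .add (.reg i) (.const 1))))
    (e := .op .lt (.reg i) (.reg b))
    (s := s.setReg i 0)
    (fun s => s.reg i ≤ N ∧ s.reg b = N ∧ I (s.reg i) s)
    (fun s => ∑ j ∈ Finset.Ico (s.reg i) N, (c j + 8)) ?_ ?_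
  · unfold forCmd
    refine (Runs.seq (B₁ := 2) (B₂ := ∑ j ∈ Finset.range N, (c j + 8) + 4)
      (Runs.of_run (p := .assign i (.const 0)) trivial (by simp [Cmd.maxCost, Expr.cost]) ?_)).mono
      (by omega) (fun _ h => h)
    · simp only [Cmd.run, Expr.eval, Nat.zero_mod]
      refine key.mono ?_ ?_
      · simp only [State.reg_setReg, if_true, Expr.cost, ← Finset.range_eq_Ico]; omega
      · rintro s' ⟨⟨h₁, h₂, h₃⟩, h₄⟩
        simp only [Expr.eval, Op.eval, h₂] at h₄
        have : s'.reg i = N := by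
          split_ifs at h₄ with h
          omega
        exact ⟨h₂, this ▸ h₃⟩
  · rintro s' ⟨h₁, h₂, h₃⟩ h₄
    simp only [Expr.eval, Op.eval, h₂] at h₄
    have hlt : s'.reg i < N := by
      by_contra h
      simp [h] at h₄
    refine ⟨c (s'.reg i) + 4, Runs.seq ((step _ hlt s' rfl h₂ h₃).mono le_rfl ?_)⟩
    rintro s'' ⟨k₁, k₂, k₃⟩
    refine Runs.of_run (p := .assign i (.op .add (.reg i) (.const 1))) trivial
      (by simp [Cmd.maxCost, Expr.cost]) ?_
    have e1 : (s'.reg i + 1) % 2 ^ w = s'.reg i + 1 := Nat.mod_eq_of_lt (by omega)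
    simp only [Cmd.run, Expr.eval, Op.eval, k₁, hone, e1]
    refine ⟨⟨?_, ?_, ?_⟩, ?_⟩
    · simpa using hlt
    · simp [hib, k₂]
    · simpa using k₃
    · rw [Finset.sum_eq_sum_Ico_succ_bot hlt]
      simp only [State.reg_setReg, if_true, Expr.cost]
      omega
  · refine ⟨by simp, by simp [hib, hb], by simpa using h₀⟩

/-- Some iterations of the loop `while e ≠ 0 do p`. -/
inductive Iter (w : ℕ) (e : Expr) (p : Cmd) : State → State → ℕ → Prop where
  | refl (s : State) : Iter w e p s s 0
  | step {s s' s'' : State} {T T' : ℕ} : e.eval w s ≠ 0 → Exec w p s s' T →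
      Iter w e p s' s'' T' → Iter w e p s s'' (e.cost + 1 + T + T')

theorem Iter.trans {e : Expr} {s s' s'' : State} {T T' : ℕ} (h : Iter w e p s s' T)
    (h' : Iter w e p s' s'' T') : Iter w e p s s'' (T + T') := by
  induction h with
  | refl => simpa using h'
  | step he hp _ ih =>
    have := Iter.step he hp (ih h')
    convert this using 1
    omega

/-- The machine runs through the postfix code in one flat loop, whereas the analysis follows the
expression tree. Runs for subexpressions are therefore unfinished loops, glued by `Iter.trans`, and
only the whole run is closed by a failing test. -/
theorem Iter.exec_loop {e : Expr} {s s' : State} {T : ℕ} (h : Iter w e p s s' T)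
    (he : e.eval w s' = 0) : Exec w (.loop e p) s s' (T + (e.cost + 1)) := by
  induction h with
  | refl => simpa using Exec.loop_false he
  | step he' hp _ ih =>
    have := Exec.loop_true he' hp (ih he)
    convert this using 1
    omega

end WordRAM

/-! ### How labels in a subexpression determine the edges still to come -/

namespace CWExpr

variable {V : Type*} {k : ℕ}

theorem mem_verts_iff {t : CWExpr V k} {v : V} : v ∈ t.verts ↔ ∃ l, t.HasLabel v l := by
  induction t with
  | vertex i u => simp [verts, HasLabel]
  | union t₁ t₂ h₁ h₂ => simp [verts, HasLabel, h₁, h₂, exists_or]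
  | join i j t h => simpa [verts, HasLabel] using h
  | relabel i j t h =>
    simp only [verts, HasLabel, h]
    constructor
    · rintro ⟨l, hl⟩
      by_cases hli : l = i
      · exact ⟨j, Or.inr ⟨hli ▸ hl, rfl⟩⟩
      · exact ⟨l, Or.inl ⟨hl, hli⟩⟩
    · rintro ⟨l, hl | hl⟩
      · exact ⟨l, hl.1⟩
      · exact ⟨i, hl.1⟩

theorem HasLabel.mem_verts {t : CWExpr V k} {v : V} {l : Fin k} (h : t.HasLabel v l) :
    v ∈ t.verts := mem_verts_iff.2 ⟨l, h⟩

theorem WellFormed.label_unique {t : CWExpr V k} (ht : t.WellFormed) {v : V} {l l' : Fin k}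
    (h : t.HasLabel v l) (h' : t.HasLabel v l') : l = l' := by
  induction t generalizing l l' with
  | vertex i u => exact h.2.trans h'.2.symm
  | union t₁ t₂ h₁ h₂ =>
    have hd := Set.disjoint_left.1 ht.2.2
    rcases h with h | h <;> rcases h' with h' | h'
    · exact h₁ ht.1 h h'
    · exact (hd h.mem_verts h'.mem_verts).elim
    · exact (hd h'.mem_verts h.mem_verts).elim
    · exact h₂ ht.2.1 h h'
  | join i j t ih => exact ih ht.1 h h'
  | relabel i j t ih =>
    rcases h with h | h <;> rcases h' with h' | h'
    · exact ih ht h.1 h'.1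
    · exact (h.2 (ih ht h.1 h'.1)).elim
    · exact (h'.2 (ih ht h'.1 h.1)).elim
    · exact h.2.trans h'.2.symm

theorem Adj.mem_verts {t : CWExpr V k} {u v : V} (h : t.Adj u v) : u ∈ t.verts ∧ v ∈ t.verts := by
  induction t with
  | vertex i u => exact h.elim
  | union t₁ t₂ h₁ h₂ =>
    rcases h with h | h
    · exact ⟨Or.inl (h₁ h).1, Or.inl (h₁ h).2⟩
    · exact ⟨Or.inr (h₂ h).1, Or.inr (h₂ h).2⟩
  | join i j t ih =>
    rcases h with h | h | h
    · exact ih h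
    · exact ⟨h.1.mem_verts, h.2.mem_verts⟩
    · exact ⟨h.1.mem_verts, h.2.mem_verts⟩
  | relabel i j t ih => exact ih h

theorem verts_nonempty (t : CWExpr V k) : t.verts.Nonempty := by
  induction t with
  | vertex i u => exact ⟨u, rfl⟩
  | union t₁ t₂ h₁ _ => exact h₁.mono Set.subset_union_left
  | join i j t ih => exact ih
  | relabel i j t ih => exact ih

theorem size_pos (t : CWExpr V k) : 0 < t.size := by
  cases t <;> simp [size]

theorem length_code {n : ℕ} (t : CWExpr (Fin n) k) : t.code.length = 3 * t.size := by
  induction t with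
  | vertex i u => rfl
  | union t₁ t₂ h₁ h₂ => simp [code, size, h₁, h₂]; omega
  | join i j t ih => simp [code, size, ih]; omega
  | relabel i j t ih => simp [code, size, ih]; omega

/-- The subexpression `t` of an expression of `G`: whether two vertices of `t` that `t` leaves
non-adjacent are adjacent in `G` depends on their labels only. -/
def Refines (t : CWExpr V k) (G : SimpleGraph V) : Prop :=
  (∀ u v, t.Adj u v → G.Adj u v) ∧
  ∀ u u' v v' p q, t.HasLabel u p → t.HasLabel u' p → t.HasLabel v q → t.HasLabel v' q →
    ¬ t.Adj u v → ¬ t.Adj u' v' → (G.Adj u v ↔ G.Adj u' v')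

variable {G : SimpleGraph V}

/-- At the root nothing is left to be added: both adjacencies are false. -/
theorem Generates.refines {t : CWExpr V k} (h : t.Generates G) : t.Refines G :=
  ⟨fun u v => (h.2.2 u v).2, fun u u' v v' p q _ _ _ _ h₁ h₂ => by
    rw [h.2.2, h.2.2]; exact iff_of_false h₁ h₂⟩

/-- A pair inside `t₁` gets no edge from `t₂`, because the parts are disjoint; so the pairs of `t₁`
left nonadjacent stay so in the union, with the same labels. -/
theorem Refines.union_left {t₁ t₂ : CWExpr V k} (h : (union t₁ t₂).Refines G)
    (ht : (union t₁ t₂).WellFormed) : t₁.Refines G := by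
  have hd := Set.disjoint_left.1 ht.2.2
  refine ⟨fun u v huv => h.1 u v (Or.inl huv), fun u u' v v' p q hu hu' hv hv' h₁ h₂ => ?_⟩
  refine h.2 u u' v v' p q (Or.inl hu) (Or.inl hu') (Or.inl hv) (Or.inl hv') ?_ ?_
  · rintro (h | h)
    exacts [h₁ h, hd hu.mem_verts h.mem_verts.1]
  · rintro (h | h)
    exacts [h₂ h, hd hu'.mem_verts h.mem_verts.1]

theorem Refines.union_right {t₁ t₂ : CWExpr V k} (h : (union t₁ t₂).Refines G)
    (ht : (union t₁ t₂).WellFormed) : t₂.Refines G := by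
  have hd := Set.disjoint_left.1 ht.2.2
  refine ⟨fun u v huv => h.1 u v (Or.inr huv), fun u u' v v' p q hu hu' hv hv' h₁ h₂ => ?_⟩
  refine h.2 u u' v v' p q (Or.inr hu) (Or.inr hu') (Or.inr hv) (Or.inr hv') ?_ ?_
  · rintro (h | h)
    exacts [hd h.mem_verts.1 hu.mem_verts, h₁ h]
  · rintro (h | h)
    exacts [hd h.mem_verts.1 hu'.mem_verts, h₂ h]

/-- The union has no edges across its two sides, so the defining property applies to every such
pair. This is what lets one pair of representatives decide for two whole classes. -/
theorem Refines.adj_congr {t₁ t₂ : CWExpr V k} (h : (union t₁ t₂).Refines G)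
    (ht : (union t₁ t₂).WellFormed) {u u' v v' : V} {p q : Fin k} (hu : t₁.HasLabel u p)
    (hu' : t₁.HasLabel u' p) (hv : t₂.HasLabel v q) (hv' : t₂.HasLabel v' q) :
    G.Adj u v ↔ G.Adj u' v' := by
  have hd := Set.disjoint_left.1 ht.2.2
  refine h.2 u u' v v' p q (Or.inl hu) (Or.inl hu') (Or.inr hv) (Or.inr hv') ?_ ?_
  · rintro (h | h)
    exacts [hd h.mem_verts.2 hv.mem_verts, hd hu.mem_verts h.mem_verts.1]
  · rintro (h | h)
    exacts [hd h.mem_verts.2 hv'.mem_verts, hd hu'.mem_verts h.mem_verts.1]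

/-- A join treats all pairs with given labels alike: of the pairs that `t` leaves open, it connects
all or none. -/
theorem Refines.join {i j : Fin k} {t : CWExpr V k} (h : (join i j t).Refines G)
    (ht : (join i j t).WellFormed) : t.Refines G := by
  refine ⟨fun u v huv => h.1 u v (Or.inl huv), fun u u' v v' p q hu hu' hv hv' h₁ h₂ => ?_⟩
  have key : ∀ {a a' b b' : V}, t.HasLabel a p → t.HasLabel a' p → t.HasLabel b q →
      t.HasLabel b' q → ¬ t.Adj a b → (CWExpr.join i j t).Adj a b →
      (CWExpr.join i j t).Adj a' b' := by
    rintro a a' b b' ha ha' hb hb' hn (h | ⟨h, h'⟩ | ⟨h, h'⟩)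
    · exact (hn h).elim
    · have := ht.1.label_unique ha h
      have := ht.1.label_unique hb h'
      subst p q
      exact Or.inr (Or.inl ⟨ha', hb'⟩)
    · have := ht.1.label_unique ha h
      have := ht.1.label_unique hb h'
      subst p q
      exact Or.inr (Or.inr ⟨ha', hb'⟩)
  -- If the join connects one pair, it connects the other, and both are edges of G. Otherwise both
  -- pairs are still open after the join, and the property of the join applies.
  by_cases hp : (CWExpr.join i j t).Adj u v
  · exact iff_of_true (h.1 _ _ hp) (h.1 _ _ (key hu hu' hv hv' h₁ hp))
  · exact h.2 u u' v v' p q hu hu' hv hv' hp fun h' => hp (key hu' hu hv' hv h₂ h')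

/-- Relabelling only coarsens the partition into label classes, so equal labels before it are equal
labels after it, and it adds no edges. -/
theorem Refines.relabel {i j : Fin k} {t : CWExpr V k} (h : (relabel i j t).Refines G) :
    t.Refines G := by
  have key : ∀ p : Fin k, ∃ p', ∀ u, t.HasLabel u p → (CWExpr.relabel i j t).HasLabel u p' := by
    intro p
    by_cases hp : p = i
    · exact ⟨j, fun u hu => Or.inr ⟨hp ▸ hu, rfl⟩⟩
    · exact ⟨p, fun u hu => Or.inl ⟨hu, hp⟩⟩
  refine ⟨h.1, fun u u' v v' p q hu hu' hv hv' h₁ h₂ => ?_⟩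
  obtain ⟨p', hp'⟩ := key p
  obtain ⟨q', hq'⟩ := key q
  exact h.2 u u' v v' p' q' (hp' _ hu) (hp' _ hu') (hq' _ hv) (hq' _ hv') h₁ h₂

/-! ### Counting vertices, labels and pairs of classes -/

/-- The number of vertices of the generated graph. -/
noncomputable def numVerts (t : CWExpr V k) : ℕ := t.verts.ncard

theorem numVerts_pos [Finite V] (t : CWExpr V k) : 0 < t.numVerts :=
  (Set.ncard_pos (Set.toFinite _)).2 t.verts_nonempty

theorem numVerts_union [Finite V] {t₁ t₂ : CWExpr V k} (ht : (union t₁ t₂).WellFormed) :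
    (union t₁ t₂).numVerts = t₁.numVerts + t₂.numVerts :=
  Set.ncard_union_eq ht.2.2 (Set.toFinite _) (Set.toFinite _)

open Classical in
/-- The number of labels in use is at most the number of vertices. -/
theorem card_labels_le [Finite V] {t : CWExpr V k} (ht : t.WellFormed) :
    (Finset.univ.filter fun l => ∃ v, t.HasLabel v l).card ≤ t.numVerts := by
  have : ∀ l, ∃ v, (∃ v, t.HasLabel v l) → t.HasLabel v l := by
    intro l
    by_cases h : ∃ v, t.HasLabel v l
    · obtain ⟨v, hv⟩ := h
      exact ⟨v, fun _ => hv⟩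
    · exact ⟨t.verts_nonempty.some, fun h' => (h h').elim⟩
  choose f hf using this
  rw [← Set.ncard_coe_finset]
  refine Set.ncard_le_ncard_of_injOn f (fun l hl => ?_) (fun l hl l' hl' hll => ?_)
    (Set.toFinite _)
  · exact (hf l (by simpa using hl)).mem_verts
  · refine ht.label_unique (hf l (by simpa using hl)) ?_
    rw [hll]
    exact hf l' (by simpa using hl')

/-- A bound for the number of pairs of classes that meet when a graph with `a` vertices is put
together. -/
def pairBound (k a : ℕ) : ℕ := if a ≤ k then a * a else 2 * k * a - k * k

theorem pairBound_le (k a : ℕ) : pairBound k a ≤ 2 * k * a := by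
  unfold pairBound
  split_ifs with h
  · nlinarith
  · exact Nat.sub_le _ _

/-- The bound grows with slope 2·min(s, k) at s, so it is superadditive with slack at least min(a,
k)·min(b, k): the slack is 2ab when a + b ≤ k, at least ak when a ≤ k < b, and k² when both exceed
k. The case a, b ≤ k < a + b uses (k − a)(k − b) ≥ 0. -/
theorem pairBound_add {k a b x y : ℕ} (hxk : x ≤ k) (hxa : x ≤ a) (hyk : y ≤ k) (hyb : y ≤ b) :
    pairBound k a + pairBound k b + x * y ≤ pairBound k (a + b) := by
  unfold pairBound
  split_ifs with h₁ h₂ h₃ h₃ h₂ h₃ h₃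
  · nlinarith
  · have : k * k ≤ 2 * k * (a + b) := by nlinarith
    zify [this]
    zify at *
    have : (x:ℤ) * y ≤ a * b := by nlinarith
    nlinarith [mul_nonneg (sub_nonneg.2 h₁) (sub_nonneg.2 h₂)]
  · omega
  · have h1 : k * k ≤ 2 * k * (a + b) := by nlinarith
    have h2 : k * k ≤ 2 * k * b := by nlinarith
    zify [h1, h2]
    zify at *
    have : (x:ℤ) * y ≤ a * k := by nlinarith
    nlinarith
  · omega
  · have h1 : k * k ≤ 2 * k * (a + b) := by nlinarith
    have h2 : k * k ≤ 2 * k * a := by nlinarith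
    zify [h1, h2]
    zify at *
    have : (x:ℤ) * y ≤ k * b := by nlinarith
    nlinarith
  · omega
  · have h1 : k * k ≤ 2 * k * (a + b) := by nlinarith
    have h2 : k * k ≤ 2 * k * a := by nlinarith
    have h3 : k * k ≤ 2 * k * b := by nlinarith
    zify [h1, h2, h3]
    zify at *
    have : (x:ℤ) * y ≤ k * k := by nlinarith
    nlinarith

end CWExpr

/-! ### Arithmetic notation for machine expressions -/

namespace WordRAM

instance : Add Expr := ⟨.op .add⟩
instance : Sub Expr := ⟨.op .sub⟩
instance : Mul Expr := ⟨.op .mul⟩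
instance (c : ℕ) : OfNat Expr c := ⟨.const c⟩

theorem Expr.eval_reg (w : ℕ) (s : State) (x : ℕ) : (Expr.reg x).eval w s = s.reg x := rfl
theorem Expr.eval_cell (w : ℕ) (s : State) (a : ℕ) (e : Expr) :
    (Expr.cell a e).eval w s = s.arr a (e.eval w s) := rfl
theorem Expr.eval_add (w : ℕ) (s : State) (e f : Expr) :
    (e + f).eval w s = (e.eval w s + f.eval w s) % 2 ^ w := rfl
theorem Expr.eval_sub (w : ℕ) (s : State) (e f : Expr) :
    (e - f).eval w s = e.eval w s - f.eval w s := rfl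
theorem Expr.eval_mul (w : ℕ) (s : State) (e f : Expr) :
    (e * f).eval w s = (e.eval w s * f.eval w s) % 2 ^ w := rfl
theorem Expr.eval_two (w : ℕ) (s : State) : (2 : Expr).eval w s = 2 % 2 ^ w := rfl
theorem Expr.eval_three (w : ℕ) (s : State) : (3 : Expr).eval w s = 3 % 2 ^ w := rfl
theorem Expr.eval_four (w : ℕ) (s : State) : (4 : Expr).eval w s = 4 % 2 ^ w := rfl
theorem Expr.eval_zero (w : ℕ) (s : State) : (0 : Expr).eval w s = 0 := Nat.zero_mod _
theorem Expr.eval_one (w : ℕ) (s : State) : (1 : Expr).eval w s = 1 % 2 ^ w := rfl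

/-! ### Adjacency lists in memory -/

/-- Arrays `a` and `a + 1` hold adjacency lists of a digraph on the nodes below `N`: the list of
`x` has length `a[x]` and its `j`-th entry is the cell `j * N + x` of the array `a + 1`. -/
def Arc (N a : ℕ) (s : State) (x y : ℕ) : Prop :=
  x < N ∧ ∃ j < s.arr a x, s.arr (a + 1) (j * N + x) = y

/-- Append `y` to the list of `x`; register `3` holds the number of nodes. -/
def addArc (a : ℕ) (x y : Expr) : Cmd :=
  .seq (.write (a + 1) (.cell a x * .reg 3 + x) y) (.write a x (.cell a x + 1))

/-- Storing the j-th entries of all lists side by side lets every list grow without knowing its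
final length. The word length is compared with the total degree, since that is what the invariants
control. The values of `ex` and `ey` are required in all states with the same registers because `ex`
is evaluated again after the first write. -/
theorem runs_addArc {w a N x y : ℕ} {ex ey : Expr} {s : State}
    (hx : ∀ s', s'.reg = s.reg → ex.eval w s' = x) (hy : ∀ s', s'.reg = s.reg → ey.eval w s' = y)
    (hcx : ex.cost ≤ 3) (hcy : ey.cost ≤ 3) (hN : s.reg 3 = N) (hxN : x < N)
    (hw : (∑ u ∈ Finset.range N, s.arr a u + 1) * N + 1 < 2 ^ w) :
    Runs w (addArc a ex ey) s 26 fun s' =>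
      s'.reg = s.reg ∧ (∀ b, b ≠ a → b ≠ a + 1 → s'.arr b = s.arr b) ∧
      (∀ u v, Arc N a s' u v ↔ Arc N a s u v ∨ (u = x ∧ v = y)) ∧
      ∑ u ∈ Finset.range N, s'.arr a u = ∑ u ∈ Finset.range N, s.arr a u + 1 := by
  replace hw : (s.arr a x + 1) * N + 1 < 2 ^ w := by
    have := Finset.single_le_sum (f := s.arr a) (fun _ _ => Nat.zero_le _)
      (Finset.mem_range.2 hxN)
    have := Nat.mul_le_mul_right N (Nat.succ_le_succ this)
    simp only [Nat.succ_eq_add_one] at this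
    omega
  have hd : s.arr a x ≤ s.arr a x * N := Nat.le_mul_of_pos_right _ (by omega)
  rw [add_mul, one_mul] at hw
  refine Runs.of_run ⟨trivial, trivial⟩ ?_ ?_
  · simp only [addArc, Cmd.maxCost, HAdd.hAdd, Add.add, HMul.hMul, Mul.mul, Expr.cost]
    show ex.cost + 1 + 1 + 1 + ex.cost + 1 + ey.cost + 1 + (ex.cost + (ex.cost + 1 + 1 + 1) + 1) ≤ 26
    omega
  have e1 : s.arr a x * N % 2 ^ w = s.arr a x * N := Nat.mod_eq_of_lt (by omega)
  have e2 : (s.arr a x * N + x) % 2 ^ w = s.arr a x * N + x := Nat.mod_eq_of_lt (by omega)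
  have e3 : (s.arr a x + 1) % 2 ^ w = s.arr a x + 1 := Nat.mod_eq_of_lt (by omega)
  have e4 : 1 % 2 ^ w = 1 := Nat.mod_eq_of_lt (by omega)
  have hrun : (addArc a ex ey).run w s =
      (s.setArr (a + 1) (s.arr a x * N + x) y).setArr a x (s.arr a x + 1) := by
    simp only [addArc, Cmd.run, Expr.eval_add, Expr.eval_mul, Expr.eval_cell, Expr.eval_reg,
      Expr.eval_one, hx s rfl, hy s rfl, hN, e1, e2, e4,
      hx (s.setArr (a + 1) (s.arr a x * N + x) y) rfl, State.arr_setArr]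
    simp [e3]
  rw [hrun]
  refine ⟨rfl, fun b h₁ h₂ => by simp [h₁, h₂], fun u v => ?_, ?_⟩
  · simp only [Arc, State.arr_setArr, if_true, Nat.add_eq_left, one_ne_zero, if_false]
    have hne : (a = a + 1) = False := by simp
    simp only [hne, if_false]
    by_cases hu : u = x
    · subst hu
      simp only [Function.update_self, hxN, true_and]
      constructor
      · rintro ⟨j, hj, hv⟩
        rcases Nat.lt_succ_iff_lt_or_eq.1 hj with hj | rfl
        · left
          refine ⟨j, hj, ?_⟩
          rwa [Function.update_of_ne] at hv
          have := Nat.mul_lt_mul_of_pos_right hj (show 0 < N by omega)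
          omega
        · right
          simpa using hv.symm
      · rintro (⟨j, hj, hv⟩ | rfl)
        · refine ⟨j, by omega, ?_⟩
          rwa [Function.update_of_ne]
          have := Nat.mul_lt_mul_of_pos_right hj (show 0 < N by omega)
          omega
        · exact ⟨_, Nat.lt_succ_self _, by simp⟩
    · simp only [Function.update_of_ne hu, hu, false_and, or_false]
      refine and_congr_right fun huN => exists_congr fun j => and_congr_right fun hj => ?_
      rw [Function.update_of_ne]
      intro h
      apply hu
      -- Cells of different lists never coincide: the address modulo N is the node.
      have := congrArg (· % N) h
      simpa [Nat.add_mod, Nat.mod_eq_of_lt huN, Nat.mod_eq_of_lt hxN]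
        using this
  · have hne : (a = a + 1) = False := by simp
    simp only [State.arr_setArr, if_true, hne, if_false]
    rw [Finset.sum_update_of_mem (Finset.mem_range.2 hxN),
      ← Finset.add_sum_erase _ _ (Finset.mem_range.2 hxN), Finset.sdiff_singleton_eq_erase]
    omega

/-! ### Classes of vertices and the hub digraph -/

variable {n : ℕ}

/-- The meaning of a node reached by the search. An even node stands for some vertex of its
class, an odd node `x + 1` for all vertices of the class `x`. -/
def Sem (L : ℕ → Set (Fin n)) (z : ℕ) (P : Fin n → Prop) : Prop :=
  if z % 2 = 0 then ∃ v ∈ L z, P v else ∀ v ∈ L (z - 1), P v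

/-- Allocating the class `h` leaves the meaning of all earlier nodes alone, so soundness of old arcs
survives. -/
theorem sem_update {L : ℕ → Set (Fin n)} {h z : ℕ} {S : Set (Fin n)} {P : Fin n → Prop}
    (hz : z < h) : Sem (Function.update L h S) z P ↔ Sem L z P := by
  unfold Sem
  rw [Function.update_of_ne (by omega), Function.update_of_ne (by omega)]

/-- Reachability by arcs of length `0`, which are stored in array `5`. -/
def Reach (n : ℕ) (s : State) : ℕ → ℕ → Prop := Relation.ReflTransGen (Arc (4 * n) 5 s)

/-- `x` is a class with the set `S` of members: array `4` holds a member, there are arcs from the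
members to the class, and arcs from the class to its members. -/
structure IsClass (s : State) (L : ℕ → Set (Fin n)) (x : ℕ) (S : Set (Fin n)) : Prop where
  pos : 0 < x
  even : x % 2 = 0
  lt : x < s.reg 5
  eq : L x = S
  rep : ∃ v ∈ S, s.arr 4 x = v
  up : ∀ u ∈ S, Reach n s (2 * u + 3) x
  down : ∀ u ∈ S, Reach n s (x + 1) (2 * u + 3)

/-- The cell `p` of array `3` represents the set `S`. -/
def Cell (s : State) (L : ℕ → Set (Fin n)) (p : ℕ) (S : Set (Fin n)) : Prop :=
  (s.arr 3 p = 0 ∧ S = ∅) ∨ IsClass s L (s.arr 3 p) S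

theorem Cell.nonempty_iff {s : State} {L : ℕ → Set (Fin n)} {p : ℕ} {S : Set (Fin n)}
    (h : Cell s L p S) : S.Nonempty ↔ s.arr 3 p ≠ 0 := by
  rcases h with ⟨h, rfl⟩ | h
  · simp [h]
  · obtain ⟨v, hv, _⟩ := h.rep
    exact iff_of_true ⟨v, hv⟩ h.pos.ne'

theorem Cell.isClass {s : State} {L : ℕ → Set (Fin n)} {p : ℕ} {S : Set (Fin n)}
    (h : Cell s L p S) (h0 : s.arr 3 p ≠ 0) : IsClass s L (s.arr 3 p) S :=
  h.resolve_left fun h' => h0 h'.1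

/-- All arcs of `s` are arcs of `s'`. -/
def ArcMono (n : ℕ) (s s' : State) : Prop :=
  ∀ a, a = 5 ∨ a = 7 → ∀ x y, Arc (4 * n) a s x y → Arc (4 * n) a s' x y

theorem ArcMono.refl (s : State) : ArcMono n s s := fun _ _ _ _ h => h

theorem ArcMono.trans {s s' s'' : State} (h : ArcMono n s s') (h' : ArcMono n s' s'') :
    ArcMono n s s'' := fun a ha x y hxy => h' a ha x y (h a ha x y hxy)

theorem ArcMono.of_arr {s s' : State} (h : ∀ a, 5 ≤ a → a ≤ 8 → s'.arr a = s.arr a) :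
    ArcMono n s s' := by
  rintro a (rfl | rfl) x y hxy
  · unfold Arc; rw [h 5 (by omega) (by omega), h 6 (by omega) (by omega)]; exact hxy
  · unfold Arc; rw [h 7 (by omega) (by omega), h 8 (by omega) (by omega)]; exact hxy

theorem ArcMono.reach {s s' : State} (h : ArcMono n s s') {x y : ℕ} (hxy : Reach n s x y) :
    Reach n s' x y := Relation.ReflTransGen.mono (h 5 (Or.inl rfl)) _ _ hxy

theorem IsClass.mono {s s' : State} {L L' : ℕ → Set (Fin n)} {x : ℕ} {S : Set (Fin n)}
    (hx : IsClass s L x S) (h : ArcMono n s s') (h5 : s.reg 5 ≤ s'.reg 5)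
    (h4 : s'.arr 4 x = s.arr 4 x) (hL : L' x = L x) : IsClass s' L' x S :=
  ⟨hx.pos, hx.even, hx.lt.trans_le h5, hL.trans hx.eq, h4 ▸ hx.rep,
    fun u hu => h.reach (hx.up u hu), fun u hu => h.reach (hx.down u hu)⟩

/-- The arcs in memory let every edge between `u` and `v` be traversed. -/
def Covered (s : State) (u v : Fin n) : Prop :=
  ∃ x y, Reach n s (2 * u + 3) x ∧ Arc (4 * n) 7 s x (y + 1) ∧ Reach n s (y + 1) (2 * v + 3)

theorem Covered.mono {s s' : State} {u v : Fin n} (hc : Covered s u v) (h : ArcMono n s s') :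
    Covered s' u v := by
  obtain ⟨x, y, h₁, h₂, h₃⟩ := hc
  exact ⟨x, y, h.reach h₁, h 7 (Or.inr rfl) _ _ h₂, h.reach h₃⟩

/-- The cells of array `3` represent the sets `F p`, and the arcs in memory (of length `0` in the
arrays `5`, `6`, of length `1` in the arrays `7`, `8`) are sound for the graph `G`. There are `m`
classes besides the single vertices, `ν` vertices have been created and `ψ` pairs of classes
joined. -/
structure Hubs (k : ℕ) (G : SimpleGraph (Fin n)) (s : State) (F L : ℕ → Set (Fin n))
    (m ν ψ : ℕ) : Prop where
  next : s.reg 5 = 2 * (n + 1 + m)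
  finite : {p | (F p).Nonempty}.Finite
  count : m + {p | (F p).Nonempty}.ncard ≤ ν
  le_verts : ν ≤ n
  le_pairs : ψ ≤ 2 * k * n
  arcs : ∑ x ∈ Finset.range (4 * n), s.arr 5 x + ∑ x ∈ Finset.range (4 * n), s.arr 7 x
    ≤ ν + 4 * m + 2 * ψ
  lt : ∀ a, a = 5 ∨ a = 7 → ∀ x y, Arc (4 * n) a s x y → x < s.reg 5 ∧ y < s.reg 5
  sound_zero : ∀ x y, Arc (4 * n) 5 s x y → ∀ P, Sem L x P → Sem L y P
  sound_one : ∀ x y, Arc (4 * n) 7 s x y →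
    ∀ P, Sem L x P → Sem L y fun v => ∃ u, P u ∧ G.Adj u v
  leaf : ∀ v : Fin n, L (2 * v + 2) = {v}
  cell : ∀ p, Cell s L p (F p)

variable {k : ℕ} {G : SimpleGraph (Fin n)} {s : State} {F L : ℕ → Set (Fin n)} {m ν ψ w : ℕ}

/-- Words are long enough for the addresses that occur. -/
def Wide (n k w : ℕ) : Prop := 1 ≤ n ∧ 1 ≤ k ∧ 100 * (k * n * n) + 100 ≤ 2 ^ w

/-- By `count` there are at most ν ≤ n hubs, and ψ ≤ 2kn, so ν + 4m + 2ψ is at most n + 4n + 4kn. -/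
theorem Hubs.sum_deg_le (H : Hubs k G s F L m ν ψ) {a : ℕ} (ha : a = 5 ∨ a = 7) :
    ∑ x ∈ Finset.range (4 * n), s.arr a x ≤ 5 * n + 4 * (k * n) := by
  have := H.arcs
  have := H.count
  have := H.le_verts
  have h2 := H.le_pairs
  rw [mul_assoc] at h2
  rcases ha with rfl | rfl <;> omega

theorem Hubs.sum_deg_lt (H : Hubs k G s F L m ν ψ) (hw : Wide n k w) {a : ℕ}
    (ha : a = 5 ∨ a = 7) :
    (∑ x ∈ Finset.range (4 * n), s.arr a x + 5) * (4 * n) + 24 * n + 50 < 2 ^ w := by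
  have h := H.sum_deg_le ha
  obtain ⟨hn, hk, hw⟩ := hw
  have : n ≤ k * n := Nat.le_mul_of_pos_left _ hk
  have : k * n ≤ k * n * n := Nat.le_mul_of_pos_right _ hn
  have : (∑ x ∈ Finset.range (4 * n), s.arr a x + 5) * (4 * n) ≤ (14 * (k * n)) * (4 * n) :=
    Nat.mul_le_mul_right _ (by omega)
  have e : (14 * (k * n)) * (4 * n) = 56 * (k * n * n) := by ring
  omega

end WordRAM

/-! ### Merging classes -/

namespace WordRAM

variable {n k : ℕ} {G : SimpleGraph (Fin n)} {s : State} {F L : ℕ → Set (Fin n)} {m ν ψ w : ℕ}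

/-- The parts of the memory that operations on classes with local registers `b`, `b + 1`, …
do not change. -/
def Frame (b : ℕ) (s s' : State) : Prop :=
  (∀ r, r < b → r ≠ 5 → s'.reg r = s.reg r) ∧ ∀ a, a < 3 ∨ 8 < a → s'.arr a = s.arr a

theorem Frame.refl (b : ℕ) (s : State) : Frame b s s := ⟨fun _ _ _ => rfl, fun _ _ => rfl⟩

theorem Frame.trans {b : ℕ} {s s' s'' : State} (h : Frame b s s') (h' : Frame b s' s'') :
    Frame b s s'' :=
  ⟨fun r h₁ h₂ => (h'.1 r h₁ h₂).trans (h.1 r h₁ h₂), fun a ha => (h'.2 a ha).trans (h.2 a ha)⟩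

theorem Frame.anti {b b' : ℕ} {s s' : State} (h : Frame b s s') (hb : b' ≤ b) : Frame b' s s' :=
  ⟨fun r h₁ h₂ => h.1 r (by omega) h₂, h.2⟩

theorem Frame.setReg {b x : ℕ} (s : State) (v : ℕ) (hx : b ≤ x) : Frame b s (s.setReg x v) :=
  ⟨fun r h₁ _ => by simp [show r ≠ x by omega], fun _ _ => rfl⟩

/-- A change of cells of array `3` only. -/
theorem Hubs.of_cells (H : Hubs k G s F L m ν ψ) {s' : State} {F' : ℕ → Set (Fin n)}
    (h5 : s'.reg 5 = s.reg 5) (harr : ∀ a, 4 ≤ a → a ≤ 8 → s'.arr a = s.arr a)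
    (hfin : {p | (F' p).Nonempty}.Finite)
    (hcount : m + {p | (F' p).Nonempty}.ncard ≤ ν)
    (hcell : ∀ p, (s'.arr 3 p = 0 ∧ F' p = ∅) ∨ IsClass s L (s'.arr 3 p) (F' p)) :
    Hubs k G s' F' L m ν ψ where
  next := h5.trans H.next
  finite := hfin
  count := hcount
  le_verts := H.le_verts
  le_pairs := H.le_pairs
  arcs := by rw [harr 5 (by omega) (by omega), harr 7 (by omega) (by omega)]; exact H.arcs
  lt := by
    intro a ha x y h
    rw [h5]
    refine H.lt a ha x y ?_
    refine ArcMono.of_arr (fun b h₁ h₂ => (harr b (by omega) h₂).symm) a ha x y h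
  sound_zero x y h := H.sound_zero x y
    (ArcMono.of_arr (fun b h₁ h₂ => (harr b (by omega) h₂).symm) 5 (Or.inl rfl) x y h)
  sound_one x y h := H.sound_one x y
    (ArcMono.of_arr (fun b h₁ h₂ => (harr b (by omega) h₂).symm) 7 (Or.inr rfl) x y h)
  leaf := H.leaf
  cell p := by
    refine (hcell p).imp id fun h => h.mono ?_ h5.ge ?_ rfl
    · exact ArcMono.of_arr fun b h₁ h₂ => harr b (by omega) h₂
    · rw [harr 4 (by omega) (by omega)]

theorem Hubs.congr (H : Hubs k G s F L m ν ψ) {s' : State}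
    (h5 : s'.reg 5 = s.reg 5) (harr : ∀ a, 3 ≤ a → a ≤ 8 → s'.arr a = s.arr a) :
    Hubs k G s' F L m ν ψ :=
  H.of_cells h5 (fun a h₁ h₂ => harr a (by omega) h₂) H.finite H.count
    fun p => by rw [harr 3 (by omega) (by omega)]; exact H.cell p

/-- A new class for the union of the classes in registers `14` and `15`. -/
def newHub : Cmd :=
  .seq (.seq (.assign 16 (.reg 5)) (.seq (.assign 5 (.reg 16 + 2))
    (.write 4 (.reg 16) (.cell 4 (.reg 14))))) <|
  .seq (addArc 5 (.reg 14) (.reg 16)) <|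
  .seq (addArc 5 (.reg 15) (.reg 16)) <|
  .seq (addArc 5 (.reg 16 + 1) (.reg 14 + 1)) <|
  .seq (addArc 5 (.reg 16 + 1) (.reg 15 + 1)) <|
  .write 3 (.reg 13) (.reg 16)

/-- Two arcs lead up into the new even node and two lead down from the new odd node. The condition
`m + 2 ≤ n` is what places the odd node `h + 1 = 2 * (n + 1 + m) + 1` below 4n. -/
theorem runs_newHub (H : Hubs k G s F L m ν ψ) (hw : Wide n k w) (h3 : s.reg 3 = 4 * n)
    {q x y h : ℕ} (h13 : s.reg 13 = q) (h14 : s.reg 14 = x) (h15 : s.reg 15 = y)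
    (h5 : s.reg 5 = h) (hm : m + 2 ≤ n) (hx : x + 1 < 4 * n) (hy : y + 1 < 4 * n) :
    Runs w newHub s 150 fun s' => Frame 14 s s' ∧ s'.reg 5 = h + 2 ∧
      s'.arr 3 = Function.update (s.arr 3) q h ∧
      s'.arr 4 = Function.update (s.arr 4) h (s.arr 4 x) ∧
      s'.arr 7 = s.arr 7 ∧ s'.arr 8 = s.arr 8 ∧
      (∀ u v, Arc (4 * n) 5 s' u v ↔ Arc (4 * n) 5 s u v ∨ (u = x ∧ v = h) ∨ (u = y ∧ v = h) ∨
        (u = h + 1 ∧ v = x + 1) ∨ (u = h + 1 ∧ v = y + 1)) ∧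
      ∑ u ∈ Finset.range (4 * n), s'.arr 5 u = ∑ u ∈ Finset.range (4 * n), s.arr 5 u + 4 := by
  have hh : h = 2 * (n + 1 + m) := by rw [← h5, H.next]
  have hD := H.sum_deg_lt hw (Or.inl rfl)
  set D := ∑ x ∈ Finset.range (4 * n), s.arr 5 x with hDdef
  have hmul : ∀ c, c ≤ 5 → (D + c) * (4 * n) ≤ (D + 5) * (4 * n) := fun c hc =>
    Nat.mul_le_mul_right _ (by omega)
  have e1 : 1 % 2 ^ w = 1 := Nat.mod_eq_of_lt (by omega)
  have e2 : 2 % 2 ^ w = 2 := Nat.mod_eq_of_lt (by omega)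
  have e3 : (h + 2) % 2 ^ w = h + 2 := Nat.mod_eq_of_lt (by omega)
  have e4 : (h + 1) % 2 ^ w = h + 1 := Nat.mod_eq_of_lt (by omega)
  have e5 : (x + 1) % 2 ^ w = x + 1 := Nat.mod_eq_of_lt (by omega)
  have e6 : (y + 1) % 2 ^ w = y + 1 := Nat.mod_eq_of_lt (by omega)
  refine Runs.mono (B := 10 + (26 + (26 + (26 + (26 + 3))))) (Runs.seq ?_) (by norm_num)
    fun _ h => h
  refine Runs.of_run ⟨trivial, trivial, trivial⟩ (by decide) ?_
  have hrun : Cmd.run w (.seq (.assign 16 (.reg 5)) (.seq (.assign 5 (.reg 16 + 2))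
      (.write 4 (.reg 16) (.cell 4 (.reg 14))))) s =
      ((s.setReg 16 h).setReg 5 (h + 2)).setArr 4 h (s.arr 4 x) := by
    simp [Cmd.run, Expr.eval_add, Expr.eval_reg, Expr.eval_two, Expr.eval_cell, h5, h14, e2, e3]
  rw [hrun]
  set s₀ := ((s.setReg 16 h).setReg 5 (h + 2)).setArr 4 h (s.arr 4 x) with hs₀
  have r13 : s₀.reg 13 = q := by simp [hs₀, h13]
  have r14 : s₀.reg 14 = x := by simp [hs₀, h14]
  have r15 : s₀.reg 15 = y := by simp [hs₀, h15]
  have r16 : s₀.reg 16 = h := by simp [hs₀]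
  have r3 : s₀.reg 3 = 4 * n := by simp [hs₀, h3]
  have hA : ∀ u v, Arc (4 * n) 5 s₀ u v ↔ Arc (4 * n) 5 s u v := by
    intro u v; simp [Arc, hs₀]
  have hD0 : ∑ x ∈ Finset.range (4 * n), s₀.arr 5 x = D := by simp [hs₀, hDdef]
  refine Runs.seq ((runs_addArc (x := x) (y := h) (N := 4 * n) (fun s' h => ?_) (fun s' h => ?_)
    (by decide) (by decide) r3 (by omega) ?_).mono le_rfl ?_)
  · rw [Expr.eval_reg, h, r14]
  · rw [Expr.eval_reg, h, r16]
  · rw [hD0]; have := hmul 1 (by omega); omega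
  rintro s₁ ⟨R₁, A₁, E₁, D₁⟩
  refine Runs.seq ((runs_addArc (x := y) (y := h) (N := 4 * n) (fun s' h => ?_) (fun s' h => ?_)
    (by decide) (by decide) (by rw [R₁, r3]) (by omega) ?_).mono le_rfl ?_)
  · rw [Expr.eval_reg, h, R₁, r15]
  · rw [Expr.eval_reg, h, R₁, r16]
  · rw [D₁, hD0]; have := hmul 2 (by omega); simp only [add_assoc, Nat.reduceAdd]; omega
  rintro s₂ ⟨R₂, A₂, E₂, D₂⟩
  refine Runs.seq ((runs_addArc (x := h + 1) (y := x + 1) (N := 4 * n) (fun s' h => ?_)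
    (fun s' h => ?_) (by decide) (by decide) (by rw [R₂, R₁, r3]) (by omega) ?_).mono le_rfl ?_)
  · rw [Expr.eval_add, Expr.eval_reg, Expr.eval_one, h, R₂, R₁, r16, e1, e4]
  · rw [Expr.eval_add, Expr.eval_reg, Expr.eval_one, h, R₂, R₁, r14, e1, e5]
  · rw [D₂, D₁, hD0]; have := hmul 3 (by omega); simp only [add_assoc, Nat.reduceAdd]; omega
  rintro s₃ ⟨R₃, A₃, E₃, D₃⟩
  refine Runs.seq ((runs_addArc (x := h + 1) (y := y + 1) (N := 4 * n) (fun s' h => ?_)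
    (fun s' h => ?_) (by decide) (by decide) (by rw [R₃, R₂, R₁, r3]) (by omega) ?_).mono le_rfl ?_)
  · rw [Expr.eval_add, Expr.eval_reg, Expr.eval_one, h, R₃, R₂, R₁, r16, e1, e4]
  · rw [Expr.eval_add, Expr.eval_reg, Expr.eval_one, h, R₃, R₂, R₁, r15, e1, e6]
  · rw [D₃, D₂, D₁, hD0]; have := hmul 4 (by omega); simp only [add_assoc, Nat.reduceAdd]; omega
  rintro s₄ ⟨R₄, A₄, E₄, D₄⟩
  refine Runs.of_run trivial (by decide) ?_
  have hR : s₄.reg = s₀.reg := by rw [R₄, R₃, R₂, R₁]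
  have hArr : ∀ b, b ≠ 5 → b ≠ 6 → s₄.arr b = s₀.arr b := fun b h₁ h₂ => by
    rw [A₄ b h₁ h₂, A₃ b h₁ h₂, A₂ b h₁ h₂, A₁ b h₁ h₂]
  have hrun' : Cmd.run w (.write 3 (.reg 13) (.reg 16)) s₄ = s₄.setArr 3 q h := by
    simp [Cmd.run, Expr.eval_reg, hR, r13, r16]
  rw [hrun']
  refine ⟨⟨fun r h₁ h₂ => ?_, fun a ha => ?_⟩, ?_, ?_, ?_, ?_, ?_, fun u v => ?_, ?_⟩
  · rw [State.reg_setArr, hR]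
    simp [hs₀, h₂, show r ≠ 16 by omega]
  · rw [State.arr_setArr, if_neg (by omega), hArr a (by omega) (by omega)]
    simp [hs₀, show a ≠ 4 by omega]
  · rw [State.reg_setArr, hR]; simp [hs₀]
  · rw [State.arr_setArr, if_pos rfl, hArr 3 (by omega) (by omega)]
    simp [hs₀]
  · rw [State.arr_setArr, if_neg (by omega), hArr 4 (by omega) (by omega)]
    simp [hs₀]
  · rw [State.arr_setArr, if_neg (by omega), hArr 7 (by omega) (by omega)]
    simp [hs₀]
  · rw [State.arr_setArr, if_neg (by omega), hArr 8 (by omega) (by omega)]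
    simp [hs₀]
  · have : Arc (4 * n) 5 (s₄.setArr 3 q h) u v ↔ Arc (4 * n) 5 s₄ u v := by simp [Arc]
    rw [this, E₄, E₃, E₂, E₁, hA]
    simp only [or_assoc]
  · have : (s₄.setArr 3 q h).arr 5 = s₄.arr 5 := by simp
    rw [this, D₄, D₃, D₂, D₁, hD0]

-- This is the bookkeeping for `count`: the number of nonempty cells drops by one when both cells
-- are nonempty, and otherwise does not grow.
open Classical in
theorem nonempty_merge {p q : ℕ} (hpq : p ≠ q) :
    {r | (Function.update (Function.update F q (F p ∪ F q)) p ∅ r).Nonempty} =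
      if (F p).Nonempty ∧ ¬ (F q).Nonempty then insert q ({r | (F r).Nonempty} \ {p})
      else {r | (F r).Nonempty} \ {p} := by
  ext r
  by_cases hp : (F p).Nonempty <;> by_cases hq : (F q).Nonempty <;> by_cases h₁ : r = p <;>
    by_cases h₂ : r = q <;> simp_all [Function.update_apply, Set.union_nonempty]

theorem Hubs.merge_finite (H : Hubs k G s F L m ν ψ) {p q : ℕ} (hpq : p ≠ q) :
    {r | (Function.update (Function.update F q (F p ∪ F q)) p ∅ r).Nonempty}.Finite := by
  rw [nonempty_merge hpq]
  split_ifs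
  · exact (H.finite.sdiff).insert _
  · exact H.finite.sdiff

/-- Merge the class in the cell `reg 12` of array `3` into the class in the cell `reg 13`. -/
def merge : Cmd :=
  .seq (.seq (.assign 14 (.cell 3 (.reg 12))) (.assign 15 (.cell 3 (.reg 13)))) <|
  .seq (.cond (.reg 14) (.cond (.reg 15) newHub (.write 3 (.reg 13) (.reg 14))) .skip) <|
  .write 3 (.reg 12) 0

/-- A new class made from two nonempty classes. -/
theorem Hubs.add_hub (H : Hubs k G s F L m ν ψ) {p q h : ℕ} (hpq : p ≠ q)
    (h5 : s.reg 5 = h)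
    (hp : IsClass s L (s.arr 3 p) (F p)) (hq : IsClass s L (s.arr 3 q) (F q)) {s' : State}
    (k5 : s'.reg 5 = h + 2)
    (a3 : s'.arr 3 = Function.update (Function.update (s.arr 3) q h) p 0)
    (a4 : s'.arr 4 = Function.update (s.arr 4) h (s.arr 4 (s.arr 3 p)))
    (a7 : s'.arr 7 = s.arr 7) (a8 : s'.arr 8 = s.arr 8)
    (hA : ∀ u v, Arc (4 * n) 5 s' u v ↔ Arc (4 * n) 5 s u v ∨ (u = s.arr 3 p ∧ v = h) ∨
      (u = s.arr 3 q ∧ v = h) ∨ (u = h + 1 ∧ v = s.arr 3 p + 1) ∨ (u = h + 1 ∧ v = s.arr 3 q + 1))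
    (hD : ∑ u ∈ Finset.range (4 * n), s'.arr 5 u = ∑ u ∈ Finset.range (4 * n), s.arr 5 u + 4) :
    Hubs k G s' (Function.update (Function.update F q (F p ∪ F q)) p ∅)
      (Function.update L h (F p ∪ F q)) (m + 1) ν ψ ∧ ArcMono n s s' := by
  have hh : h = 2 * (n + 1 + m) := by rw [← h5, H.next]
  have hA7 : ∀ u v, Arc (4 * n) 7 s' u v ↔ Arc (4 * n) 7 s u v := by
    intro u v; simp [Arc, a7, a8]
  have hmono : ArcMono n s s' := by
    rintro a (rfl | rfl) u v huv
    · exact (hA u v).2 (Or.inl huv)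
    · exact (hA7 u v).2 huv
  have hpl := hp.lt
  have hql := hq.lt
  have hpn : (F p).Nonempty := let ⟨v, hv, _⟩ := hp.rep; ⟨v, hv⟩
  have hqn : (F q).Nonempty := let ⟨v, hv, _⟩ := hq.rep; ⟨v, hv⟩
  have hold : ∀ {x S}, IsClass s L x S → IsClass s' (Function.update L h (F p ∪ F q)) x S := by
    intro x S hx
    have := hx.lt
    refine hx.mono hmono (by omega) ?_ ?_
    · rw [a4, Function.update_of_ne (by omega)]
    · rw [Function.update_of_ne (by omega)]
  refine ⟨⟨by omega, H.merge_finite hpq, ?_, H.le_verts, H.le_pairs, ?_, ?_, ?_, ?_, ?_, ?_⟩, hmono⟩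
  -- The cell `p` becomes empty, which pays for the additional hub.
  · rw [nonempty_merge hpq, if_neg (by simp [hqn])]
    have := Set.ncard_sdiff_singleton_add_one (a := p) (s := {r | (F r).Nonempty}) hpn H.finite
    have := H.count
    omega
  · have := H.arcs
    rw [hD, a7]
    omega
  · rintro a (rfl | rfl) u v huv
    · rcases (hA u v).1 huv with h' | h' | h' | h' | h'
      · have := H.lt 5 (Or.inl rfl) u v h'; omega
      all_goals omega
    · have := H.lt 7 (Or.inr rfl) u v ((hA7 u v).1 huv); omega
  · intro u v huv P hP
    have hodd : (h + 1) % 2 ≠ 0 := by omega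
    have heven : h % 2 = 0 := by omega
    -- Going up, an existential statement passes to a larger class; going down, a universal one
    -- passes to a smaller class.
    rcases (hA u v).1 huv with h' | ⟨rfl, rfl⟩ | ⟨rfl, rfl⟩ | ⟨rfl, rfl⟩ | ⟨rfl, rfl⟩
    · have := H.lt 5 (Or.inl rfl) u v h'
      rw [sem_update (by omega)] at hP ⊢
      exact H.sound_zero u v h' P hP
    · rw [sem_update (by omega)] at hP
      simp only [Sem, hp.even, heven, if_true, hp.eq, Function.update_self] at hP ⊢
      obtain ⟨v, hv, hPv⟩ := hP
      exact ⟨v, Or.inl hv, hPv⟩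
    · rw [sem_update (by omega)] at hP
      simp only [Sem, hq.even, heven, if_true, hq.eq, Function.update_self] at hP ⊢
      obtain ⟨v, hv, hPv⟩ := hP
      exact ⟨v, Or.inr hv, hPv⟩
    · have := hp.even
      have : (s.arr 3 p + 1) % 2 ≠ 0 := by omega
      rw [sem_update (by omega)]
      simp only [Sem, hodd, this, if_false, Nat.add_sub_cancel, hp.eq, Function.update_self] at hP ⊢
      exact fun v hv => hP v (Or.inl hv)
    · have := hq.even
      have : (s.arr 3 q + 1) % 2 ≠ 0 := by omega
      rw [sem_update (by omega)]
      simp only [Sem, hodd, this, if_false, Nat.add_sub_cancel, hq.eq, Function.update_self] at hP ⊢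
      exact fun v hv => hP v (Or.inr hv)
  · intro u v huv P hP
    have huv := (hA7 u v).1 huv
    have := H.lt 7 (Or.inr rfl) u v huv
    rw [sem_update (by omega)] at hP ⊢
    exact H.sound_one u v huv P hP
  · intro v
    rw [Function.update_of_ne (by omega), H.leaf]
  · intro r
    unfold Cell
    rw [a3]
    by_cases hrp : r = p
    · subst hrp; simp
    rw [Function.update_of_ne hrp, Function.update_of_ne hrp]
    by_cases hrq : r = q
    · subst hrq
      simp only [Function.update_self]
      have harc : ∀ {u v}, _ → Reach n s' u v := fun {u v} h => Relation.ReflTransGen.single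
        ((hA u v).2 h)
      right
      refine ⟨by omega, by omega, by omega, by simp, ?_, ?_, ?_⟩
      · obtain ⟨v, hv, hv'⟩ := hp.rep
        exact ⟨v, Or.inl hv, by simp [a4, hv']⟩
      · rintro u (hu | hu)
        · exact ((hold hp).up u hu).trans (harc (by simp))
        · exact ((hold hq).up u hu).trans (harc (by simp))
      · rintro u (hu | hu)
        · exact Relation.ReflTransGen.trans (harc (by simp)) ((hold hp).down u hu)
        · exact Relation.ReflTransGen.trans (harc (by simp)) ((hold hq).down u hu)
    · rw [Function.update_of_ne hrq, Function.update_of_ne hrq]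
      exact (H.cell r).imp id hold

theorem runs_merge (H : Hubs k G s F L m ν ψ) (hw : Wide n k w) (h3 : s.reg 3 = 4 * n)
    {p q : ℕ} (h12 : s.reg 12 = p) (h13 : s.reg 13 = q) (hpq : p ≠ q) :
    Runs w merge s 200 fun s' => (∃ L' m', Hubs k G s'
      (Function.update (Function.update F q (F p ∪ F q)) p ∅) L' m' ν ψ) ∧
      Frame 14 s s' ∧ ArcMono n s s' := by
  refine Runs.mono (B := 6 + (4 + 150 + 3)) (Runs.seq ?_) (by norm_num) fun _ h => h
  refine Runs.of_run ⟨trivial, trivial⟩ (by decide) ?_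
  have hrun : Cmd.run w (.seq (.assign 14 (.cell 3 (.reg 12))) (.assign 15 (.cell 3 (.reg 13)))) s
      = (s.setReg 14 (s.arr 3 p)).setReg 15 (s.arr 3 q) := by
    simp [Cmd.run, Expr.eval_reg, Expr.eval_cell, h12, h13]
  rw [hrun]
  set s₀ := (s.setReg 14 (s.arr 3 p)).setReg 15 (s.arr 3 q) with hs₀
  have r12 : s₀.reg 12 = p := by simp [hs₀, h12]
  have r13 : s₀.reg 13 = q := by simp [hs₀, h13]
  have r14 : s₀.reg 14 = s.arr 3 p := by simp [hs₀]
  have r15 : s₀.reg 15 = s.arr 3 q := by simp [hs₀]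
  have r3 : s₀.reg 3 = 4 * n := by simp [hs₀, h3]
  have ha : s₀.arr = s.arr := by simp [hs₀]
  have hf : Frame 14 s s₀ := ⟨fun r h _ => by
    simp [hs₀, show r ≠ 14 by omega, show r ≠ 15 by omega], fun a _ => by rw [ha]⟩
  have H₀ : Hubs k G s₀ F L m ν ψ := H.congr (by simp [hs₀]) fun a _ _ => by rw [ha]
  -- The case in which one of the two classes is empty: no hub is created and `c` is the class left
  -- in the cell `q`.
  have hsimple : ∀ c, (∀ r, (Function.update (Function.update (s.arr 3) q c) p 0 r = 0 ∧
      Function.update (Function.update F q (F p ∪ F q)) p ∅ r = ∅) ∨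
      IsClass s₀ L (Function.update (Function.update (s.arr 3) q c) p 0 r)
        (Function.update (Function.update F q (F p ∪ F q)) p ∅ r)) →
      ¬ ((F p).Nonempty ∧ (F q).Nonempty) → ∀ s', s'.reg = s₀.reg →
      (∀ a, a ≠ 3 → s'.arr a = s₀.arr a) →
      s'.arr 3 = Function.update (Function.update (s.arr 3) q c) p 0 →
      (∃ L' m', Hubs k G s'
      (Function.update (Function.update F q (F p ∪ F q)) p ∅) L' m' ν ψ) ∧
      Frame 14 s s' ∧ ArcMono n s s' := by
    intro c hc hne s' hr hs' h3'
    refine ⟨⟨L, m, H₀.of_cells (by rw [hr]) (fun a h₁ h₂ => hs' a (by omega))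
      (H.merge_finite hpq) ?_ fun r => ?_⟩, hf.trans ⟨fun r _ _ => by rw [hr],
      fun a ha' => hs' a (by omega)⟩, ArcMono.of_arr fun a h₁ h₂ => ?_⟩
    · have hcount := H.count
      rw [nonempty_merge hpq]
      split_ifs with hif
      · have := Set.ncard_sdiff_singleton_add_one (a := p) (s := {r | (F r).Nonempty}) hif.1
          H.finite
        have := Set.ncard_insert_le q ({r | (F r).Nonempty} \ {p})
        omega
      · have := Set.ncard_le_ncard (s := {r | (F r).Nonempty} \ {p}) Set.sdiff_subset H.finite
        omega
    · rw [h3']; exact hc r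
    · rw [hs' a (by omega), ha]
  have hcell := fun r => H₀.cell r
  simp only [Cell, ha] at hcell
  refine Runs.seq (Runs.mono (B := (Expr.reg 14).cost + 1 + ((Expr.reg 15).cost + 1 + 150))
    (Runs.cond (fun h14 => Runs.cond (fun h15 => ?_) fun h15 => ?_) fun h14 => ?_) (by decide)
    fun _ h => h)
  · rw [Expr.eval_reg, r14] at h14
    rw [Expr.eval_reg, r15] at h15
    have cp := (hcell p).resolve_left fun h => h14 h.1
    have cq := (hcell q).resolve_left fun h => h15 h.1
    -- Two nonempty cells give m + 2 ≤ ν ≤ n, so there is room for one more hub.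
    have hcard : ({p, q} : Set ℕ).ncard ≤ {r | (F r).Nonempty}.ncard := by
      refine Set.ncard_le_ncard ?_ H.finite
      rintro r (rfl | rfl)
      · obtain ⟨v, hv, _⟩ := cp.rep; exact ⟨v, hv⟩
      · obtain ⟨v, hv, _⟩ := cq.rep; exact ⟨v, hv⟩
    rw [Set.ncard_pair hpq] at hcard
    have hcount := H.count
    have hv := H.le_verts
    have hnext := H₀.next
    have := cp.lt
    have := cq.lt
    refine (runs_newHub H₀ hw r3 r13 r14 r15 rfl (by omega) (by omega) (by omega)).mono le_rfl ?_
    rintro s' ⟨hF, k5, a3, a4, a7, a8, hA, hD⟩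
    refine Runs.of_run trivial (by decide) ?_
    have hrun : Cmd.run w (.write 3 (.reg 12) 0) s' = s'.setArr 3 p 0 := by
      simp [Cmd.run, Expr.eval_reg, Expr.eval_zero, hF.1 12, r12]
    rw [hrun]
    rw [← ha] at cp cq hA a4
    obtain ⟨h₁, h₂⟩ := H₀.add_hub (s' := s'.setArr 3 p 0) hpq rfl cp cq k5
      (by simp [a3]) (by simpa using a4) (by simpa using a7) (by simpa using a8)
      (fun u v => by rw [← hA u v]; simp [Arc]) (by simpa using hD)
    refine ⟨⟨_, _, h₁⟩, (hf.trans hF).trans ⟨fun _ _ _ => rfl, fun a ha' => ?_⟩, ?_⟩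
    · rw [State.arr_setArr, if_neg (by omega)]
    · exact (ArcMono.of_arr fun a _ _ => by rw [ha]).trans h₂
  · rw [Expr.eval_reg, r14] at h14
    rw [Expr.eval_reg, r15] at h15
    have cp := (hcell p).resolve_left fun h => h14 h.1
    have cq : F q = ∅ := ((hcell q).resolve_right fun h => h.pos.ne' h15).2
    refine Runs.of_run trivial (by decide) (Runs.of_run trivial (by decide) ?_)
    refine hsimple (s.arr 3 p) (fun r => ?_) (by simp [cq]) _ rfl (fun a ha => ?_) ?_
    · by_cases hrp : r = p
      · subst hrp; simp
      rw [Function.update_of_ne hrp, Function.update_of_ne hrp]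
      by_cases hrq : r = q
      · subst hrq; simpa [cq] using Or.inr cp
      rw [Function.update_of_ne hrq, Function.update_of_ne hrq]
      exact hcell r
    · simp [Cmd.run, ha]
    · simp [Cmd.run, Expr.eval_reg, Expr.eval_zero, r12, r13, r14, ha]
  · rw [Expr.eval_reg, r14] at h14
    have cp : F p = ∅ := ((hcell p).resolve_right fun h => h.pos.ne' h14).2
    refine Runs.of_run trivial (by decide) (Runs.of_run trivial (by decide) ?_)
    refine hsimple (s.arr 3 q) (fun r => ?_) (by simp [cp]) _ rfl (fun a ha => ?_) ?_
    · by_cases hrp : r = p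
      · subst hrp; simp
      rw [Function.update_of_ne hrp, Function.update_of_ne hrp]
      by_cases hrq : r = q
      · subst hrq; simpa [cp] using hcell r
      rw [Function.update_of_ne hrq, Function.update_of_ne hrq]
      exact hcell r
    · simp [Cmd.run, ha]
    · simp [Cmd.run, Expr.eval_reg, Expr.eval_zero, r12, ha]

end WordRAM

/-! ### Arcs of length 1 and classes of single vertices -/

namespace WordRAM

variable {n k : ℕ} {G : SimpleGraph (Fin n)} {s : State} {F L : ℕ → Set (Fin n)} {m ν ψ w : ℕ}

theorem Hubs.setReg (H : Hubs k G s F L m ν ψ) {x : ℕ} (v : ℕ) (hx : x ≠ 5) :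
    Hubs k G (s.setReg x v) F L m ν ψ :=
  H.congr (by simp [hx.symm]) fun a _ _ => rfl

/-- One nonempty cell already forces m < n, so the 4n nodes suffice for all classes in use. -/
theorem Hubs.lt_nodes (H : Hubs k G s F L m ν ψ) {p x : ℕ} {S : Set (Fin n)}
    (hp : (F p).Nonempty) (hx : IsClass s L x S) : x + 1 < 4 * n := by
  have h1 := H.count
  have h2 : 0 < {p | (F p).Nonempty}.ncard := (Set.ncard_pos H.finite).2 ⟨p, hp⟩
  have h3 := H.le_verts
  have h4 := hx.lt
  have h5 := H.next
  have h6 := hx.even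
  omega

/-- Arcs of length `1` between the classes in registers `14` and `15`. -/
def link : Cmd :=
  .seq (addArc 7 (.reg 14) (.reg 15 + 1)) (addArc 7 (.reg 15) (.reg 14 + 1))

/-- Two arcs serve all edges between `S` and `T`. They are sound because the classes are completely
joined: whichever member of one class has the property, all members of the other are adjacent to it.
-/
theorem runs_link (H : Hubs k G s F L m ν ψ) (hw : Wide n k w) (h3 : s.reg 3 = 4 * n)
    {x y p : ℕ} {S T : Set (Fin n)} (h14 : s.reg 14 = x) (h15 : s.reg 15 = y)
    (hp : (F p).Nonempty)
    (hx : IsClass s L x S) (hy : IsClass s L y T) (hST : ∀ u ∈ S, ∀ v ∈ T, G.Adj u v)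
    (hψ : ψ + 1 ≤ 2 * k * n) :
    Runs w link s 52 fun s' => Hubs k G s' F L m ν (ψ + 1) ∧ Frame 14 s s' ∧ ArcMono n s s' ∧
      ∀ u ∈ S, ∀ v ∈ T, Covered s' u v ∧ Covered s' v u := by
  have hD := H.sum_deg_lt hw (Or.inr rfl)
  set D := ∑ x ∈ Finset.range (4 * n), s.arr 7 x with hDdef
  have hmul : ∀ c, c ≤ 5 → (D + c) * (4 * n) ≤ (D + 5) * (4 * n) := fun c hc =>
    Nat.mul_le_mul_right _ (by omega)
  have hxl := H.lt_nodes hp hx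
  have hyl := H.lt_nodes hp hy
  have e1 : 1 % 2 ^ w = 1 := Nat.mod_eq_of_lt (by omega)
  have e5 : (x + 1) % 2 ^ w = x + 1 := Nat.mod_eq_of_lt (by omega)
  have e6 : (y + 1) % 2 ^ w = y + 1 := Nat.mod_eq_of_lt (by omega)
  refine Runs.mono (B := 26 + 26) (Runs.seq ?_) le_rfl fun _ h => h
  refine (runs_addArc (x := x) (y := y + 1) (N := 4 * n) (fun s' h => ?_) (fun s' h => ?_)
    (by decide) (by decide) h3 (by omega) ?_).mono le_rfl ?_
  · rw [Expr.eval_reg, h, h14]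
  · rw [Expr.eval_add, Expr.eval_reg, Expr.eval_one, h, h15, e1, e6]
  · rw [← hDdef]; have := hmul 1 (by omega); omega
  rintro s₁ ⟨R₁, A₁, E₁, D₁⟩
  refine (runs_addArc (x := y) (y := x + 1) (N := 4 * n) (fun s' h => ?_) (fun s' h => ?_)
    (by decide) (by decide) (by rw [R₁, h3]) (by omega) ?_).mono le_rfl ?_
  · rw [Expr.eval_reg, h, R₁, h15]
  · rw [Expr.eval_add, Expr.eval_reg, Expr.eval_one, h, R₁, h14, e1, e5]
  · rw [D₁, ← hDdef]; have := hmul 2 (by omega); simp only [add_assoc, Nat.reduceAdd]; omega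
  rintro s₂ ⟨R₂, A₂, E₂, D₂⟩
  have hR : s₂.reg = s.reg := by rw [R₂, R₁]
  have hA : ∀ b, b ≠ 7 → b ≠ 8 → s₂.arr b = s.arr b := fun b h₁ h₂ => by
    rw [A₂ b h₁ h₂, A₁ b h₁ h₂]
  have hE : ∀ u v, Arc (4 * n) 7 s₂ u v ↔ Arc (4 * n) 7 s u v ∨ (u = x ∧ v = y + 1) ∨
      (u = y ∧ v = x + 1) := by
    intro u v; rw [E₂, E₁, or_assoc]
  have hE5 : ∀ u v, Arc (4 * n) 5 s₂ u v ↔ Arc (4 * n) 5 s u v := by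
    intro u v; simp [Arc, hA 5, hA 6]
  have hmono : ArcMono n s s₂ := by
    rintro a (rfl | rfl) u v huv
    · exact (hE5 u v).2 huv
    · exact (hE u v).2 (Or.inl huv)
  refine ⟨⟨by rw [hR, H.next], H.finite, H.count, H.le_verts, hψ, ?_, ?_, ?_, ?_, H.leaf, ?_⟩,
    ⟨fun r _ _ => by rw [hR], fun a ha => hA a (by omega) (by omega)⟩, hmono, ?_⟩
  · have := H.arcs
    rw [D₂, D₁, hA 5 (by omega) (by omega)]
    omega
  · rw [hR]
    have := hx.lt
    have := hx.even
    have := hy.lt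
    have := hy.even
    have := H.next
    rintro a (rfl | rfl) u v huv
    · exact H.lt 5 (Or.inl rfl) u v ((hE5 u v).1 huv)
    · rcases (hE u v).1 huv with h | h | h
      · exact H.lt 7 (Or.inr rfl) u v h
      all_goals omega
  · exact fun u v huv => H.sound_zero u v ((hE5 u v).1 huv)
  · have hxo : (x + 1) % 2 ≠ 0 := by have := hx.even; omega
    have hyo : (y + 1) % 2 ≠ 0 := by have := hy.even; omega
    intro u v huv P hP
    rcases (hE u v).1 huv with h | ⟨rfl, rfl⟩ | ⟨rfl, rfl⟩
    · exact H.sound_one u v h P hP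
    · simp only [Sem, hx.even, hyo, if_true, if_false, Nat.add_sub_cancel, hx.eq, hy.eq] at hP ⊢
      obtain ⟨a, ha, hPa⟩ := hP
      exact fun b hb => ⟨a, hPa, hST a ha b hb⟩
    · simp only [Sem, hy.even, hxo, if_true, if_false, Nat.add_sub_cancel, hx.eq, hy.eq] at hP ⊢
      obtain ⟨a, ha, hPa⟩ := hP
      exact fun b hb => ⟨a, hPa, (hST b hb a ha).symm⟩
  · intro r
    unfold Cell
    rw [hA 3 (by omega) (by omega)]
    exact (H.cell r).imp id fun h => h.mono hmono (by rw [hR])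
      (by rw [hA 4 (by omega) (by omega)]) rfl
  · intro u hu v hv
    exact ⟨⟨x, y, hmono.reach (hx.up u hu), (hE _ _).2 (by simp), hmono.reach (hy.down v hv)⟩,
      ⟨y, x, hmono.reach (hy.up v hv), (hE _ _).2 (by simp), hmono.reach (hx.down u hu)⟩⟩

/-- A new class in the cell `reg 12` of array `3` for the single vertex in register `9`. -/
def newVertex : Cmd :=
  .seq (.seq (.assign 14 (2 * .reg 9 + 2)) (.write 4 (.reg 14) (.reg 9))) <|
  .seq (addArc 5 (.reg 14 + 1) (.reg 14)) (.write 3 (.reg 12) (.reg 14))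

/-- The arc added here turns "all members" into "some member", which is sound only because the class
is a singleton. It is what allows a path that has come down to a vertex to go up again. -/
theorem runs_newVertex (H : Hubs k G s F L m ν ψ) (hw : Wide n k w) (h3 : s.reg 3 = 4 * n)
    {p : ℕ} {v : Fin n} (h12 : s.reg 12 = p) (h9 : s.reg 9 = v) (hp : F p = ∅)
    (hν : ν + 1 ≤ n) :
    Runs w newVertex s 50 fun s' => Hubs k G s' (Function.update F p {v}) L m (ν + 1) ψ ∧
      Frame 14 s s' ∧ ArcMono n s s' := by
  have hD := H.sum_deg_lt hw (Or.inl rfl)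
  set D := ∑ x ∈ Finset.range (4 * n), s.arr 5 x with hDdef
  have hmul : ∀ c, c ≤ 5 → (D + c) * (4 * n) ≤ (D + 5) * (4 * n) := fun c hc =>
    Nat.mul_le_mul_right _ (by omega)
  have hv := v.isLt
  have hnext := H.next
  have e1 : 1 % 2 ^ w = 1 := Nat.mod_eq_of_lt (by omega)
  have e2 : 2 % 2 ^ w = 2 := Nat.mod_eq_of_lt (by omega)
  have e3 : 2 * v.val % 2 ^ w = 2 * v.val := Nat.mod_eq_of_lt (by omega)
  have e4 : (2 * v.val + 2) % 2 ^ w = 2 * v.val + 2 := Nat.mod_eq_of_lt (by omega)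
  have e5 : (2 * v.val + 2 + 1) % 2 ^ w = 2 * v.val + 3 := Nat.mod_eq_of_lt (by omega)
  refine Runs.mono (B := 9 + (26 + 3)) (Runs.seq ?_) (by norm_num) fun _ h => h
  refine Runs.of_run ⟨trivial, trivial⟩ (by decide) ?_
  have hrun : Cmd.run w (.seq (.assign 14 (2 * .reg 9 + 2)) (.write 4 (.reg 14) (.reg 9))) s =
      (s.setReg 14 (2 * v + 2)).setArr 4 (2 * v + 2) v := by
    simp [Cmd.run, Expr.eval_add, Expr.eval_mul, Expr.eval_reg, Expr.eval_two, h9, e2, e3, e4]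
  rw [hrun]
  set s₀ := (s.setReg 14 (2 * v + 2)).setArr 4 (2 * v + 2) v with hs₀
  have r12 : s₀.reg 12 = p := by simp [hs₀, h12]
  have r14 : s₀.reg 14 = 2 * v + 2 := by simp [hs₀]
  have r3 : s₀.reg 3 = 4 * n := by simp [hs₀, h3]
  have hA : ∀ u v, Arc (4 * n) 5 s₀ u v ↔ Arc (4 * n) 5 s u v := by
    intro u v; simp [Arc, hs₀]
  have hD0 : ∑ x ∈ Finset.range (4 * n), s₀.arr 5 x = D := by simp [hs₀, hDdef]
  refine Runs.seq ((runs_addArc (x := 2 * v + 3) (y := 2 * v + 2) (N := 4 * n) (fun s' h => ?_)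
    (fun s' h => ?_) (by decide) (by decide) r3 (by omega) ?_).mono le_rfl ?_)
  · rw [Expr.eval_add, Expr.eval_one, Expr.eval_reg, h, r14, e1, e5]
  · rw [Expr.eval_reg, h, r14]
  · rw [hD0]; have := hmul 1 (by omega); omega
  rintro s₁ ⟨R₁, A₁, E₁, D₁⟩
  refine Runs.of_run trivial (by decide) ?_
  have hrun' : Cmd.run w (.write 3 (.reg 12) (.reg 14)) s₁ = s₁.setArr 3 p (2 * v + 2) := by
    simp [Cmd.run, Expr.eval_reg, R₁, r12, r14]
  rw [hrun']
  set s' := s₁.setArr 3 p (2 * v + 2) with hs'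
  have hR : ∀ r, r ≠ 14 → s'.reg r = s.reg r := by
    intro r hr
    rw [hs', State.reg_setArr, R₁]
    simp [hs₀, hr]
  have hArr : ∀ a, a ≠ 3 → a ≠ 4 → a ≠ 5 → a ≠ 6 → s'.arr a = s.arr a := by
    intro a h₁ h₂ h₃ h₄
    rw [hs', State.arr_setArr, if_neg h₁, A₁ a h₃ h₄]
    simp [hs₀, h₂]
  have a3 : s'.arr 3 = Function.update (s.arr 3) p (2 * v + 2) := by
    rw [hs', State.arr_setArr, if_pos rfl, A₁ 3 (by omega) (by omega)]
    simp [hs₀]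
  have a4 : s'.arr 4 = Function.update (s.arr 4) (2 * v + 2) v := by
    rw [hs', State.arr_setArr, if_neg (by omega), A₁ 4 (by omega) (by omega)]
    simp [hs₀]
  have hE5 : ∀ x y, Arc (4 * n) 5 s' x y ↔ Arc (4 * n) 5 s x y ∨ (x = 2 * v + 3 ∧ y = 2 * v + 2) := by
    intro x y
    have : Arc (4 * n) 5 s' x y ↔ Arc (4 * n) 5 s₁ x y := by simp [Arc, hs']
    rw [this, E₁, hA]
  have hE7 : ∀ x y, Arc (4 * n) 7 s' x y ↔ Arc (4 * n) 7 s x y := by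
    intro u v; simp [Arc, hArr 7, hArr 8]
  have hmono : ArcMono n s s' := by
    rintro a (rfl | rfl) u v huv
    · exact (hE5 u v).2 (Or.inl huv)
    · exact (hE7 u v).2 huv
  have h5 : s'.reg 5 = s.reg 5 := hR 5 (by omega)
  have hold : ∀ {x S}, IsClass s L x S → IsClass s' L x S := by
    intro x S hx
    -- Array 4 is overwritten at 2v + 2, but a class with this number is {v}, so the new
    -- representative is correct for it.
    by_cases hxv : x = 2 * v + 2
    · have hS := hx.eq
      rw [hxv, H.leaf] at hS
      subst hS
      exact ⟨hx.pos, hx.even, h5 ▸ hx.lt, hx.eq, ⟨v, rfl, by simp [a4, hxv]⟩,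
        fun u hu => hmono.reach (hx.up u hu), fun u hu => hmono.reach (hx.down u hu)⟩
    · exact hx.mono hmono h5.ge (by rw [a4, Function.update_of_ne hxv]) rfl
  have hset : {r | (Function.update F p {v} r).Nonempty} = insert p {r | (F r).Nonempty} := by
    ext r
    by_cases hr : r = p <;> simp [Function.update_apply, hr]
  refine ⟨⟨h5.trans H.next, ?_, ?_, hν, H.le_pairs, ?_, ?_, ?_, ?_, H.leaf, ?_⟩,
    ⟨fun r _ _ => hR r (by omega), fun a ha => hArr a (by omega) (by omega) (by omega) (by omega)⟩,
    hmono⟩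
  · rw [hset]; exact H.finite.insert p
  · rw [hset]
    have := Set.ncard_insert_le p {r | (F r).Nonempty}
    have := H.count
    omega
  · have := H.arcs
    have hd : ∑ x ∈ Finset.range (4 * n), s'.arr 5 x = D + 1 := by
      rw [← hD0, ← D₁]
      simp [hs']
    rw [hd, hArr 7 (by omega) (by omega) (by omega) (by omega)]
    omega
  · rw [h5]
    rintro a (rfl | rfl) x y hxy
    · rcases (hE5 x y).1 hxy with h | h
      · exact H.lt 5 (Or.inl rfl) x y h
      · omega
    · exact H.lt 7 (Or.inr rfl) x y ((hE7 x y).1 hxy)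
  · intro x y hxy P hP
    rcases (hE5 x y).1 hxy with h | ⟨rfl, rfl⟩
    · exact H.sound_zero x y h P hP
    · have h1 : (2 * v.val + 3) % 2 ≠ 0 := by omega
      have h2 : (2 * v.val + 2) % 2 = 0 := by omega
      have h3 : 2 * v.val + 3 - 1 = 2 * v.val + 2 := by omega
      simp only [Sem, h1, h2, h3, if_true, if_false, H.leaf] at hP ⊢
      exact ⟨v, rfl, hP v rfl⟩
  · exact fun x y hxy => H.sound_one x y ((hE7 x y).1 hxy)
  · intro r
    unfold Cell
    rw [a3]
    by_cases hr : r = p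
    · subst hr
      simp only [Function.update_self]
      right
      refine ⟨by omega, by omega, by omega, H.leaf v, ⟨v, rfl, by simp [a4]⟩, ?_, ?_⟩
      · rintro u rfl; exact Relation.ReflTransGen.single ((hE5 _ _).2 (Or.inr ⟨rfl, rfl⟩))
      · rintro u rfl; exact Relation.ReflTransGen.refl
    · rw [Function.update_of_ne hr, Function.update_of_ne hr]
      exact (H.cell r).imp id hold

end WordRAM

/-! ### Comparing and merging the rows of two labelled graphs -/

namespace WordRAM

variable {n k : ℕ} {G : SimpleGraph (Fin n)} {s : State} {F L : ℕ → Set (Fin n)} {m ν ψ w : ℕ}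

/-- Array `0` holds the adjacency matrix of `G`; the registers `0`, `1`, `3` hold the number of
vertices, of labels and of nodes. -/
structure Setup (k : ℕ) (G : SimpleGraph (Fin n)) (s : State) : Prop where
  reg_zero : s.reg 0 = n
  reg_one : s.reg 1 = k
  reg_three : s.reg 3 = 4 * n
  adj : ∀ u v : Fin n, s.arr 0 (u * n + v) ≠ 0 ↔ G.Adj u v

theorem Setup.frame {b : ℕ} {s' : State} (h : Setup k G s) (hb : 4 ≤ b) (hf : Frame b s s') :
    Setup k G s' :=
  ⟨(hf.1 0 (by omega) (by omega)).trans h.1, (hf.1 1 (by omega) (by omega)).trans h.2,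
    (hf.1 3 (by omega) (by omega)).trans h.3, by rw [hf.2 0 (by omega)]; exact h.4⟩

/-- All edges between `S` and `T` are covered by arcs. -/
def AllCovered (G : SimpleGraph (Fin n)) (s : State) (S T : Set (Fin n)) : Prop :=
  ∀ u ∈ S, ∀ v ∈ T, G.Adj u v → Covered s u v ∧ Covered s v u

theorem AllCovered.mono {s' : State} {S T : Set (Fin n)} (h : AllCovered G s S T)
    (hm : ArcMono n s s') : AllCovered G s' S T :=
  fun u hu v hv huv => ⟨(h u hu v hv huv).1.mono hm, (h u hu v hv huv).2.mono hm⟩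

/-- Compare the classes in the cells `reg 12` and `reg 13` of array `3`. -/
def comparePair : Cmd :=
  .cond (.cell 3 (.reg 13))
    (.seq (.seq (.assign 14 (.cell 3 (.reg 12))) (.assign 15 (.cell 3 (.reg 13))))
      (.cond (.cell 0 (.cell 4 (.reg 14) * .reg 0 + .cell 4 (.reg 15))) link .skip))
    .skip

-- By `hom`, the adjacency of the two stored representatives is the adjacency of every pair. Only a
-- nonempty partner can raise ψ, so empty labels are not counted.
open Classical in
theorem runs_comparePair (H : Hubs k G s F L m ν ψ) (hw : Wide n k w) (hs : Setup k G s)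
    {p q : ℕ} (h12 : s.reg 12 = p) (h13 : s.reg 13 = q) (hp : (F p).Nonempty)
    (hψ : ψ + (if (F q).Nonempty then 1 else 0) ≤ 2 * k * n)
    (hom : ∀ u ∈ F p, ∀ u' ∈ F p, ∀ v ∈ F q, ∀ v' ∈ F q, (G.Adj u v ↔ G.Adj u' v')) :
    Runs w comparePair s 80 fun s' =>
      (∃ ψ', Hubs k G s' F L m ν ψ' ∧ ψ' ≤ ψ + if (F q).Nonempty then 1 else 0) ∧
      Frame 14 s s' ∧ ArcMono n s s' ∧ AllCovered G s' (F p) (F q) := by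
  have cp := (H.cell p).isClass ((H.cell p).nonempty_iff.1 hp)
  refine Runs.mono (B := (Expr.cell 3 (.reg 13)).cost + 1 + (6 + (9 + 52))) (Runs.cond
    (fun hq => Runs.seq ?_) fun hq => ?_) (by decide) fun _ h => h
  · rw [Expr.eval_cell, Expr.eval_reg, h13] at hq
    have cq := (H.cell q).isClass hq
    have hqn := (H.cell q).nonempty_iff.2 hq
    refine Runs.of_run ⟨trivial, trivial⟩ (by decide) ?_
    have hrun : Cmd.run w
        (.seq (.assign 14 (.cell 3 (.reg 12))) (.assign 15 (.cell 3 (.reg 13)))) s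
        = (s.setReg 14 (s.arr 3 p)).setReg 15 (s.arr 3 q) := by
      simp [Cmd.run, Expr.eval_reg, Expr.eval_cell, h12, h13]
    rw [hrun]
    set s₀ := (s.setReg 14 (s.arr 3 p)).setReg 15 (s.arr 3 q) with hs₀
    have hf : Frame 14 s s₀ := (Frame.setReg s _ le_rfl).trans (Frame.setReg _ _ (by omega))
    have H₀ : Hubs k G s₀ F L m ν ψ := (H.setReg _ (by omega)).setReg _ (by omega)
    have hS₀ := hs.frame (by omega) hf
    have hm₀ : ArcMono n s s₀ := ArcMono.of_arr fun _ _ _ => rfl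
    have r14 : s₀.reg 14 = s.arr 3 p := by simp [hs₀]
    have r15 : s₀.reg 15 = s.arr 3 q := by simp [hs₀]
    obtain ⟨u, hu, hru⟩ := cp.rep
    obtain ⟨v, hv, hrv⟩ := cq.rep
    have hval : (Expr.cell 0 (.cell 4 (.reg 14) * .reg 0 + .cell 4 (.reg 15))).eval w s₀ =
        s₀.arr 0 (u * n + v) := by
      have hun : u.val * n ≤ n * n := Nat.mul_le_mul_right _ u.isLt.le
      obtain ⟨h1, h2, h3⟩ := hw
      have := Nat.le_mul_of_pos_left (n * n) h2
      rw [← mul_assoc] at this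
      have hvn := v.isLt
      have hnn : n ≤ n * n := Nat.le_mul_of_pos_right _ h1
      have e1 : u.val * n % 2 ^ w = u * n := Nat.mod_eq_of_lt (by omega)
      have e2 : (u.val * n + v) % 2 ^ w = u * n + v := Nat.mod_eq_of_lt (by omega)
      simp only [Expr.eval_cell, Expr.eval_add, Expr.eval_mul, Expr.eval_reg, r14, r15,
        hS₀.reg_zero]
      have : s₀.arr = s.arr := rfl
      rw [this, hru, hrv, e1, e2]
    rw [if_pos hqn] at hψ ⊢
    refine Runs.mono (Runs.cond (fun h => ?_) fun h => ?_) (show _ + 1 + 52 ≤ 9 + 52 by decide)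
      fun _ h => h
    · rw [hval, hS₀.adj] at h
      have cp₀ : IsClass s₀ L (s.arr 3 p) (F p) := cp.mono hm₀ (by simp [hs₀]) rfl rfl
      have cq₀ : IsClass s₀ L (s.arr 3 q) (F q) := cq.mono hm₀ (by simp [hs₀]) rfl rfl
      refine (runs_link H₀ hw hS₀.reg_three r14 r15 hp cp₀ cq₀ ?_ hψ).mono le_rfl ?_
      · exact fun u' hu' v' hv' => (hom u hu u' hu' v hv v' hv').1 h
      · rintro s' ⟨k₁, k₂, k₃, k₄⟩
        exact ⟨⟨_, k₁, le_rfl⟩, hf.trans k₂, hm₀.trans k₃, fun u hu v hv _ => k₄ u hu v hv⟩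
    · rw [hval] at h
      refine Runs.of_run trivial (by decide) ⟨⟨ψ, H₀, by omega⟩, hf, hm₀, ?_⟩
      -- A zero entry at the representatives excludes every edge between the two classes.
      intro u' hu' v' hv' hadj
      exact ((hS₀.adj u v).2 ((hom u' hu' u hu v' hv' v hv).1 hadj) h).elim
  · rw [Expr.eval_cell, Expr.eval_reg, h13] at hq
    have hqn : ¬ (F q).Nonempty := fun h => (H.cell q).nonempty_iff.1 h hq
    refine Runs.of_run trivial (by decide) ⟨⟨ψ, H, by omega⟩, Frame.refl _ _, ArcMono.refl _, ?_⟩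
    exact fun u _ v hv _ => (hqn ⟨v, hv⟩).elim

open Classical in
/-- The number of nonempty sets among the first `j` ones from the address `a` on. -/
noncomputable def rowCount (F : ℕ → Set (Fin n)) (a j : ℕ) : ℕ :=
  ∑ i ∈ Finset.range j, if (F (a + i)).Nonempty then 1 else 0

theorem rowCount_le (F : ℕ → Set (Fin n)) (a j : ℕ) : rowCount F a j ≤ j := by
  classical
  unfold rowCount
  refine (Finset.sum_le_card_nsmul _ _ 1 fun i _ => ?_).trans (by simp)
  split_ifs <;> simp

theorem rowCount_mono (F : ℕ → Set (Fin n)) (a : ℕ) {i j : ℕ} (h : i ≤ j) :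
    rowCount F a i ≤ rowCount F a j :=
  Finset.sum_le_sum_of_subset (Finset.range_mono h)

/-- Compare the class in the cell `reg 12` of array `3` with the row at address `reg 4`. -/
def compareRow : Cmd :=
  forCmd 11 1 (.seq (.assign 13 (.reg 4 + .reg 11)) comparePair)

theorem runs_compareRow (H : Hubs k G s F L m ν ψ) (hw : Wide n k w) (hs : Setup k G s)
    {p b : ℕ} (h12 : s.reg 12 = p) (h4 : s.reg 4 = b) (hb : b + k + 1 < 2 ^ w)
    (hp : (F p).Nonempty) (hψ : ψ + rowCount F b k ≤ 2 * k * n)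
    (hom : ∀ j < k, ∀ u ∈ F p, ∀ u' ∈ F p, ∀ v ∈ F (b + j), ∀ v' ∈ F (b + j),
      (G.Adj u v ↔ G.Adj u' v')) :
    Runs w compareRow s (k * 92 + 6) fun s' =>
      (∃ ψ', Hubs k G s' F L m ν ψ' ∧ ψ' ≤ ψ + rowCount F b k) ∧
      Frame 11 s s' ∧ ArcMono n s s' ∧ ∀ j < k, AllCovered G s' (F p) (F (b + j)) := by
  classical
  refine (Runs.for (N := k) (fun j s' => (∃ ψ', Hubs k G s' F L m ν ψ' ∧ ψ' ≤ ψ + rowCount F b j) ∧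
      Frame 11 s s' ∧ s'.reg 12 = p ∧ ArcMono n s s' ∧
      ∀ j' < j, AllCovered G s' (F p) (F (b + j'))) (fun _ => 84) (by omega) (by omega)
    hs.reg_one ?_ ?_).mono (by simp) ?_
  · exact ⟨⟨ψ, H.setReg _ (by omega), by simp [rowCount]⟩, Frame.setReg _ _ le_rfl, by simpa using h12,
      ArcMono.of_arr fun _ _ _ => rfl, by simp⟩
  · rintro j hj s₁ h11 h1 ⟨⟨ψ', H₁, hψ'⟩, hf, r12, hm, hcov⟩
    refine Runs.mono (B := 4 + 80) (Runs.seq (Runs.of_run trivial (by decide) ?_)) le_rfl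
      fun _ h => h
    have hrun : Cmd.run w (.assign 13 (.reg 4 + .reg 11)) s₁ = s₁.setReg 13 (b + j) := by
      have e1 : (b + j) % 2 ^ w = b + j := Nat.mod_eq_of_lt (by omega)
      simp [Cmd.run, Expr.eval_add, Expr.eval_reg, h11, hf.1 4, h4, e1]
    rw [hrun]
    have hf₂ : Frame 13 s₁ (s₁.setReg 13 (b + j)) := Frame.setReg _ _ le_rfl
    have hsucc : rowCount F b (j + 1) = rowCount F b j +
        if (F (b + j)).Nonempty then 1 else 0 := Finset.sum_range_succ _ _
    have hle := rowCount_mono F b (show j + 1 ≤ k from hj)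
    refine (runs_comparePair (H₁.setReg _ (by omega)) hw
      (hs.frame (by omega) (hf.trans (hf₂.anti (by omega)))) (p := p) (q := b + j) (by simp [r12])
      (by simp) hp (by omega) (hom j hj)).mono le_rfl ?_
    rintro s' ⟨⟨ψ'', k₁, k₂⟩, k₃, k₄, k₅⟩
    have hf₃ := hf₂.trans (k₃.anti (by omega))
    have hm' : ArcMono n s₁ s' := ArcMono.trans (ArcMono.of_arr fun _ _ _ => rfl) k₄
    have hm'' : ArcMono n s' (s'.setReg 11 (j + 1)) := ArcMono.of_arr fun _ _ _ => rfl
    refine ⟨?_, ?_, ⟨ψ'', k₁.setReg _ (by omega), by omega⟩, ?_, ?_, (hm.trans hm').trans hm'', ?_⟩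
    · rw [hf₃.1 11 (by omega) (by omega), h11]
    · rw [hf₃.1 1 (by omega) (by omega), h1]
    · exact (hf.trans (hf₃.anti (by omega))).trans (Frame.setReg _ _ le_rfl)
    · simp [hf₃.1 12, r12]
    · intro j' hj'
      rcases Nat.lt_succ_iff_lt_or_eq.1 hj' with h | rfl
      · exact ((hcov j' h).mono hm').mono hm''
      · exact k₅.mono hm''
  · rintro s' ⟨_, h₁, h₂, _, h₃, h₄⟩
    exact ⟨h₁, h₂, h₃, h₄⟩

/-- Compare the row at address `reg 7` with the row at address `reg 4`. -/
def compareRows : Cmd :=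
  forCmd 10 1 (.seq (.assign 12 (.reg 7 + .reg 10)) (.cond (.cell 3 (.reg 12)) compareRow .skip))

/-- The inner loop runs only for nonempty cells of the first row. Its cost is thus k times their
number instead of k², which matters when k exceeds n. -/
theorem runs_compareRows (H : Hubs k G s F L m ν ψ) (hw : Wide n k w) (hs : Setup k G s)
    {a b : ℕ} (h7 : s.reg 7 = a) (h4 : s.reg 4 = b) (ha : a + k + 1 < 2 ^ w)
    (hb : b + k + 1 < 2 ^ w)
    (hψ : ψ + rowCount F a k * rowCount F b k ≤ 2 * k * n)
    (hom : ∀ i < k, ∀ j < k, ∀ u ∈ F (a + i), ∀ u' ∈ F (a + i), ∀ v ∈ F (b + j),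
      ∀ v' ∈ F (b + j), (G.Adj u v ↔ G.Adj u' v')) :
    Runs w compareRows s (k * 18 + rowCount F a k * (k * 92 + 6) + 6) fun s' =>
      (∃ ψ', Hubs k G s' F L m ν ψ' ∧ ψ' ≤ ψ + rowCount F a k * rowCount F b k) ∧
      Frame 10 s s' ∧ ArcMono n s s' ∧
      ∀ i < k, ∀ j < k, AllCovered G s' (F (a + i)) (F (b + j)) := by
  classical
  have hcost : ∑ i ∈ Finset.range k,
      ((10 + if (F (a + i)).Nonempty then k * 92 + 6 else 0) + 8) + 6 =
      k * 18 + rowCount F a k * (k * 92 + 6) + 6 := by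
    rw [rowCount, Finset.sum_mul]
    simp only [Finset.sum_add_distrib, Finset.sum_const, Finset.card_range, smul_eq_mul, ite_mul,
      one_mul, zero_mul]
    ring
  rw [← hcost]
  refine (Runs.for (N := k) (fun i s' =>
      (∃ ψ', Hubs k G s' F L m ν ψ' ∧ ψ' ≤ ψ + rowCount F a i * rowCount F b k) ∧
      Frame 10 s s' ∧ ArcMono n s s' ∧
      ∀ i' < i, ∀ j < k, AllCovered G s' (F (a + i')) (F (b + j))) _ (by omega) (by omega)
    hs.reg_one ?_ ?_).mono le_rfl ?_
  · exact ⟨⟨ψ, H.setReg _ (by omega), by simp [rowCount]⟩, Frame.setReg _ _ le_rfl,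
      ArcMono.of_arr fun _ _ _ => rfl, by simp⟩
  · rintro i hi s₁ h10 h1 ⟨⟨ψ', H₁, hψ'⟩, hf, hm, hcov⟩
    have hrun : Cmd.run w (.assign 12 (.reg 7 + .reg 10)) s₁ = s₁.setReg 12 (a + i) := by
      have e1 : (a + i) % 2 ^ w = a + i := Nat.mod_eq_of_lt (by omega)
      simp [Cmd.run, Expr.eval_add, Expr.eval_reg, h10, hf.1 7, h7, e1]
    have hf₂ : Frame 12 s₁ (s₁.setReg 12 (a + i)) := Frame.setReg _ _ le_rfl
    have H₂ : Hubs k G (s₁.setReg 12 (a + i)) F L m ν ψ' := H₁.setReg _ (by omega)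
    have hsucc : rowCount F a (i + 1) = rowCount F a i +
        if (F (a + i)).Nonempty then 1 else 0 := Finset.sum_range_succ _ _
    have hle := Nat.mul_le_mul_right (rowCount F b k) (rowCount_mono F a (show i + 1 ≤ k from hi))
    rw [hsucc, add_mul] at hle
    have hval : (Expr.cell 3 (.reg 12)).eval w (s₁.setReg 12 (a + i)) =
        (s₁.setReg 12 (a + i)).arr 3 (a + i) := by simp [Expr.eval_cell, Expr.eval_reg]
    have fin : ∀ s', (∃ ψ', Hubs k G s' F L m ν ψ' ∧
        ψ' ≤ ψ + rowCount F a (i + 1) * rowCount F b k) →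
        Frame 11 (s₁.setReg 12 (a + i)) s' → ArcMono n (s₁.setReg 12 (a + i)) s' →
        (∀ j < k, AllCovered G s' (F (a + i)) (F (b + j))) →
        s'.reg 10 = i ∧ s'.reg 1 = k ∧ (∃ ψ', Hubs k G (s'.setReg 10 (i + 1)) F L m ν ψ' ∧
          ψ' ≤ ψ + rowCount F a (i + 1) * rowCount F b k) ∧
        Frame 10 s (s'.setReg 10 (i + 1)) ∧ ArcMono n s (s'.setReg 10 (i + 1)) ∧
        ∀ i' < i + 1, ∀ j < k, AllCovered G (s'.setReg 10 (i + 1)) (F (a + i')) (F (b + j)) := by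
      rintro s' ⟨ψ'', k₁, k₂⟩ k₃ k₄ k₅
      have hf₃ := (hf₂.anti (show 11 ≤ 12 by omega)).trans k₃
      have hm' : ArcMono n s₁ s' := ArcMono.trans (ArcMono.of_arr fun _ _ _ => rfl) k₄
      have hm'' : ArcMono n s' (s'.setReg 10 (i + 1)) := ArcMono.of_arr fun _ _ _ => rfl
      refine ⟨?_, ?_, ⟨ψ'', k₁.setReg _ (by omega), k₂⟩, ?_, (hm.trans hm').trans hm'', ?_⟩
      · rw [hf₃.1 10 (by omega) (by omega), h10]
      · rw [hf₃.1 1 (by omega) (by omega), h1]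
      · exact (hf.trans (hf₃.anti (by omega))).trans (Frame.setReg _ _ le_rfl)
      · intro i' hi' j hj
        rcases Nat.lt_succ_iff_lt_or_eq.1 hi' with h | rfl
        · exact ((hcov i' h j hj).mono hm').mono hm''
        · exact (k₅ j hj).mono hm''
    refine Runs.mono (B := 4 + (4 + if (F (a + i)).Nonempty then k * 92 + 6 else 1))
      (Runs.seq (Runs.of_run trivial (by decide) ?_)) (by split_ifs <;> omega) fun _ h => h
    rw [hrun]
    refine Runs.mono (B := (Expr.cell 3 (.reg 12)).cost + 1 +
      if (F (a + i)).Nonempty then k * 92 + 6 else 1) (Runs.cond (fun h => ?_) fun h => ?_)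
      (Nat.add_le_add_right (by decide) _) fun _ h => h
    · rw [hval] at h
      have hn := (H₂.cell _).nonempty_iff.2 h
      rw [if_pos hn, one_mul] at hle
      rw [if_pos hn]
      refine (runs_compareRow H₂ hw (hs.frame (by omega) (hf.trans (hf₂.anti (by omega))))
        (p := a + i) (by simp) (b := b) (by simp [hf.1 4, h4]) hb hn (by omega)
        (hom i hi)).mono le_rfl ?_
      rintro s' ⟨⟨ψ'', k₁, k₂⟩, k₃, k₄, k₅⟩
      refine fin s' ⟨ψ'', k₁, ?_⟩ k₃ k₄ k₅
      rw [hsucc, if_pos hn, add_mul, one_mul]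
      omega
    · rw [hval] at h
      have hn : ¬ (F (a + i)).Nonempty := fun h' => (H₂.cell _).nonempty_iff.1 h' h
      rw [if_neg hn]
      refine Runs.of_run trivial (by decide) (fin _ ⟨ψ', H₂, ?_⟩ (Frame.refl _ _)
        (ArcMono.refl _) fun j _ u hu => (hn ⟨u, hu⟩).elim)
      rw [hsucc, if_neg hn]
      exact hψ'
  · rintro s' ⟨_, h₁, h₂, h₃, h₄⟩
    exact ⟨h₁, h₂, h₃, h₄⟩

/-- Merge the row at address `reg 4` into the row at address `reg 7`. -/
def mergeRows : Cmd :=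
  forCmd 10 1 (.seq (.seq (.assign 12 (.reg 4 + .reg 10)) (.assign 13 (.reg 7 + .reg 10))) merge)

/-- The sets after the first `i` cells of the row at `a + k` have been merged into the row
at `a`. -/
def mergedRows (F : ℕ → Set (Fin n)) (k a i r : ℕ) : Set (Fin n) :=
  if a ≤ r ∧ r < a + i then F (r + k) ∪ F r
  else if a + k ≤ r ∧ r < a + k + i then ∅ else F r

theorem mergedRows_zero (F : ℕ → Set (Fin n)) (k a : ℕ) : mergedRows F k a 0 = F := by
  funext r
  unfold mergedRows
  rw [if_neg (by omega), if_neg (by omega)]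

theorem mergedRows_succ (F : ℕ → Set (Fin n)) {k a i : ℕ} (hi : i < k) :
    mergedRows F k a (i + 1) =
      Function.update (Function.update (mergedRows F k a i) (a + i)
        (mergedRows F k a i (a + k + i) ∪ mergedRows F k a i (a + i))) (a + k + i) ∅ := by
  funext r
  have e1 : mergedRows F k a i (a + k + i) = F (a + i + k) := by
    unfold mergedRows
    rw [if_neg (by omega), if_neg (by omega), add_right_comm]
  have e2 : mergedRows F k a i (a + i) = F (a + i) := by
    unfold mergedRows
    rw [if_neg (by omega), if_neg (by omega)]
  rw [e1, e2]
  by_cases h1 : r = a + k + i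
  · subst h1
    simp only [Function.update_self]
    unfold mergedRows
    rw [if_neg (by omega), if_pos (by omega)]
  rw [Function.update_of_ne h1]
  by_cases h2 : r = a + i
  · subst h2
    simp only [Function.update_self]
    unfold mergedRows
    rw [if_pos (by omega)]
  rw [Function.update_of_ne h2]
  unfold mergedRows
  congr 1
  · exact propext (by omega)
  · congr 1
    exact propext (by omega)

theorem runs_mergeRows (H : Hubs k G s F L m ν ψ) (hw : Wide n k w) (hs : Setup k G s)
    {a : ℕ} (h7 : s.reg 7 = a) (h4 : s.reg 4 = a + k) (hb : a + k + k + 1 < 2 ^ w) :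
    Runs w mergeRows s (k * 216 + 6) fun s' =>
      (∃ L' m', Hubs k G s' (mergedRows F k a k) L' m' ν ψ) ∧ Frame 10 s s' ∧ ArcMono n s s' := by
  refine (Runs.for (N := k) (fun i s' => (∃ L' m', Hubs k G s' (mergedRows F k a i) L' m' ν ψ) ∧
      Frame 10 s s' ∧ ArcMono n s s') (fun _ => 208) (by omega) (by omega)
    hs.reg_one ?_ ?_).mono (by simp) ?_
  · exact ⟨⟨L, m, by rw [mergedRows_zero]; exact H.setReg _ (by omega)⟩, Frame.setReg _ _ le_rfl,
      ArcMono.of_arr fun _ _ _ => rfl⟩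
  · rintro i hi s₁ h10 h1 ⟨⟨L', m', H₁⟩, hf, hm⟩
    refine Runs.mono (B := 8 + 200) (Runs.seq (Runs.of_run ⟨trivial, trivial⟩ (by decide) ?_)) le_rfl
      fun _ h => h
    have hrun : Cmd.run w
        (.seq (.assign 12 (.reg 4 + .reg 10)) (.assign 13 (.reg 7 + .reg 10))) s₁ =
        (s₁.setReg 12 (a + k + i)).setReg 13 (a + i) := by
      have e1 : (a + k + i) % 2 ^ w = a + k + i := Nat.mod_eq_of_lt (by omega)
      have e2 : (a + i) % 2 ^ w = a + i := Nat.mod_eq_of_lt (by omega)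
      simp [Cmd.run, Expr.eval_add, Expr.eval_reg, h10, hf.1 4, hf.1 7, h4, h7, e1, e2]
    rw [hrun]
    set s₂ := (s₁.setReg 12 (a + k + i)).setReg 13 (a + i) with hs₂
    have hf₂ : Frame 12 s₁ s₂ := (Frame.setReg _ _ le_rfl).trans (Frame.setReg _ _ (by omega))
    have H₂ : Hubs k G s₂ (mergedRows F k a i) L' m' ν ψ :=
      (H₁.setReg _ (by omega)).setReg _ (by omega)
    have hS := hs.frame (by omega) (hf.trans (hf₂.anti (by omega)))
    refine (runs_merge H₂ hw hS.reg_three (p := a + k + i) (q := a + i) (by simp [hs₂])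
      (by simp [hs₂]) (by omega)).mono le_rfl ?_
    rintro s' ⟨⟨L'', m'', k₁⟩, k₂, k₃⟩
    rw [← mergedRows_succ F hi] at k₁
    have hf₃ := hf₂.trans (k₂.anti (by omega))
    have hm' : ArcMono n s₁ s' := ArcMono.trans (ArcMono.of_arr fun _ _ _ => rfl) k₃
    have hm'' : ArcMono n s' (s'.setReg 10 (i + 1)) := ArcMono.of_arr fun _ _ _ => rfl
    refine ⟨?_, ?_, ⟨L'', m'', k₁.setReg _ (by omega)⟩, ?_, (hm.trans hm').trans hm''⟩
    · rw [hf₃.1 10 (by omega) (by omega), h10]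
    · rw [hf₃.1 1 (by omega) (by omega), h1]
    · exact (hf.trans (hf₃.anti (by omega))).trans (Frame.setReg _ _ le_rfl)
  · rintro s' ⟨_, h₁, h₂, h₃⟩
    exact ⟨h₁, h₂, h₃⟩

end WordRAM

/-! ### Single operations on a stack of labelled graphs -/

namespace WordRAM

variable {n k w : ℕ} {G : SimpleGraph (Fin n)} {s : State}

/-- The rows of the table represent the labelled graphs of a stack of expressions. -/
def Rows (F : ℕ → Set (Fin n)) : List (CWExpr (Fin n) k) → Prop
  | [] => True
  | t :: ts => (∀ l : Fin k, F (ts.length * k + l) = {v | t.HasLabel v l}) ∧ Rows F ts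

theorem Rows.congr {F F' : ℕ → Set (Fin n)} {ts : List (CWExpr (Fin n) k)} (h : Rows F ts)
    (hF : ∀ p < ts.length * k, F' p = F p) : Rows F' ts := by
  induction ts with
  | nil => trivial
  | cons t ts ih =>
    have hlen : (t :: ts).length * k = ts.length * k + k := by simp [add_mul]
    refine ⟨fun l => ?_, ih h.2 fun p hp => hF p (by omega)⟩
    rw [hF _ (by omega)]
    exact h.1 l

/-- The total number of vertices of a stack of expressions. -/
noncomputable def totalVerts (ts : List (CWExpr (Fin n) k)) : ℕ := (ts.map CWExpr.numVerts).sum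

theorem length_le_totalVerts (ts : List (CWExpr (Fin n) k)) : ts.length ≤ totalVerts ts := by
  induction ts with
  | nil => simp
  | cons t ts ih =>
    have := t.numVerts_pos
    simp only [totalVerts, List.length_cons, List.map_cons, List.sum_cons] at ih ⊢
    omega

/-- The bound for the number of pairs of classes compared for a stack of expressions. -/
noncomputable def totalPairs (ts : List (CWExpr (Fin n) k)) : ℕ :=
  (ts.map fun t => CWExpr.pairBound k t.numVerts).sum

theorem totalPairs_le (ts : List (CWExpr (Fin n) k)) :
    totalPairs ts ≤ 2 * k * totalVerts ts := by
  induction ts with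
  | nil => simp [totalPairs]
  | cons t ts ih =>
    have := CWExpr.pairBound_le k t.numVerts
    simp only [totalVerts, totalPairs, List.map_cons, List.sum_cons, mul_add] at ih ⊢
    omega

/-- The memory represents a stack of expressions whose operations have been executed. -/
structure Building (G : SimpleGraph (Fin n)) (s : State) (ts : List (CWExpr (Fin n) k)) : Prop where
  setup : Setup k G s
  base : s.reg 4 = ts.length * k
  hubs : ∃ F L m ψ, Hubs k G s F L m (totalVerts ts) ψ ∧ ψ ≤ totalPairs ts ∧ Rows F ts ∧
    ∀ p, ts.length * k ≤ p → F p = ∅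
  covered : ∀ t ∈ ts, ∀ u ∈ t.verts, ∀ v ∈ t.verts, G.Adj u v → Covered s u v

theorem Building.setReg {ts : List (CWExpr (Fin n) k)} (h : Building G s ts) {x : ℕ} (v : ℕ)
    (hx : 5 < x) : Building G (s.setReg x v) ts := by
  obtain ⟨F, L, m, ψ, H, hr⟩ := h.hubs
  exact ⟨h.setup.frame (by omega) (Frame.setReg (b := 6) _ _ (by omega)),
    by simpa [show 4 ≠ x by omega] using h.base,
    ⟨F, L, m, ψ, H.setReg _ (by omega), hr⟩, h.covered⟩

/-- Every graph on the stack has a vertex, so the stack has at most n rows of k cells; the summand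
3k leaves room for the rows around its top. -/
theorem address_lt {N d : ℕ} (hw : Wide n k w) (hd : d ≤ N) (hN : N ≤ n) :
    d * k + 3 * k + 1 < 2 ^ w := by
  obtain ⟨h1, h2, h3⟩ := hw
  have : d * k ≤ n * k := Nat.mul_le_mul_right _ (by omega)
  have : k ≤ k * n := Nat.le_mul_of_pos_right _ h1
  have : k * n ≤ k * n * n := Nat.le_mul_of_pos_right _ h1
  have := mul_comm n k
  omega

/-- Registers and arrays that the operations of an expression do not change. -/
def OpFrame (s s' : State) : Prop :=
  s'.reg 2 = s.reg 2 ∧ s'.reg 6 = s.reg 6 ∧ s'.arr 1 = s.arr 1 ∧ s'.arr 9 = s.arr 9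

theorem Frame.opFrame {b : ℕ} {s s' : State} (h : Frame b s s') (hb : 7 ≤ b) : OpFrame s s' :=
  ⟨h.1 2 (by omega) (by omega), h.1 6 (by omega) (by omega), h.2 1 (by omega), h.2 9 (by omega)⟩

theorem OpFrame.trans {s s' s'' : State} (h : OpFrame s s') (h' : OpFrame s' s'') :
    OpFrame s s'' :=
  ⟨h'.1.trans h.1, h'.2.1.trans h.2.1, h'.2.2.1.trans h.2.2.1, h'.2.2.2.trans h.2.2.2⟩

theorem OpFrame.setReg (s : State) {x : ℕ} (v : ℕ) (h2 : x ≠ 2) (h6 : x ≠ 6) :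
    OpFrame s (s.setReg x v) := by
  simp [OpFrame, h2.symm, h6.symm]

/-- The operation `i(v)` for `i = reg 8`, `v = reg 9`. -/
def opVertex : Cmd :=
  .seq (.assign 12 (.reg 4 + .reg 8)) (.seq newVertex (.assign 4 (.reg 4 + .reg 1)))

theorem runs_opVertex {ts : List (CWExpr (Fin n) k)} (h : Building G s ts) (hw : Wide n k w)
    {i : Fin k} {v : Fin n} (h8 : s.reg 8 = i) (h9 : s.reg 9 = v) (hn : totalVerts ts + 1 ≤ n) :
    Runs w opVertex s 60 fun s' => Building G s' (.vertex i v :: ts) ∧ OpFrame s s' := by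
  obtain ⟨F, L, m, ψ, H, hψ, hr, hF⟩ := h.hubs
  have hadr := address_lt hw (length_le_totalVerts ts) (by omega)
  have hi := i.isLt
  have e1 : (ts.length * k + i) % 2 ^ w = ts.length * k + i := Nat.mod_eq_of_lt (by omega)
  have e2 : (ts.length * k + k) % 2 ^ w = ts.length * k + k := Nat.mod_eq_of_lt (by omega)
  refine Runs.mono (B := 4 + (50 + 4)) (Runs.seq (Runs.of_run trivial (by decide) ?_)) (by omega)
    fun _ h => h
  have hrun : Cmd.run w (.assign 12 (.reg 4 + .reg 8)) s = s.setReg 12 (ts.length * k + i) := by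
    simp [Cmd.run, Expr.eval_add, Expr.eval_reg, h8, h.base, e1]
  rw [hrun]
  set s₁ := s.setReg 12 (ts.length * k + i) with hs₁
  have hf₁ : Frame 12 s s₁ := Frame.setReg _ _ le_rfl
  refine Runs.seq ((runs_newVertex (s := s₁) (H.setReg _ (by omega)) hw
    (h.setup.frame (by omega) hf₁).reg_three (p := ts.length * k + i) (v := v) (by simp [hs₁])
    (by simp [hs₁, h9]) (hF _ (by omega)) hn).mono le_rfl ?_)
  rintro s₂ ⟨H₂, hf₂, hm⟩
  refine Runs.of_run trivial (by decide) ?_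
  have hf := hf₁.trans (hf₂.anti (by omega))
  have hS := h.setup.frame (by omega) hf
  have hrun' : Cmd.run w (.assign 4 (.reg 4 + .reg 1)) s₂ = s₂.setReg 4 (ts.length * k + k) := by
    simp [Cmd.run, Expr.eval_add, Expr.eval_reg, hf.1 4, h.base, hS.reg_one, e2]
  rw [hrun']
  have hone : (CWExpr.vertex i v : CWExpr (Fin n) k).numVerts = 1 := Set.ncard_singleton v
  refine ⟨⟨hS.frame le_rfl (Frame.setReg _ _ le_rfl), ?_, ⟨Function.update F (ts.length * k + i)
    {v}, L, m, ψ, ?_, ?_, ⟨fun l => ?_, ?_⟩, ?_⟩, ?_⟩, (hf.opFrame (by omega)).trans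
    (OpFrame.setReg _ _ (by omega) (by omega))⟩
  · simp [add_mul]
  · have : totalVerts (.vertex i v :: ts) = totalVerts ts + 1 := by
      simp [totalVerts, hone, add_comm]
    rw [this]
    exact H₂.setReg _ (by omega)
  · simp only [totalPairs, List.map_cons, List.sum_cons] at hψ ⊢
    omega
  · ext u
    by_cases hl : l = i
    · subst hl; simp [CWExpr.HasLabel]
    · have : (l : ℕ) ≠ i := fun h => hl (Fin.ext h)
      rw [Function.update_of_ne (by omega), hF _ (by omega)]
      simp [CWExpr.HasLabel, hl]
  · exact hr.congr fun p hp => Function.update_of_ne (by omega) _ _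
  · intro p hp
    simp only [List.length_cons, add_mul, one_mul] at hp
    rw [Function.update_of_ne (by omega), hF _ (by omega)]
  · intro t ht u hu u' hu' hadj
    rcases List.mem_cons.1 ht with rfl | ht
    · simp only [CWExpr.verts, Set.mem_singleton_iff] at hu hu'
      subst hu hu'
      exact (G.irrefl hadj).elim
    · exact ((h.covered t ht u hu u' hu' hadj).mono (ArcMono.of_arr fun _ _ _ => rfl)).mono hm

/-- The operation `ρ(i, j)` for `i = reg 8`, `j = reg 9`. -/
def opRelabel : Cmd :=
  .seq (.seq (.assign 12 (.reg 4 - .reg 1 + .reg 8)) (.assign 13 (.reg 4 - .reg 1 + .reg 9)))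
    (.cond (.op .eq (.reg 12) (.reg 13)) .skip merge)

theorem runs_opRelabel {t : CWExpr (Fin n) k} {ts : List (CWExpr (Fin n) k)}
    (h : Building G s (t :: ts)) (hw : Wide n k w) {i j : Fin k} (h8 : s.reg 8 = i)
    (h9 : s.reg 9 = j) (hn : totalVerts (t :: ts) ≤ n) :
    Runs w opRelabel s 220 fun s' => Building G s' (.relabel i j t :: ts) ∧ OpFrame s s' := by
  obtain ⟨F, L, m, ψ, H, hψ, hr, hF⟩ := h.hubs
  have hadr := address_lt hw (length_le_totalVerts (t :: ts)) (by omega)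
  have hbase := h.base
  simp only [List.length_cons, add_mul, one_mul] at hadr hbase hF
  have hi := i.isLt
  have hj := j.isLt
  have e1 : (ts.length * k + i) % 2 ^ w = ts.length * k + i := Nat.mod_eq_of_lt (by omega)
  have e2 : (ts.length * k + j) % 2 ^ w = ts.length * k + j := Nat.mod_eq_of_lt (by omega)
  refine Runs.mono (B := 12 + (4 + 200)) (Runs.seq (Runs.of_run ⟨trivial, trivial⟩ (by decide) ?_))
    (by omega) fun _ h => h
  have hrun : Cmd.run w (.seq (.assign 12 (.reg 4 - .reg 1 + .reg 8))
      (.assign 13 (.reg 4 - .reg 1 + .reg 9))) s =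
      (s.setReg 12 (ts.length * k + i)).setReg 13 (ts.length * k + j) := by
    simp [Cmd.run, Expr.eval_add, Expr.eval_sub, Expr.eval_reg, h8, h9, hbase, h.setup.reg_one,
      e1, e2]
  rw [hrun]
  set s₁ := (s.setReg 12 (ts.length * k + i)).setReg 13 (ts.length * k + j) with hs₁
  have hf₁ : Frame 12 s s₁ := (Frame.setReg _ _ le_rfl).trans (Frame.setReg _ _ (by omega))
  have H₁ : Hubs k G s₁ F L m (totalVerts (t :: ts)) ψ :=
    (H.setReg _ (by omega)).setReg _ (by omega)
  have fin : ∀ s' F' L' m', Hubs k G s' F' L' m' (totalVerts (t :: ts)) ψ → Frame 12 s s' →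
      ArcMono n s s' → (∀ l : Fin k, F' (ts.length * k + l) =
        {v | (CWExpr.relabel i j t).HasLabel v l}) →
      (∀ p, (∀ l : Fin k, p ≠ ts.length * k + l) → F' p = F p) →
      Building G s' (.relabel i j t :: ts) ∧ OpFrame s s' := by
    intro s' F' L' m' H' hf hm hrow hout
    refine ⟨⟨h.setup.frame (by omega) hf, ?_, ⟨F', L', m', ψ, H', hψ, ⟨hrow, hr.2.congr fun p hp =>
      hout p fun l => by omega⟩, fun p hp => ?_⟩, fun t' ht' u hu u' hu' hadj => ?_⟩,
      hf.opFrame (by omega)⟩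
    · rw [hf.1 4 (by omega) (by omega)]; exact h.base
    · simp only [List.length_cons, add_mul, one_mul] at hp
      rw [hout p fun l => by omega]
      exact hF p hp
    · rcases List.mem_cons.1 ht' with rfl | ht'
      · exact (h.covered t (by simp) u hu u' hu' hadj).mono hm
      · exact (h.covered t' (by simp [ht']) u hu u' hu' hadj).mono hm
  have hval : (Expr.op .eq (.reg 12) (.reg 13)).eval w s₁ = if i = j then 1 else 0 := by
    simp [Expr.eval, Op.eval, hs₁, Fin.ext_iff]
  -- The operation ρ(i,i) is the identity and has to be skipped, as merging a cell with itself would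
  -- empty it.
  refine Runs.cond (fun hc => ?_) fun hc => ?_
  · rw [hval] at hc
    have hij : i = j := by by_contra hij; simp [hij] at hc
    subst hij
    refine Runs.of_run trivial (by decide) (fin s₁ F L m H₁ hf₁
      (ArcMono.of_arr fun _ _ _ => rfl) (fun l => ?_) fun _ _ => rfl)
    rw [hr.1 l]
    ext v
    by_cases hl : l = i <;> simp [CWExpr.HasLabel, hl]
  · rw [hval] at hc
    have hij : i ≠ j := by rintro rfl; simp at hc
    have hij' : i.val ≠ j.val := fun h => hij (Fin.ext h)
    refine (runs_merge H₁ hw (h.setup.frame (by omega) hf₁).reg_three (p := ts.length * k + i)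
      (q := ts.length * k + j) (by simp [hs₁]) (by simp [hs₁]) (by omega)).mono le_rfl ?_
    rintro s' ⟨⟨L', m', k₁⟩, k₂, k₃⟩
    refine fin s' _ L' m' k₁ (hf₁.trans (k₂.anti (by omega)))
      (ArcMono.trans (ArcMono.of_arr fun _ _ _ => rfl) k₃) (fun l => ?_) fun p hp => ?_
    · by_cases hl : l = i
      · subst hl
        simp [CWExpr.HasLabel, hij]
      have hl' : l.val ≠ i := fun h => hl (Fin.ext h)
      rw [Function.update_of_ne (by omega)]
      by_cases hlj : l = j
      · subst hlj
        rw [Function.update_self, hr.1, hr.1]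
        ext v
        simp [CWExpr.HasLabel, hl, or_comm]
      · have hlj' : l.val ≠ j := fun h => hlj (Fin.ext h)
        rw [Function.update_of_ne (by omega), hr.1]
        ext v
        simp [CWExpr.HasLabel, hl, hlj]
    · rw [Function.update_of_ne (hp i), Function.update_of_ne (hp j)]

/-- The operation of disjoint union. -/
def opUnion : Cmd :=
  .seq (.seq (.assign 4 (.reg 4 - .reg 1)) (.assign 7 (.reg 4 - .reg 1)))
    (.seq compareRows mergeRows)

theorem rowCount_le_numVerts {F : ℕ → Set (Fin n)} {t : CWExpr (Fin n) k} (ht : t.WellFormed)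
    {a : ℕ} (h : ∀ l : Fin k, F (a + l) = {v | t.HasLabel v l}) :
    rowCount F a k ≤ t.numVerts := by
  classical
  refine le_trans (le_of_eq ?_) (CWExpr.card_labels_le ht)
  rw [rowCount, Finset.sum_range, Finset.card_filter]
  refine Finset.sum_congr rfl fun l _ => ?_
  rw [h l]
  rfl

/-- Edges inside either part are covered already. Those across are covered by comparing the two rows
while the sides are still separate, and only then are equal labels merged. -/
theorem runs_opUnion {t₁ t₂ : CWExpr (Fin n) k} {ts : List (CWExpr (Fin n) k)}
    (h : Building G s (t₂ :: t₁ :: ts)) (hw : Wide n k w) (ht : (t₁.union t₂).WellFormed)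
    (hR : (t₁.union t₂).Refines G) (hn : totalVerts (t₂ :: t₁ :: ts) ≤ n) :
    Runs w opUnion s (360 * (k * n)) fun s' => Building G s' (t₁.union t₂ :: ts) ∧ OpFrame s s' := by
  obtain ⟨F, L, m, ψ, H, hψ, hr, hF⟩ := h.hubs
  have hadr := address_lt hw (length_le_totalVerts (t₂ :: t₁ :: ts)) (by omega)
  have hbase := h.base
  obtain ⟨hr₂, hr₁, hr₀⟩ := hr
  simp only [List.length_cons, add_mul, one_mul] at hadr hbase hF hr₂
  set a := ts.length * k with ha
  have hc₁ := rowCount_le_numVerts ht.1 hr₁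
  have hc₂ := rowCount_le_numVerts ht.2.1 hr₂
  -- A row has at most as many nonempty cells as its graph has vertices, hence at most n, so
  -- comparing costs O(kn).
  have hcost : 9 + (k * 18 + rowCount F a k * (k * 92 + 6) + 6 + (k * 216 + 6)) ≤
      360 * (k * n) := by
    have hv : totalVerts (t₂ :: t₁ :: ts) = t₂.numVerts + (t₁.numVerts + totalVerts ts) := by
      simp [totalVerts]
    have h1 : rowCount F a k * (k * 92 + 6) ≤ n * (k * 98) :=
      Nat.mul_le_mul (by omega) (by have := hw.2.1; omega)
    have h2 : k ≤ k * n := Nat.le_mul_of_pos_right _ hw.1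
    have h3 : n * (k * 98) = 98 * (k * n) := by ring
    have := hw.2.1
    omega
  refine Runs.mono (B := 9 + (_ + _)) (Runs.seq (Runs.of_run ⟨trivial, trivial⟩ (by decide) ?_))
    hcost fun _ h => h
  have hrun : Cmd.run w (.seq (.assign 4 (.reg 4 - .reg 1)) (.assign 7 (.reg 4 - .reg 1))) s =
      (s.setReg 4 (a + k)).setReg 7 a := by
    simp [Cmd.run, Expr.eval_sub, Expr.eval_reg, hbase, h.setup.reg_one]
  rw [hrun]
  set s₁ := (s.setReg 4 (a + k)).setReg 7 a with hs₁
  have hS₁ : Setup k G s₁ := (h.setup.frame le_rfl (Frame.setReg _ _ le_rfl)).frame le_rfl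
    (Frame.setReg _ _ (by omega))
  have H₁ : Hubs k G s₁ F L m (totalVerts (t₂ :: t₁ :: ts)) ψ :=
    (H.setReg _ (by omega)).setReg _ (by omega)
  have hO₁ : OpFrame s s₁ := (OpFrame.setReg _ _ (by omega) (by omega)).trans
    (OpFrame.setReg _ _ (by omega) (by omega))
  have r4 : s₁.reg 4 = a + k := by simp [hs₁]
  have r7 : s₁.reg 7 = a := by simp [hs₁]
  have hnum := CWExpr.numVerts_union ht
  have hverts : totalVerts (t₁.union t₂ :: ts) = totalVerts (t₂ :: t₁ :: ts) := by
    simp only [totalVerts, List.map_cons, List.sum_cons, hnum]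
    omega
  -- The pairs compared now are paid by the slack of `pairBound` under addition of the vertex
  -- numbers.
  have hpairs : ψ + rowCount F a k * rowCount F (a + k) k ≤ totalPairs (t₁.union t₂ :: ts) := by
    have := CWExpr.pairBound_add (rowCount_le F a k) hc₁ (rowCount_le F (a + k) k) hc₂
    simp only [totalPairs, List.map_cons, List.sum_cons, hnum] at hψ ⊢
    omega
  have hψn : ψ + rowCount F a k * rowCount F (a + k) k ≤ 2 * k * n :=
    (hpairs.trans (totalPairs_le _)).trans (Nat.mul_le_mul_left _ (by omega))
  refine Runs.seq ((runs_compareRows H₁ hw hS₁ r7 r4 (by omega) (by omega) hψn ?_).mono le_rfl ?_)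
  · intro i hi j hj u hu u' hu' v hv v' hv'
    have e₁ := hr₁ ⟨i, hi⟩
    have e₂ := hr₂ ⟨j, hj⟩
    simp only at e₁ e₂
    rw [e₁] at hu hu'
    rw [e₂] at hv hv'
    exact hR.adj_congr ht hu hu' hv hv'
  rintro s₂ ⟨⟨ψ', H₂, hψ'⟩, hf₂, hm₂, hcov⟩
  refine (runs_mergeRows H₂ hw (hS₁.frame (by omega) hf₂) (a := a)
    (by rw [hf₂.1 7 (by omega) (by omega), r7]) (by rw [hf₂.1 4 (by omega) (by omega), r4])
    (by omega)).mono le_rfl ?_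
  rintro s₃ ⟨⟨L', m', H₃⟩, hf₃, hm₃⟩
  have hf := hf₂.trans hf₃
  have hm : ArcMono n s s₃ := (ArcMono.trans (ArcMono.of_arr fun _ _ _ => rfl) hm₂).trans hm₃
  refine ⟨⟨hS₁.frame (by omega) hf, ?_, ⟨mergedRows F k a k, L', m', ψ', by rw [hverts]; exact H₃,
    hψ'.trans hpairs, ⟨fun l => ?_, hr₀.congr fun p hp => ?_⟩, fun p hp => ?_⟩, ?_⟩,
    hO₁.trans (hf.opFrame (by omega))⟩
  · rw [hf.1 4 (by omega) (by omega), r4]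
    simp [add_mul, ha]
  · have := l.isLt
    rw [← ha]
    unfold mergedRows
    rw [if_pos (by omega), hr₁ l, add_right_comm, hr₂ l]
    ext v
    simp [CWExpr.HasLabel, or_comm]
  · unfold mergedRows
    rw [if_neg (by omega), if_neg (by omega)]
  · simp only [List.length_cons, add_mul, one_mul] at hp
    unfold mergedRows
    rw [if_neg (by omega)]
    split_ifs with hif
    · rfl
    · exact hF p (by omega)
  · intro t' ht' u hu v hv hadj
    have cross : ∀ u ∈ t₁.verts, ∀ v ∈ t₂.verts, G.Adj u v → Covered s₃ u v ∧ Covered s₃ v u := by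
      intro u hu v hv hadj
      obtain ⟨i, hi⟩ := CWExpr.mem_verts_iff.1 hu
      obtain ⟨j, hj⟩ := CWExpr.mem_verts_iff.1 hv
      refine (hcov i i.isLt j j.isLt).mono hm₃ u ?_ v ?_ hadj
      · rw [hr₁ i]; exact hi
      · rw [hr₂ j]; exact hj
    rcases List.mem_cons.1 ht' with rfl | ht'
    · rcases hu with hu | hu <;> rcases hv with hv | hv
      · exact (h.covered t₁ (by simp) u hu v hv hadj).mono hm
      · exact (cross u hu v hv hadj).1
      · exact (cross v hv u hu hadj.symm).2
      · exact (h.covered t₂ (by simp) u hu v hv hadj).mono hm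
    · exact (h.covered t' (by simp [ht']) u hu v hv hadj).mono hm

end WordRAM

/-! ### Running the whole expression -/

namespace WordRAM

variable {n k w : ℕ} {G : SimpleGraph (Fin n)} {s : State}

/-- Execute the operation with code `reg 17`. -/
def dispatch : Cmd :=
  .cond (.reg 17)
    (.cond (.reg 17 - 1) (.cond (.reg 17 - 2) opRelabel .skip) opUnion)
    opVertex

/-- Read and execute the operation number `reg 6` of the expression. -/
def doOp : Cmd :=
  .seq (.seq (.assign 8 (.cell 1 (3 * .reg 6 + 1))) (.seq (.assign 9 (.cell 1 (3 * .reg 6 + 2)))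
    (.assign 17 (.cell 1 (3 * .reg 6)))))
  (.seq dispatch (.assign 6 (.reg 6 + 1)))

/-- Execute the operations of the expression, whose number is in register `2`. -/
def build : Cmd := .loop (.op .lt (.reg 6) (.reg 2)) doOp

/-- The invariant of `build`: the operations before number `i` have been executed. -/
structure BuildState (G : SimpleGraph (Fin n)) (s₀ : State) (ts : List (CWExpr (Fin n) k)) (i : ℕ)
    (s : State) : Prop where
  building : Building G s ts
  size : s.reg 2 = s₀.reg 2
  code : s.arr 1 = s₀.arr 1
  dist : s.arr 9 = s₀.arr 9
  pos : s.reg 6 = i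

theorem runs_doOp {s₀ : State} {ts ts' : List (CWExpr (Fin n) k)} {i c x y B : ℕ}
    (h : BuildState G s₀ ts i s) (hi : i < s₀.reg 2) (hL : 3 * s₀.reg 2 + 3 < 2 ^ w)
    (hc : s₀.arr 1 (3 * i) = c) (hx : s₀.arr 1 (3 * i + 1) = x) (hy : s₀.arr 1 (3 * i + 2) = y)
    (hrun : ∀ s, Building G s ts → s.reg 8 = x → s.reg 9 = y → s.reg 17 = c →
      Runs w dispatch s B fun s' => Building G s' ts' ∧ OpFrame s s') :
    ∃ s' T, Iter w (.op .lt (.reg 6) (.reg 2)) doOp s s' T ∧ T ≤ B + 30 ∧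
      BuildState G s₀ ts' (i + 1) s' := by
  have e1 : 1 % 2 ^ w = 1 := Nat.mod_eq_of_lt (by omega)
  have e2 : 2 % 2 ^ w = 2 := Nat.mod_eq_of_lt (by omega)
  have e3 : 3 % 2 ^ w = 3 := Nat.mod_eq_of_lt (by omega)
  have e4 : 3 * i % 2 ^ w = 3 * i := Nat.mod_eq_of_lt (by omega)
  have e5 : (3 * i + 1) % 2 ^ w = 3 * i + 1 := Nat.mod_eq_of_lt (by omega)
  have e6 : (3 * i + 2) % 2 ^ w = 3 * i + 2 := Nat.mod_eq_of_lt (by omega)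
  have e7 : (i + 1) % 2 ^ w = i + 1 := Nat.mod_eq_of_lt (by omega)
  have hcond : (Expr.op .lt (.reg 6) (.reg 2)).eval w s ≠ 0 := by
    simp [Expr.eval, Op.eval, h.pos, h.size, hi]
  have key : Runs w doOp s (21 + (B + 4)) fun s' => BuildState G s₀ ts' (i + 1) s' := by
    refine Runs.seq (Runs.of_run ⟨trivial, trivial, trivial⟩ (by decide) ?_)
    have hrun₁ : Cmd.run w (.seq (.assign 8 (.cell 1 (3 * .reg 6 + 1)))
        (.seq (.assign 9 (.cell 1 (3 * .reg 6 + 2))) (.assign 17 (.cell 1 (3 * .reg 6))))) s =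
        ((s.setReg 8 x).setReg 9 y).setReg 17 c := by
      simp [Cmd.run, Expr.eval_add, Expr.eval_mul, Expr.eval_reg, Expr.eval_cell, Expr.eval_one,
        Expr.eval_two, Expr.eval_three, h.pos, h.code, e1, e2, e3, e4, e5, e6, hc, hx, hy]
    rw [hrun₁]
    refine Runs.seq ((hrun _ (((h.building.setReg _ (by omega)).setReg _ (by omega)).setReg _
      (by omega)) (by simp) (by simp) (by simp)).mono le_rfl ?_)
    rintro s' ⟨k₁, k₂, k₃, k₄, k₅⟩
    simp only [State.reg_setReg, State.arr_setReg, Nat.reduceEqDiff, if_false] at k₂ k₃ k₄ k₅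
    refine Runs.of_run trivial (by decide) ?_
    have hrun₂ : Cmd.run w (.assign 6 (.reg 6 + 1)) s' = s'.setReg 6 (i + 1) := by
      simp [Cmd.run, Expr.eval_add, Expr.eval_reg, Expr.eval_one, k₃, h.pos, e1, e7]
    rw [hrun₂]
    exact ⟨k₁.setReg _ (by omega), by simp [k₂, h.size], by simp [k₄, h.code],
      by simp [k₅, h.dist], by simp⟩
  obtain ⟨s', T, h₁, h₂, h₃⟩ := key
  exact ⟨s', _, .step hcond h₁ (.refl s'), by simp only [Expr.cost]; omega, h₃⟩

theorem eval_code_sub_one (hw : Wide n k w) (s : State) :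
    (Expr.reg 17 - 1 : Expr).eval w s = s.reg 17 - 1 := by
  have e1 : 1 % 2 ^ w = 1 := Nat.mod_eq_of_lt (by have := hw.2.2; omega)
  rw [Expr.eval_sub, Expr.eval_one, Expr.eval_reg, e1]

theorem eval_code_sub_two (hw : Wide n k w) (s : State) :
    (Expr.reg 17 - 2 : Expr).eval w s = s.reg 17 - 2 := by
  have e1 : 2 % 2 ^ w = 2 := Nat.mod_eq_of_lt (by have := hw.2.2; omega)
  rw [Expr.eval_sub, Expr.eval_two, Expr.eval_reg, e1]

theorem getD_append_at {c d : List ℕ} {p i : ℕ} (hp : c.length = p) :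
    (c ++ d).getD (p + i) 0 = d.getD i 0 := by
  subst hp
  rw [List.getD_append_right _ _ _ _ (by omega), Nat.add_sub_cancel_left]

/-- An expression with p vertices contains p − 1 unions. Each is charged 400kn, and every operation
300 in addition; writing the term 400kn on the left replaces the factor p − 1 by p and makes the
bound add up at a union. -/
theorem iter_build (t : CWExpr (Fin n) k) (hw : Wide n k w) {s₀ : State}
    (hL : 3 * s₀.reg 2 + 3 < 2 ^ w) (ht : t.WellFormed) (hR : t.Refines G)
    {ts : List (CWExpr (Fin n) k)} {i : ℕ} (hn : totalVerts ts + t.numVerts ≤ n)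
    (hi : i + t.size ≤ s₀.reg 2)
    (hcode : ∀ j < 3 * t.size, s₀.arr 1 (3 * i + j) = t.code.getD j 0)
    (h : BuildState G s₀ ts i s) :
    ∃ s' T, Iter w (.op .lt (.reg 6) (.reg 2)) doOp s s' T ∧
      T + 400 * (k * n) ≤ 300 * t.size + 400 * (k * n) * t.numVerts ∧
      BuildState G s₀ (t :: ts) (i + t.size) s' := by
  induction t generalizing ts i s with
  | vertex l v =>
    simp only [CWExpr.size] at hi hcode ⊢
    have hone : (CWExpr.vertex l v : CWExpr (Fin n) k).numVerts = 1 := Set.ncard_singleton v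
    rw [hone] at hn
    obtain ⟨s', T, h₁, h₂, h₃⟩ := runs_doOp (w := w) (B := 62) (ts' := .vertex l v :: ts) h
      (by omega) hL (hcode 0 (by omega)) (hcode 1 (by omega)) (hcode 2 (by omega)) (by
        intro s hB h8 h9 h17
        exact Runs.mono (B := (Expr.reg 17).cost + 1 + 60) (Runs.cond
          (fun hc => (hc (by rw [Expr.eval_reg, h17]; rfl)).elim)
          fun _ => runs_opVertex hB hw h8 h9 hn) (by decide) fun _ h => h)
    exact ⟨s', T, h₁, by rw [hone]; omega, h₃⟩
  | union t₁ t₂ ih₁ ih₂ =>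
    have hnum := CWExpr.numVerts_union ht
    simp only [CWExpr.size, CWExpr.code, hnum, mul_add] at hn hi hcode ⊢
    have l₁ := t₁.length_code
    have l₂ := t₂.length_code
    obtain ⟨s₁, T₁, h₁, b₁, k₁⟩ := ih₁ ht.1 (hR.union_left ht) (ts := ts) (i := i) (by omega)
      (by omega) (fun j hj => by
        rw [hcode j (by omega), List.append_assoc, List.getD_append _ _ _ _ (by omega)]) h
    obtain ⟨s₂, T₂, h₂, b₂, k₂⟩ := ih₂ ht.2.1 (hR.union_right ht) (ts := t₁ :: ts)
      (i := i + t₁.size) (by simp only [totalVerts, List.map_cons, List.sum_cons] at hn ⊢; omega)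
      (by omega) (fun j hj => by
        have := hcode (3 * t₁.size + j) (by omega)
        rw [List.append_assoc, getD_append_at l₁, List.getD_append _ _ _ _ (by omega)] at this
        rw [← this]; congr 1; ring) k₁
    have hlast : ∀ j < 3, s₀.arr 1 (3 * (i + t₁.size + t₂.size) + j) = [1, 0, 0].getD j 0 := by
      intro j hj
      have := hcode (3 * t₁.size + 3 * t₂.size + j) (by omega)
      rw [getD_append_at (by rw [List.length_append, l₁, l₂])] at this
      rw [← this]; congr 1; ring
    obtain ⟨s₃, T₃, h₃, b₃, k₃⟩ := runs_doOp (w := w) (B := 6 + 360 * (k * n))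
      (ts' := t₁.union t₂ :: ts) k₂ (by omega) hL (hlast 0 (by omega)) (hlast 1 (by omega))
      (hlast 2 (by omega)) (by
        intro s hB h8 h9 h17
        refine Runs.mono (B := (Expr.reg 17).cost + 1 + ((Expr.reg 17 - 1).cost + 1 +
          360 * (k * n))) (Runs.cond (fun _ => Runs.cond (fun hc => ?_) fun _ => ?_)
          fun hc => ?_) ?_ fun _ h => h
        · rw [eval_code_sub_one hw, h17] at hc
          exact (hc rfl).elim
        · refine runs_opUnion hB hw ht hR ?_
          simp only [totalVerts, List.map_cons, List.sum_cons] at hn ⊢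
          omega
        · rw [Expr.eval_reg, h17] at hc
          exact absurd hc (by simp)
        · rw [← add_assoc]
          exact Nat.add_le_add_right (by decide) _)
    refine ⟨s₃, _, (h₁.trans h₂).trans h₃, ?_, by rw [← add_assoc, ← add_assoc]; exact k₃⟩
    have : 0 < k * n := Nat.mul_pos hw.2.1 hw.1
    omega
  | join l l' t ih =>
    simp only [CWExpr.size, CWExpr.code, mul_add] at hi hcode ⊢
    have hl := t.length_code
    obtain ⟨s₁, T₁, h₁, b₁, k₁⟩ := ih ht.1 (hR.join ht) (ts := ts) (i := i) hn (by omega)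
      (fun j hj => by rw [hcode j (by omega), List.getD_append _ _ _ _ (by omega)]) h
    have hlast : ∀ j < 3, s₀.arr 1 (3 * (i + t.size) + j) = [2, l.val, l'.val].getD j 0 := by
      intro j hj
      have := hcode (3 * t.size + j) (by omega)
      rw [getD_append_at hl] at this
      rw [← this]; congr 1; ring
    obtain ⟨s₃, T₃, h₃, b₃, k₃⟩ := runs_doOp (w := w) (B := 20)
      (ts' := t.join l l' :: ts) k₁ (by omega) hL (hlast 0 (by omega)) (hlast 1 (by omega))
      (hlast 2 (by omega)) (by
        intro s hB h8 h9 h17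
        refine Runs.mono (B := (Expr.reg 17).cost + 1 + ((Expr.reg 17 - 1).cost + 1 +
          ((Expr.reg 17 - 2).cost + 1 + 1))) (Runs.cond (fun _ => Runs.cond (fun _ => Runs.cond
          (fun hc => ?_) fun _ => ?_) fun hc => ?_) fun hc => ?_) (by decide) fun _ h => h
        · rw [eval_code_sub_two hw, h17] at hc
          exact (hc rfl).elim
        -- A join needs no work: coverage refers to the edges of G, which are read off the matrix at
        -- the unions, and a join changes no label.
        · refine Runs.of_run trivial (by decide) ⟨⟨hB.setup, hB.base, hB.hubs, ?_⟩,
            rfl, rfl, rfl, rfl⟩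
          intro t' ht' u hu v hv hadj
          rcases List.mem_cons.1 ht' with rfl | ht'
          · exact hB.covered t (by simp) u hu v hv hadj
          · exact hB.covered t' (by simp [ht']) u hu v hv hadj
        · rw [eval_code_sub_one hw, h17] at hc
          exact absurd hc (by simp)
        · rw [Expr.eval_reg, h17] at hc
          exact absurd hc (by simp))
    exact ⟨s₃, _, h₁.trans h₃, by change _ ≤ _ + _ * t.numVerts; omega, k₃⟩
  | relabel l l' t ih =>
    simp only [CWExpr.size, CWExpr.code, mul_add] at hi hcode ⊢
    have hl := t.length_code
    obtain ⟨s₁, T₁, h₁, b₁, k₁⟩ := ih ht hR.relabel (ts := ts) (i := i) hn (by omega)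
      (fun j hj => by rw [hcode j (by omega), List.getD_append _ _ _ _ (by omega)]) h
    have hlast : ∀ j < 3, s₀.arr 1 (3 * (i + t.size) + j) = [3, l.val, l'.val].getD j 0 := by
      intro j hj
      have := hcode (3 * t.size + j) (by omega)
      rw [getD_append_at hl] at this
      rw [← this]; congr 1; ring
    obtain ⟨s₃, T₃, h₃, b₃, k₃⟩ := runs_doOp (w := w) (B := 240)
      (ts' := t.relabel l l' :: ts) k₁ (by omega) hL (hlast 0 (by omega)) (hlast 1 (by omega))
      (hlast 2 (by omega)) (by
        intro s hB h8 h9 h17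
        refine Runs.mono (B := (Expr.reg 17).cost + 1 + ((Expr.reg 17 - 1).cost + 1 +
          ((Expr.reg 17 - 2).cost + 1 + 220))) (Runs.cond (fun _ => Runs.cond (fun _ => Runs.cond
          (fun _ => ?_) fun hc => ?_) fun hc => ?_) fun hc => ?_) (by decide) fun _ h => h
        · refine runs_opRelabel hB hw h8 h9 ?_
          simp only [totalVerts, List.map_cons, List.sum_cons]
          have : (CWExpr.relabel l l' t).numVerts = t.numVerts := rfl
          simp only [totalVerts] at hn
          omega
        · rw [eval_code_sub_two hw, h17] at hc
          exact absurd hc (by simp)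
        · rw [eval_code_sub_one hw, h17] at hc
          exact absurd hc (by simp)
        · rw [Expr.eval_reg, h17] at hc
          exact absurd hc (by simp))
    exact ⟨s₃, _, h₁.trans h₃, by change _ ≤ _ + _ * t.numVerts; omega, k₃⟩

/-- The memory after all operations of the expression `t` of `G` have been executed. -/
theorem runs_build (t : CWExpr (Fin n) k) (hw : Wide n k w) {s : State}
    (hL : 3 * s.reg 2 + 3 < 2 ^ w) (hG : t.Generates G) (hs : s.reg 2 = t.size)
    (hcode : ∀ j < 3 * t.size, s.arr 1 j = t.code.getD j 0) (h6 : s.reg 6 = 0)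
    (h : Building G s ([] : List (CWExpr (Fin n) k))) :
    Runs w build s (300 * t.size + 400 * (k * n) * n + 4) fun s' => Building G s' [t] ∧
      s'.arr 9 = s.arr 9 := by
  have hn : t.numVerts = n := by
    rw [CWExpr.numVerts, hG.2.1, Set.ncard_univ, Nat.card_fin]
  obtain ⟨s', T, h₁, h₂, h₃⟩ := iter_build t hw hL hG.1 hG.refines (ts := []) (i := 0) (s := s)
    (by simp [totalVerts, hn]) (by omega) (by simpa using hcode) ⟨h, rfl, rfl, rfl, h6⟩
  refine ⟨s', _, h₁.exec_loop ?_, ?_, h₃.building, h₃.dist⟩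
  · simp [Expr.eval, Op.eval, h₃.pos, h₃.size, hs]
  · rw [hn] at h₂
    simp only [Expr.cost]
    omega

end WordRAM

namespace WordRAM

/-! ### Breadth-first search with arcs of length `0` and `1` -/

/-- The queue of the search in array `10` has `tail` entries. The distance of a node `x` plus `1` is
the cell `B + x` of array `9`, which is zero as long as `x` has not been reached. The search started
at the node `r` in the state `s₀`, and `Good x d` holds if `x` has been reached with the value
`d`. -/
structure Queue (N B r : ℕ) (Good : ℕ → ℕ → Prop) (s₀ s : State) (tail : ℕ) : Prop where
  reg_tail : s.reg 22 = tail
  reg : ∀ x ≤ 21, s.reg x = s₀.reg x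
  arr : ∀ a, a ≠ 9 → a ≠ 10 → s.arr a = s₀.arr a
  out : ∀ p, p < B ∨ B + N ≤ p → s.arr 9 p = s₀.arr 9 p
  root : s.arr 9 (B + r) = 1
  lt : ∀ i < tail, s.arr 10 i < N
  reached : ∀ i < tail, s.arr 9 (B + s.arr 10 i) ≠ 0
  inj : ∀ i < tail, ∀ j < tail, s.arr 10 i = s.arr 10 j → i = j
  surj : ∀ x < N, s.arr 9 (B + x) ≠ 0 → ∃ i < tail, s.arr 10 i = x
  good : ∀ x < N, s.arr 9 (B + x) ≠ 0 → Good x (s.arr 9 (B + x))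
  sorted : ∀ i j, i ≤ j → j < tail → s.arr 9 (B + s.arr 10 i) ≤ s.arr 9 (B + s.arr 10 j)
  small : ∀ i < tail, s.arr 9 (B + s.arr 10 i) ≤ i + 1

/-- The queue has been extended by nodes with the value `D`. -/
structure Extends (N B D : ℕ) (s : State) (tail : ℕ) (s' : State) (tail' : ℕ) : Prop where
  le : tail ≤ tail'
  queue : ∀ i < tail, s'.arr 10 i = s.arr 10 i
  dist : ∀ x < N, s.arr 9 (B + x) ≠ 0 → s'.arr 9 (B + x) = s.arr 9 (B + x)
  new : ∀ i, tail ≤ i → i < tail' → s'.arr 9 (B + s'.arr 10 i) = D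

variable {N B r D w : ℕ} {Good : ℕ → ℕ → Prop} {s₀ s s' s'' : State} {tail tail' tail'' : ℕ}

theorem Extends.refl : Extends N B D s tail s tail :=
  ⟨le_rfl, fun _ _ => rfl, fun _ _ _ => rfl, fun i h h' => by omega⟩

theorem Extends.congr {t t' : State} (h : Extends N B D s tail s' tail') (hs : t.arr = s.arr)
    (hs' : t'.arr = s'.arr) : Extends N B D t tail t' tail' := by
  obtain ⟨h₁, h₂, h₃, h₄⟩ := h
  rw [← hs, ← hs'] at *
  exact ⟨h₁, by rwa [hs, hs'], by rwa [hs, hs'], by rwa [hs']⟩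

theorem Queue.tail_le (h : Queue N B r Good s₀ s tail) : tail ≤ N := by
  have := Finset.card_le_card_of_injOn (s := Finset.range tail) (t := Finset.range N) (s.arr 10)
    (fun i hi => by
      simpa using h.lt i (by simpa using hi))
    (fun i hi j hj hij => h.inj i (by simpa using hi) j (by simpa using hj) hij)
  simpa using this

theorem Queue.setReg (h : Queue N B r Good s₀ s tail) {x : ℕ} (v : ℕ) (hx : 22 < x) :
    Queue N B r Good s₀ (s.setReg x v) tail :=
  ⟨by simpa [show 22 ≠ x by omega] using h.reg_tail,
    fun y hy => by simpa [show y ≠ x by omega] using h.reg y hy,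
    h.arr, h.out, h.root, h.lt, h.reached, h.inj, h.surj, h.good, h.sorted, h.small⟩

/-- Append the node `y` to the queue with the value `D`. -/
def State.push (s : State) (B tail y D : ℕ) : State :=
  ((s.setArr 9 (B + y) D).setArr 10 tail y).setReg 22 (tail + 1)

/-- Sortedness persists because `D` dominates all values so far. The bound `D ≤ tail + 1` maintains
`small`, which keeps values below N + 1 and so excludes overflow. -/
theorem Queue.push (h : Queue N B r Good s₀ s tail) {y : ℕ} (hy : y < N)
    (h0 : s.arr 9 (B + y) = 0) (hD : D ≠ 0) (hDt : D ≤ tail + 1) (hg : Good y D)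
    (hle : ∀ i < tail, s.arr 9 (B + s.arr 10 i) ≤ D) :
    Queue N B r Good s₀ (s.push B tail y D) (tail + 1) ∧
      Extends N B D s tail (s.push B tail y D) (tail + 1) := by
  have a9 : (s.push B tail y D).arr 9 = Function.update (s.arr 9) (B + y) D := by
    simp [State.push]
  have a10 : (s.push B tail y D).arr 10 = Function.update (s.arr 10) tail y := by
    simp [State.push]
  have q_old : ∀ i < tail, (s.push B tail y D).arr 10 i = s.arr 10 i := fun i hi => by
    rw [a10, Function.update_of_ne (by omega)]
  have q_new : (s.push B tail y D).arr 10 tail = y := by rw [a10, Function.update_self]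
  have d_new : (s.push B tail y D).arr 9 (B + y) = D := by rw [a9, Function.update_self]
  have d_old : ∀ x, s.arr 9 (B + x) ≠ 0 → (s.push B tail y D).arr 9 (B + x) = s.arr 9 (B + x) := by
    intro x hx
    rw [a9, Function.update_of_ne]
    intro hxy
    rw [hxy] at hx
    exact hx h0
  have d_ne : ∀ x, x ≠ y → (s.push B tail y D).arr 9 (B + x) = s.arr 9 (B + x) := by
    intro x hx
    rw [a9, Function.update_of_ne (by omega)]
  have val : ∀ i < tail, (s.push B tail y D).arr 9 (B + (s.push B tail y D).arr 10 i) =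
      s.arr 9 (B + s.arr 10 i) := fun i hi => by
    rw [q_old i hi, d_old _ (h.reached i hi)]
  have hne : ∀ i < tail, s.arr 10 i ≠ y := fun i hi hiy => h.reached i hi (by rw [hiy, h0])
  refine ⟨⟨by simp [State.push], fun x hx => ?_, fun a h₁ h₂ => ?_, fun p hp => ?_, ?_, ?_, ?_, ?_,
    ?_, ?_, ?_, ?_⟩, ⟨by omega, q_old, fun x _ => d_old x, fun i h₁ h₂ => ?_⟩⟩
  · rw [← h.reg x hx]; simp [State.push, show x ≠ 22 by omega]
  · rw [← h.arr a h₁ h₂]; simp [State.push, h₁, h₂]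
  · rw [a9, Function.update_of_ne (by omega), h.out p hp]
  · rw [d_old _ (by rw [h.root]; omega), h.root]
  · intro i hi
    rcases Nat.lt_succ_iff_lt_or_eq.1 hi with hi | rfl
    · rw [q_old i hi]; exact h.lt i hi
    · rwa [q_new]
  · intro i hi
    rcases Nat.lt_succ_iff_lt_or_eq.1 hi with hi | rfl
    · rw [val i hi]; exact h.reached i hi
    · rwa [q_new, d_new]
  · intro i hi j hj hij
    rcases Nat.lt_succ_iff_lt_or_eq.1 hi with hi | rfl <;>
      rcases Nat.lt_succ_iff_lt_or_eq.1 hj with hj | rfl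
    · rw [q_old i hi, q_old j hj] at hij; exact h.inj i hi j hj hij
    · rw [q_old i hi, q_new] at hij; exact (hne i hi hij).elim
    · rw [q_old j hj, q_new] at hij; exact (hne j hj hij.symm).elim
    · rfl
  · intro x hx hxd
    by_cases hxy : x = y
    · exact ⟨tail, by omega, by rw [q_new, hxy]⟩
    · rw [d_ne x hxy] at hxd
      obtain ⟨i, hi, hix⟩ := h.surj x hx hxd
      exact ⟨i, by omega, by rw [q_old i hi, hix]⟩
  · intro x hx hxd
    by_cases hxy : x = y
    · subst hxy; rwa [d_new]
    · rw [d_ne x hxy] at hxd ⊢; exact h.good x hx hxd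
  · intro i j hij hj
    rcases Nat.lt_succ_iff_lt_or_eq.1 hj with hj | rfl
    · rw [val i (by omega), val j hj]; exact h.sorted i j hij hj
    · rw [q_new, d_new]
      rcases hij.lt_or_eq with hi | rfl
      · rw [val i hi]; exact hle i hi
      · rw [q_new, d_new]
  · intro i hi
    rcases Nat.lt_succ_iff_lt_or_eq.1 hi with hi | rfl
    · rw [val i hi]; exact h.small i hi
    · rwa [q_new, d_new]
  · obtain rfl : i = tail := by omega
    rw [q_new, d_new]

theorem Queue.extends_reached (h : Queue N B r Good s₀ s tail)
    (he : Extends N B D s tail s' tail') {i : ℕ} (hi : i < tail) :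
    s'.arr 9 (B + s'.arr 10 i) = s.arr 9 (B + s.arr 10 i) := by
  rw [he.queue i hi, he.dist _ (h.lt i hi) (h.reached i hi)]

theorem Extends.trans (h : Queue N B r Good s₀ s' tail') (he : Extends N B D s tail s' tail')
    (he' : Extends N B D s' tail' s'' tail'') : Extends N B D s tail s'' tail'' := by
  refine ⟨he.le.trans he'.le, fun i hi => ?_, fun x hx hxd => ?_, fun i h₁ h₂ => ?_⟩
  · rw [he'.queue i (hi.trans_le he.le), he.queue i hi]
  · rw [he'.dist x hx (by rwa [he.dist x hx hxd]), he.dist x hx hxd]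
  · by_cases hi : i < tail'
    · rw [h.extends_reached he' hi, he.new i h₁ hi]
    · exact he'.new i (by omega) h₂

/-- Push the node in register `29` with the value in register `26`, unless it has been reached. -/
def visit : Cmd :=
  .cond (.cell 9 (.reg 21 + .reg 29)) .skip
    (.seq (.write 9 (.reg 21 + .reg 29) (.reg 26))
      (.seq (.write 10 (.reg 22) (.reg 29)) (.assign 22 (.reg 22 + 1))))

/-- Visit the ends of the arcs from the node in register `25` in the adjacency lists in the arrays
`a` and `a + 1`, the arcs having length `l`. -/
def relax (a l : ℕ) : Cmd :=
  .seq (.seq (.assign 26 (.cell 9 (.reg 21 + .reg 25) + .const l)) (.assign 28 (.cell a (.reg 25))))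
    (forCmd 27 28 (.seq (.assign 29 (.cell (a + 1) (.reg 27 * .reg 3 + .reg 25))) visit))

theorem runs_visit (h : Queue N B r Good s₀ s tail) (h21 : s₀.reg 21 = B)
    (hw : B + N + 2 < 2 ^ w) {y : ℕ}
    (h29 : s.reg 29 = y) (h26 : s.reg 26 = D) (hy : y < N)
    (hD : D ≠ 0) (hDt : D ≤ tail + 1) (hg : Good y D)
    (hle : ∀ i < tail, s.arr 9 (B + s.arr 10 i) ≤ D) :
    Runs w visit s 20 fun s' => ∃ tail', Queue N B r Good s₀ s' tail' ∧
      Extends N B D s tail s' tail' ∧ s'.arr 9 (B + y) ≠ 0 ∧ ∀ x, x ≠ 22 → s'.reg x = s.reg x := by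
  have htail := h.tail_le
  have r21 : s.reg 21 = B := by rw [h.reg 21 le_rfl, h21]
  have e1 : 1 % 2 ^ w = 1 := Nat.mod_eq_of_lt (by omega)
  have e2 : (B + y) % 2 ^ w = B + y := Nat.mod_eq_of_lt (by omega)
  have e3 : (tail + 1) % 2 ^ w = tail + 1 := Nat.mod_eq_of_lt (by omega)
  have hval : (Expr.cell 9 (.reg 21 + .reg 29)).eval w s = s.arr 9 (B + y) := by
    simp [Expr.eval_cell, Expr.eval_add, Expr.eval_reg, r21, h29, e2]
  refine Runs.mono (B := (Expr.cell 9 (.reg 21 + .reg 29)).cost + 1 + 12) (Runs.cond (fun hc => ?_)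
    fun hc => ?_) (by decide) fun _ h => h
  · rw [hval] at hc
    exact Runs.of_run trivial (by decide) ⟨tail, h, Extends.refl, hc, fun _ _ => rfl⟩
  · rw [hval] at hc
    refine Runs.of_run ⟨trivial, trivial, trivial⟩ (by decide) ?_
    have hrun : Cmd.run w (.seq (.write 9 (.reg 21 + .reg 29) (.reg 26))
        (.seq (.write 10 (.reg 22) (.reg 29)) (.assign 22 (.reg 22 + 1)))) s =
        s.push B tail y D := by
      simp [Cmd.run, Expr.eval_add, Expr.eval_reg, Expr.eval_one, r21, h29, h26, h.reg_tail,
        e1, e2, e3, State.push]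
    rw [hrun]
    obtain ⟨k₁, k₂⟩ := h.push hy hc hD hDt hg hle
    refine ⟨_, k₁, k₂, ?_, fun x hx => by simp [State.push, hx]⟩
    simpa [State.push] using hD

/-- The hypothesis `hle` says that the ends of the arcs may be appended without breaking the order
of the queue. Since x is at position `t < tail`, its value is at most `t + 1`, so with `l ≤ 1` the
new value is at most `tail + 1`. -/
theorem runs_relax {a l x t : ℕ} (h : Queue N B r Good s₀ s tail) (h21 : s₀.reg 21 = B)
    (h3 : s₀.reg 3 = N) (ha : a < 8)
    (hw : B + N + 2 < 2 ^ w) (hdw : (∑ u ∈ Finset.range N, s₀.arr a u + 1) * N + 1 < 2 ^ w)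
    (harc : ∀ x y, Arc N a s₀ x y → y < N)
    (hgood : ∀ x y d, Arc N a s₀ x y → Good x d → Good y (d + l)) (hl : l ≤ 1)
    (h25 : s.reg 25 = x) (ht : t < tail) (htx : s.arr 10 t = x)
    (hle : ∀ i < tail, s.arr 9 (B + s.arr 10 i) ≤ s.arr 9 (B + x) + l) :
    Runs w (relax a l) s (50 * (s₀.arr a x + 1)) fun s' => ∃ tail', Queue N B r Good s₀ s' tail' ∧
      Extends N B (s.arr 9 (B + x) + l) s tail s' tail' ∧
      (∀ y, Arc N a s₀ x y → s'.arr 9 (B + y) ≠ 0) ∧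
      s'.reg 23 = s.reg 23 ∧ s'.reg 24 = s.reg 24 := by
  have htail := h.tail_le
  have hxN : x < N := htx ▸ h.lt t ht
  have hdx : s.arr 9 (B + x) ≠ 0 := htx ▸ h.reached t ht
  have hDt : s.arr 9 (B + x) ≤ t + 1 := htx ▸ h.small t ht
  have hgx : Good x (s.arr 9 (B + x)) := h.good x hxN hdx
  set D := s.arr 9 (B + x) + l with hD
  have r21 : s.reg 21 = B := by rw [h.reg 21 le_rfl, h21]
  have e1 : l % 2 ^ w = l := Nat.mod_eq_of_lt (by omega)
  have e2 : (B + x) % 2 ^ w = B + x := Nat.mod_eq_of_lt (by omega)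
  have e3 : (s.arr 9 (B + x) + l) % 2 ^ w = D := Nat.mod_eq_of_lt (by omega)
  have hdeg : (s₀.arr a x + 1) * N + 1 < 2 ^ w := by
    have := Finset.single_le_sum (f := s₀.arr a) (fun _ _ => Nat.zero_le _)
      (Finset.mem_range.2 hxN)
    have := Nat.mul_le_mul_right N (Nat.succ_le_succ this)
    simp only [Nat.succ_eq_add_one] at this
    omega
  have hdeg' : s₀.arr a x + 1 ≤ (s₀.arr a x + 1) * N := Nat.le_mul_of_pos_right _ (by omega)
  have hcost : (Cmd.seq (.assign 26 (.cell 9 (.reg 21 + .reg 25) + .const l))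
      (.assign 28 (.cell a (.reg 25)))).maxCost ≤ 10 := by
    simp only [Cmd.maxCost, HAdd.hAdd, Add.add, Expr.cost]
    decide
  refine Runs.mono (B := 10 + (∑ j ∈ Finset.range (s₀.arr a x), (27 + 8) + 6)) (Runs.seq
    (Runs.of_run ⟨trivial, trivial⟩ hcost ?_)) ?_ fun _ h => h
  swap
  · simp only [Finset.sum_const, Finset.card_range, smul_eq_mul]; omega
  have hrun : Cmd.run w (.seq (.assign 26 (.cell 9 (.reg 21 + .reg 25) + .const l))
      (.assign 28 (.cell a (.reg 25)))) s = (s.setReg 26 D).setReg 28 (s₀.arr a x) := by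
    have ha' := h.arr a (by omega) (by omega)
    have hlc : (Expr.const l).eval w s = l := e1
    simp [Cmd.run, Expr.eval_add, Expr.eval_reg, Expr.eval_cell, r21, h25, e2, e3, ha', hlc]
  rw [hrun]
  set s₁ := (s.setReg 26 D).setReg 28 (s₀.arr a x) with hs₁
  have Q₁ : Queue N B r Good s₀ s₁ tail := (h.setReg _ (by omega)).setReg _ (by omega)
  refine (Runs.for (N := s₀.arr a x) (fun j s' => ∃ tail', Queue N B r Good s₀ s' tail' ∧
      Extends N B D s tail s' tail' ∧
      (∀ j' < j, s'.arr 9 (B + s₀.arr (a + 1) (j' * N + x)) ≠ 0) ∧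
      s'.reg 23 = s.reg 23 ∧ s'.reg 24 = s.reg 24 ∧ s'.reg 25 = x ∧ s'.reg 26 = D)
    (fun _ => 27) (by omega) (by omega) (by simp [hs₁]) ?_ ?_).mono le_rfl ?_
  · exact ⟨tail, Q₁.setReg _ (by omega), Extends.refl.congr rfl rfl, by simp, by simp [hs₁],
      by simp [hs₁], by simp [hs₁, h25], by simp [hs₁]⟩
  · rintro j hj s₂ h27 h28 ⟨tail₂, Q₂, E₂, C₂, r23, r24, r25, r26⟩
    have hjN := Nat.mul_le_mul_right N (show j + 1 ≤ s₀.arr a x from hj)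
    rw [add_mul] at hdeg
    rw [add_mul] at hjN
    have f1 : j * N % 2 ^ w = j * N := Nat.mod_eq_of_lt (by omega)
    have f2 : (j * N + x) % 2 ^ w = j * N + x := Nat.mod_eq_of_lt (by omega)
    set y := s₀.arr (a + 1) (j * N + x) with hy
    have hxy : Arc N a s₀ x y := ⟨hxN, j, hj, rfl⟩
    have hrun₂ : Cmd.run w (.assign 29 (.cell (a + 1) (.reg 27 * .reg 3 + .reg 25))) s₂ =
        s₂.setReg 29 y := by
      have := Q₂.arr (a + 1) (by omega) (by omega)
      simp [Cmd.run, Expr.eval_add, Expr.eval_mul, Expr.eval_reg, Expr.eval_cell, h27, r25,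
        Q₂.reg 3, h3, f1, f2, this, hy]
    refine Runs.mono (B := 7 + 20) (Runs.seq (Runs.of_run trivial (Nat.le_refl 7) ?_)) le_rfl
      fun _ h => h
    rw [hrun₂]
    -- Entries older than this call are bounded by `hle`; those pushed during it have the value `D`
    -- itself.
    have hle₂ : ∀ i < tail₂, s₂.arr 9 (B + s₂.arr 10 i) ≤ D := by
      intro i hi
      by_cases hit : i < tail
      · rw [h.extends_reached E₂ hit]; exact hle i hit
      · exact (E₂.new i (by omega) hi).le
    have hlet := E₂.le
    refine (runs_visit (s := s₂.setReg 29 y) (Q₂.setReg _ (by omega)) h21 hw (y := y) (D := D)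
      (by simp) (by simp [r26]) (harc x y hxy) (by omega) (by omega) (hgood x y _ hxy hgx)
      hle₂).mono le_rfl ?_
    rintro s₃ ⟨tail₃, Q₃, E₃, hy₃, hreg⟩
    have hE₃ : Extends N B D s₂ tail₂ s₃ tail₃ := E₃.congr rfl rfl
    have hregs : ∀ x, x ≠ 22 → x ≠ 29 → s₃.reg x = s₂.reg x := by
      intro x h₁ h₂; rw [hreg x h₁]; simp [h₂]
    refine ⟨by rw [hregs 27 (by omega) (by omega), h27], by rw [hregs 28 (by omega) (by omega), h28],
      tail₃, Q₃.setReg _ (by omega), E₂.trans Q₂ (hE₃.congr rfl rfl), ?_, ?_, ?_, ?_, ?_⟩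
    · intro j' hj'
      rcases Nat.lt_succ_iff_lt_or_eq.1 hj' with hj' | rfl
      · have hlt : s₀.arr (a + 1) (j' * N + x) < N :=
          harc x _ ⟨hxN, j', by omega, rfl⟩
        rw [State.arr_setReg, hE₃.dist _ hlt (C₂ j' hj')]
        exact C₂ j' hj'
      · exact hy₃
    · simp [hregs 23, r23]
    · simp [hregs 24, r24]
    · simp [hregs 25, r25]
    · simp [hregs 26, r26]
  · rintro s' ⟨_, tail', k₁, k₂, k₃, k₄, k₅, _⟩
    refine ⟨tail', k₁, k₂, ?_, k₄, k₅⟩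
    rintro y ⟨_, j, hj, rfl⟩
    exact k₃ j hj

end WordRAM

/-! ### The search with one queue and two heads -/

namespace WordRAM

/-- The invariant of the search: the arcs of length `0` from the first `h₁` nodes of the queue and
the arcs of length `1` from the first `h₂` nodes have been followed. -/
structure Search (N B r : ℕ) (Good : ℕ → ℕ → Prop) (s₀ s : State) (tail h₁ h₂ : ℕ) : Prop where
  queue : Queue N B r Good s₀ s tail
  reg_h₁ : s.reg 23 = h₁
  reg_h₂ : s.reg 24 = h₂
  le₁ : h₁ ≤ tail
  le₂ : h₂ ≤ h₁
  top : ∀ i < tail, ∀ j, h₁ ≤ j → j < tail → s.arr 9 (B + s.arr 10 i) ≤ s.arr 9 (B + s.arr 10 j)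
  near : ∀ i < tail, ∀ j, h₂ ≤ j → j < tail →
    s.arr 9 (B + s.arr 10 i) ≤ s.arr 9 (B + s.arr 10 j) + 1
  closed_zero : ∀ i < h₁, ∀ y, Arc N 5 s₀ (s.arr 10 i) y → s.arr 9 (B + y) ≠ 0 ∧
    s.arr 9 (B + y) ≤ s.arr 9 (B + s.arr 10 i)
  closed_one : ∀ i < h₂, ∀ y, Arc N 7 s₀ (s.arr 10 i) y → s.arr 9 (B + y) ≠ 0 ∧
    s.arr 9 (B + y) ≤ s.arr 9 (B + s.arr 10 i) + 1

variable {N B r D w : ℕ} {Good : ℕ → ℕ → Prop} {s₀ s s' s'' : State} {tail tail' h₁ h₂ : ℕ}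

/-- The work done for the first `h` nodes of the queue. -/
def work (s₀ s : State) (a h : ℕ) : ℕ := ∑ i ∈ Finset.range h, (s₀.arr a (s.arr 10 i) + 1)

/-- The entries of the queue are distinct nodes, so each adjacency list is paid for at most once. -/
theorem Queue.work_le (h : Queue N B r Good s₀ s tail) (a : ℕ) {p : ℕ} (hp : p ≤ tail) :
    work s₀ s a p ≤ ∑ x ∈ Finset.range N, s₀.arr a x + N := by
  have e : ∑ x ∈ Finset.range N, (s₀.arr a x + 1) = ∑ x ∈ Finset.range N, s₀.arr a x + N := by
    simp [Finset.sum_add_distrib]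
  have hinj : Set.InjOn (s.arr 10) (Finset.range p) := by
    intro i hi j hj hij
    simp only [Finset.coe_range, Set.mem_Iio] at hi hj
    exact h.inj i (by omega) j (by omega) hij
  rw [← e, work, ← Finset.sum_image (f := fun x => s₀.arr a x + 1) hinj]
  refine Finset.sum_le_sum_of_subset fun x hx => ?_
  obtain ⟨i, hi, rfl⟩ := Finset.mem_image.1 hx
  have := Finset.mem_range.1 hi
  exact Finset.mem_range.2 (h.lt i (by omega))

theorem work_congr {a h : ℕ} (hs : ∀ i < h, s'.arr 10 i = s.arr 10 i) :
    work s₀ s' a h = work s₀ s a h :=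
  Finset.sum_congr rfl fun i hi => by rw [hs i (Finset.mem_range.1 hi)]

/-- One step of the search. -/
def searchStep : Cmd :=
  .cond (.op .lt (.reg 23) (.reg 22))
    (.seq (.seq (.assign 25 (.cell 10 (.reg 23))) (.assign 23 (.reg 23 + 1))) (relax 5 0))
    (.seq (.seq (.assign 25 (.cell 10 (.reg 24))) (.assign 24 (.reg 24 + 1))) (relax 7 1))

/-- The digraph in memory and the word length are suitable for the search. -/
structure Searchable (w N B : ℕ) (Good : ℕ → ℕ → Prop) (s₀ : State) : Prop where
  reg_B : s₀.reg 21 = B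
  reg_N : s₀.reg 3 = N
  wide : B + N + 2 < 2 ^ w
  wide_arcs : ∀ a, a = 5 ∨ a = 7 → (∑ u ∈ Finset.range N, s₀.arr a u + 1) * N + 1 < 2 ^ w
  arc : ∀ a, a = 5 ∨ a = 7 → ∀ x y, Arc N a s₀ x y → y < N
  good_zero : ∀ x y d, Arc N 5 s₀ x y → Good x d → Good y d
  good_one : ∀ x y d, Arc N 7 s₀ x y → Good x d → Good y (d + 1)

/-- While some arcs of length 0 are pending, they are followed first, so values increase only when
all nodes of the current value have been found. The cost of the step is bounded by the growth of
`work`. -/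
theorem runs_searchStep (hS : Searchable w N B Good s₀) (h : Search N B r Good s₀ s tail h₁ h₂)
    (hlt : h₂ < tail) :
    ∃ b, Runs w searchStep s b fun s' => (∃ tail' h₁' h₂', Search N B r Good s₀ s' tail' h₁' h₂') ∧
      b + 4 ≤ 70 * ((work s₀ s' 5 (s'.reg 23) + work s₀ s' 7 (s'.reg 24)) -
        (work s₀ s 5 (s.reg 23) + work s₀ s 7 (s.reg 24))) ∧
      work s₀ s 5 (s.reg 23) + work s₀ s 7 (s.reg 24) ≤
        work s₀ s' 5 (s'.reg 23) + work s₀ s' 7 (s'.reg 24) := by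
  have Q := h.queue
  have htail := Q.tail_le
  have hw := hS.wide
  have e1 : 1 % 2 ^ w = 1 := Nat.mod_eq_of_lt (by omega)
  have hval : (Expr.op .lt (.reg 23) (.reg 22)).eval w s = if h₁ < tail then 1 else 0 := by
    simp [Expr.eval, Op.eval, h.reg_h₁, Q.reg_tail]
  by_cases hc : h₁ < tail
  · set x := s.arr 10 h₁ with hx
    have e2 : (h₁ + 1) % 2 ^ w = h₁ + 1 := Nat.mod_eq_of_lt (by have := h.le₁; omega)
    -- Test, preparation and relaxation; with 4 more for the loop test this is at most 70 times the
    -- degree plus one, the growth of `work`.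
    refine ⟨4 + (7 + 50 * (s₀.arr 5 x + 1)), Runs.mono (B := (Expr.op .lt (.reg 23) (.reg 22)).cost
      + 1 + _) (Runs.cond (fun _ => Runs.seq (B₁ := 7) (B₂ := 50 * (s₀.arr 5 x + 1))
      (Runs.of_run ⟨trivial, trivial⟩ (by decide) ?_)) fun h0 => ?_) le_rfl fun _ h => h⟩
    swap
    · rw [hval, if_pos hc] at h0; omega
    have hrun : Cmd.run w (.seq (.assign 25 (.cell 10 (.reg 23))) (.assign 23 (.reg 23 + 1))) s =
        (s.setReg 25 x).setReg 23 (h₁ + 1) := by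
      simp [Cmd.run, Expr.eval_add, Expr.eval_reg, Expr.eval_cell, Expr.eval_one, h.reg_h₁, e1, e2,
        hx]
    rw [hrun]
    set s₁ := (s.setReg 25 x).setReg 23 (h₁ + 1) with hs₁
    have Q₁ : Queue N B r Good s₀ s₁ tail := (Q.setReg _ (by omega)).setReg _ (by omega)
    refine (runs_relax (x := x) (l := 0) (t := h₁) Q₁ hS.reg_B hS.reg_N (by omega) hw
      (hS.wide_arcs 5 (Or.inl rfl)) (hS.arc 5 (Or.inl rfl)) hS.good_zero (by omega) (by simp [hs₁])
      hc rfl fun i hi => h.top i hi h₁ le_rfl hc).mono le_rfl ?_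
    rintro s' ⟨tail', Q', E, C, r23, r24⟩
    have r23' : s'.reg 23 = h₁ + 1 := by rw [r23]; simp [hs₁]
    have r24' : s'.reg 24 = h₂ := by rw [r24]; simpa [hs₁] using h.reg_h₂
    have E' : Extends N B (s.arr 9 (B + x)) s tail s' tail' := E.congr rfl rfl
    have hold : ∀ i < tail, s'.arr 9 (B + s'.arr 10 i) = s.arr 9 (B + s.arr 10 i) :=
      fun i hi => Q.extends_reached E' hi
    -- The node at the first head has the largest value in the queue by `top`, and its arcs of
    -- length 0 append nodes of this same value.
    have htop : ∀ i < tail', s'.arr 9 (B + s'.arr 10 i) ≤ s.arr 9 (B + x) := by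
      intro i hi
      by_cases hit : i < tail
      · rw [hold i hit]; exact h.top i hit h₁ le_rfl hc
      · exact (E'.new i (by omega) hi).le
    have hle := E'.le
    have hle₂ := h.le₂
    have hge : ∀ j, h₁ ≤ j → j < tail' → s.arr 9 (B + x) ≤ s'.arr 9 (B + s'.arr 10 j) := by
      intro j hj hj'
      by_cases hjt : j < tail
      · rw [hold j hjt]; exact Q.sorted h₁ j hj hjt
      · exact (E'.new j (by omega) hj').ge
    have hw7 : work s₀ s' 7 h₂ = work s₀ s 7 h₂ :=
      work_congr fun i hi => E'.queue i (by omega)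
    have hw5 : work s₀ s' 5 (h₁ + 1) = work s₀ s 5 h₁ + (s₀.arr 5 x + 1) := by
      rw [work, Finset.sum_range_succ, E'.queue h₁ hc]
      congr 1
      exact work_congr fun i hi => E'.queue i (by omega)
    refine ⟨⟨tail', h₁ + 1, h₂, Q', r23', r24', by omega, by omega, ?_, ?_, ?_, ?_⟩, ?_⟩
    · exact fun i hi j hj hj' => (htop i hi).trans (hge j (by omega) hj')
    · intro i hi j hj hj'
      by_cases hjt : j < tail
      · rw [hold j hjt]
        exact (htop i hi).trans (h.near h₁ hc j hj hjt)
      · exact ((htop i hi).trans (hge j (by omega) hj')).trans (Nat.le_succ _)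
    · intro i hi y hy
      rw [E'.queue i (by omega)] at hy ⊢
      have hxi := E'.dist _ (Q.lt i (by omega)) (Q.reached i (by omega))
      rcases Nat.lt_succ_iff_lt_or_eq.1 hi with hi | rfl
      · obtain ⟨k₁, k₂⟩ := h.closed_zero i hi y hy
        rw [E'.dist y (hS.arc 5 (Or.inl rfl) _ _ hy) k₁, hxi]
        exact ⟨k₁, k₂⟩
      · refine ⟨C y hy, ?_⟩
        obtain ⟨j, hj, hjy⟩ := Q'.surj y (hS.arc 5 (Or.inl rfl) _ _ hy) (C y hy)
        rw [← hjy, hxi]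
        exact htop j hj
    · intro i hi y hy
      rw [E'.queue i (by omega)] at hy ⊢
      obtain ⟨k₁, k₂⟩ := h.closed_one i hi y hy
      rw [E'.dist y (hS.arc 7 (Or.inr rfl) _ _ hy) k₁,
        E'.dist _ (Q.lt i (by omega)) (Q.reached i (by omega))]
      exact ⟨k₁, k₂⟩
    · rw [r23', r24', hw5, hw7, h.reg_h₁, h.reg_h₂]
      omega
  -- No arcs of length 0 are pending. All positions from `h₁` on are then filled in this step with
  -- the value of x plus one, which restores `top`.
  · have hh₁ : h₁ = tail := by have := h.le₁; omega
    set x := s.arr 10 h₂ with hx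
    have e2 : (h₂ + 1) % 2 ^ w = h₂ + 1 := Nat.mod_eq_of_lt (by have := h.le₁; omega)
    refine ⟨4 + (7 + 50 * (s₀.arr 7 x + 1)), Runs.mono (B := (Expr.op .lt (.reg 23) (.reg 22)).cost
      + 1 + _) (Runs.cond (fun h0 => ?_) fun _ => Runs.seq (B₁ := 7) (B₂ := 50 * (s₀.arr 7 x + 1))
      (Runs.of_run ⟨trivial, trivial⟩ (by decide) ?_)) le_rfl fun _ h => h⟩
    · rw [hval, if_neg hc] at h0; exact (h0 rfl).elim
    have hrun : Cmd.run w (.seq (.assign 25 (.cell 10 (.reg 24))) (.assign 24 (.reg 24 + 1))) s =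
        (s.setReg 25 x).setReg 24 (h₂ + 1) := by
      simp [Cmd.run, Expr.eval_add, Expr.eval_reg, Expr.eval_cell, Expr.eval_one, h.reg_h₂, e1, e2,
        hx]
    rw [hrun]
    set s₁ := (s.setReg 25 x).setReg 24 (h₂ + 1) with hs₁
    have Q₁ : Queue N B r Good s₀ s₁ tail := (Q.setReg _ (by omega)).setReg _ (by omega)
    refine (runs_relax (x := x) (l := 1) (t := h₂) Q₁ hS.reg_B hS.reg_N (by omega) hw
      (hS.wide_arcs 7 (Or.inr rfl)) (hS.arc 7 (Or.inr rfl)) hS.good_one (by omega) (by simp [hs₁])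
      hlt rfl fun i hi => h.near i hi h₂ le_rfl hlt).mono le_rfl ?_
    rintro s' ⟨tail', Q', E, C, r23, r24⟩
    have r23' : s'.reg 23 = h₁ := by rw [r23]; simpa [hs₁] using h.reg_h₁
    have r24' : s'.reg 24 = h₂ + 1 := by rw [r24]; simp [hs₁]
    have E' : Extends N B (s.arr 9 (B + x) + 1) s tail s' tail' := E.congr rfl rfl
    have hold : ∀ i < tail, s'.arr 9 (B + s'.arr 10 i) = s.arr 9 (B + s.arr 10 i) :=
      fun i hi => Q.extends_reached E' hi
    have htop : ∀ i < tail', s'.arr 9 (B + s'.arr 10 i) ≤ s.arr 9 (B + x) + 1 := by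
      intro i hi
      by_cases hit : i < tail
      · rw [hold i hit]; exact h.near i hit h₂ le_rfl hlt
      · exact (E'.new i (by omega) hi).le
    have hle := E'.le
    have hge : ∀ j, h₂ ≤ j → j < tail' → s.arr 9 (B + x) ≤ s'.arr 9 (B + s'.arr 10 j) := by
      intro j hj hj'
      by_cases hjt : j < tail
      · rw [hold j hjt]; exact Q.sorted h₂ j hj hjt
      · rw [E'.new j (by omega) hj']; exact Nat.le_succ _
    have hw5 : work s₀ s' 5 h₁ = work s₀ s 5 h₁ :=
      work_congr fun i hi => E'.queue i (by omega)
    have hw7 : work s₀ s' 7 (h₂ + 1) = work s₀ s 7 h₂ + (s₀.arr 7 x + 1) := by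
      rw [work, Finset.sum_range_succ, E'.queue h₂ hlt]
      congr 1
      exact work_congr fun i hi => E'.queue i (by omega)
    refine ⟨⟨tail', h₁, h₂ + 1, Q', r23', r24', by omega, by omega, ?_, ?_, ?_, ?_⟩, ?_⟩
    · intro i hi j hj hj'
      rw [E'.new j (by omega) hj']
      exact htop i hi
    · exact fun i hi j hj hj' => (htop i hi).trans (Nat.succ_le_succ (hge j (by omega) hj'))
    · intro i hi y hy
      rw [E'.queue i (by omega)] at hy ⊢
      obtain ⟨k₁, k₂⟩ := h.closed_zero i hi y hy
      rw [E'.dist y (hS.arc 5 (Or.inl rfl) _ _ hy) k₁,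
        E'.dist _ (Q.lt i (by omega)) (Q.reached i (by omega))]
      exact ⟨k₁, k₂⟩
    · intro i hi y hy
      rw [E'.queue i (by omega)] at hy ⊢
      have hxi := E'.dist _ (Q.lt i (by omega)) (Q.reached i (by omega))
      rcases Nat.lt_succ_iff_lt_or_eq.1 hi with hi | rfl
      · obtain ⟨k₁, k₂⟩ := h.closed_one i hi y hy
        rw [E'.dist y (hS.arc 7 (Or.inr rfl) _ _ hy) k₁, hxi]
        exact ⟨k₁, k₂⟩
      · refine ⟨C y hy, ?_⟩
        obtain ⟨j, hj, hjy⟩ := Q'.surj y (hS.arc 7 (Or.inr rfl) _ _ hy) (C y hy)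
        rw [← hjy, hxi]
        exact htop j hj
    · rw [r23', r24', hw5, hw7, h.reg_h₁, h.reg_h₂]
      omega

/-- The search, after the first node has been put into the queue. -/
def searchLoop : Cmd := .loop (.op .lt (.reg 24) (.reg 22)) searchStep

/-- The result of the search from the node `r`. -/
structure Searched (N B r : ℕ) (Good : ℕ → ℕ → Prop) (s₀ s : State) : Prop where
  reg : ∀ x ≤ 21, s.reg x = s₀.reg x
  arr : ∀ a, a ≠ 9 → a ≠ 10 → s.arr a = s₀.arr a
  out : ∀ p, p < B ∨ B + N ≤ p → s.arr 9 p = s₀.arr 9 p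
  root : s.arr 9 (B + r) = 1
  good : ∀ x < N, s.arr 9 (B + x) ≠ 0 → Good x (s.arr 9 (B + x))
  closed_zero : ∀ x y, Arc N 5 s₀ x y → s.arr 9 (B + x) ≠ 0 →
    s.arr 9 (B + y) ≠ 0 ∧ s.arr 9 (B + y) ≤ s.arr 9 (B + x)
  closed_one : ∀ x y, Arc N 7 s₀ x y → s.arr 9 (B + x) ≠ 0 →
    s.arr 9 (B + y) ≠ 0 ∧ s.arr 9 (B + y) ≤ s.arr 9 (B + x) + 1

theorem runs_searchLoop (hS : Searchable w N B Good s₀) (h : Search N B r Good s₀ s 1 0 0) :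
    Runs w searchLoop s (70 * (∑ x ∈ Finset.range N, s₀.arr 5 x +
      ∑ x ∈ Finset.range N, s₀.arr 7 x + 2 * N) + 4) (Searched N B r Good s₀) := by
  set M := ∑ x ∈ Finset.range N, s₀.arr 5 x + ∑ x ∈ Finset.range N, s₀.arr 7 x + 2 * N with hM
  have hwork : ∀ {s tail h₁ h₂}, Search N B r Good s₀ s tail h₁ h₂ →
      work s₀ s 5 (s.reg 23) + work s₀ s 7 (s.reg 24) ≤ M := by
    intro s tail h₁ h₂ h
    have hle₁ := h.le₁
    have hle₂ := h.le₂
    have k₁ := h.queue.work_le 5 (p := s.reg 23) (by rw [h.reg_h₁]; omega)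
    have k₂ := h.queue.work_le 7 (p := s.reg 24) (by rw [h.reg_h₂]; omega)
    omega
  -- The potential is the work not yet done; `M` bounds the total work, with degree plus one for
  -- each node in both lists.
  refine (Runs.loop (e := .op .lt (.reg 24) (.reg 22))
    (fun s => ∃ tail h₁ h₂, Search N B r Good s₀ s tail h₁ h₂)
    (fun s => 70 * (M - (work s₀ s 5 (s.reg 23) + work s₀ s 7 (s.reg 24)))) ?_
    ⟨1, 0, 0, h⟩).mono ?_ ?_
  · rintro s ⟨tail, h₁, h₂, h⟩ hc
    have hlt : h₂ < tail := by
      by_contra hn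
      simp [Expr.eval, Op.eval, h.reg_h₂, h.queue.reg_tail, hn] at hc
    obtain ⟨b, hb⟩ := runs_searchStep hS h hlt
    refine ⟨b, hb.mono le_rfl ?_⟩
    rintro s' ⟨⟨tail', h₁', h₂', h'⟩, hcost, hle⟩
    refine ⟨⟨_, _, _, h'⟩, ?_⟩
    have := hwork h'
    simp only [Expr.cost]
    omega
  · simp only [Expr.cost]
    omega
  · rintro s ⟨⟨tail, h₁, h₂, h⟩, hc⟩
    have hge : tail ≤ h₂ := by
      by_contra hn
      simp [Expr.eval, Op.eval, h.reg_h₂, h.queue.reg_tail, show h₂ < tail by omega] at hc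
    have hle₁ := h.le₁
    have hle₂ := h.le₂
    have Q := h.queue
    refine ⟨Q.reg, Q.arr, Q.out, Q.root, Q.good, ?_, ?_⟩
    · intro x y hxy hx
      obtain ⟨i, hi, rfl⟩ := Q.surj x hxy.1 hx
      exact h.closed_zero i (by omega) y hxy
    · intro x y hxy hx
      obtain ⟨i, hi, rfl⟩ := Q.surj x hxy.1 hx
      exact h.closed_one i (by omega) y hxy

end WordRAM

/-! ### From the search to the distances of G -/

namespace WordRAM

variable {n k w : ℕ} {G : SimpleGraph (Fin n)} {s s' : State} {L : ℕ → Set (Fin n)}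

theorem Sem.mono {z : ℕ} {P Q : Fin n → Prop} (h : ∀ v, P v → Q v) (hP : Sem L z P) :
    Sem L z Q := by
  unfold Sem at hP ⊢
  split_ifs at hP ⊢
  · exact hP.imp fun v hv => ⟨hv.1, h v hv.2⟩
  · exact fun v hv => h v (hP v hv)

/-- The memory holds a hub digraph in which the lengths of shortest paths are the distances
of `G`. -/
structure Ready (k : ℕ) (G : SimpleGraph (Fin n)) (L : ℕ → Set (Fin n)) (s : State) : Prop where
  setup : Setup k G s
  arc_lt : ∀ a, a = 5 ∨ a = 7 → ∀ x y, Arc (4 * n) a s x y → y < 4 * n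
  arcs : ∑ x ∈ Finset.range (4 * n), s.arr 5 x + ∑ x ∈ Finset.range (4 * n), s.arr 7 x
    ≤ 5 * n + 4 * (k * n)
  sound_zero : ∀ x y, Arc (4 * n) 5 s x y → ∀ P, Sem L x P → Sem L y P
  sound_one : ∀ x y, Arc (4 * n) 7 s x y →
    ∀ P, Sem L x P → Sem L y fun v => ∃ u, P u ∧ G.Adj u v
  leaf : ∀ v : Fin n, L (2 * v + 2) = {v}
  covered : ∀ u v, G.Adj u v → Covered s u v

/-- The final row still has a nonempty cell, so m ≤ n − 1 and all arcs stay below 4n. -/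
theorem Building.ready {t : CWExpr (Fin n) k} (h : Building G s [t]) (ht : t.verts = Set.univ) :
    ∃ L, Ready k G L s := by
  obtain ⟨F, L, m, ψ, H, -, hr, -⟩ := h.hubs
  have h1 := H.next
  have h2 := H.count
  have h3 := H.le_verts
  have h4 := H.le_pairs
  have h5 : 0 < {p | (F p).Nonempty}.ncard := by
    obtain ⟨v, hv⟩ := t.verts_nonempty
    obtain ⟨l, hl⟩ := CWExpr.mem_verts_iff.1 hv
    refine (Set.ncard_pos H.finite).2 ⟨([] : List (CWExpr (Fin n) k)).length * k + l, v, ?_⟩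
    rw [hr.1 l]; exact hl
  refine ⟨L, h.setup, fun a ha x y hxy => ?_, ?_, H.sound_zero, H.sound_one, H.leaf,
    fun u v => h.covered t (by simp) u (ht ▸ trivial) v (ht ▸ trivial)⟩
  · have := H.lt a ha x y hxy
    omega
  · have := H.arcs
    rw [mul_assoc] at h4
    omega

theorem Ready.congr (h : Ready k G L s) (hreg : ∀ x < 4, s'.reg x = s.reg x)
    (harr : ∀ a, a = 0 ∨ 5 ≤ a → a ≤ 8 → s'.arr a = s.arr a) : Ready k G L s' := by
  have hm : ArcMono n s' s := ArcMono.of_arr fun a h₁ h₂ => (harr a (by omega) h₂).symm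
  have hm' : ArcMono n s s' := ArcMono.of_arr fun a h₁ h₂ => harr a (by omega) h₂
  refine ⟨⟨(hreg 0 (by omega)).trans h.setup.1, (hreg 1 (by omega)).trans h.setup.2,
    (hreg 3 (by omega)).trans h.setup.3, ?_⟩, fun a ha x y hxy => h.arc_lt a ha x y (hm a ha x y hxy),
    ?_, fun x y hxy => h.sound_zero x y (hm 5 (Or.inl rfl) x y hxy),
    fun x y hxy => h.sound_one x y (hm 7 (Or.inr rfl) x y hxy), h.leaf,
    fun u v huv => (h.covered u v huv).mono hm'⟩
  · rw [harr 0 (by omega) (by omega)]; exact h.setup.4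
  · rw [harr 5 (by omega) (by omega), harr 7 (by omega) (by omega)]; exact h.arcs

/-- The value of a node reached by the search from `u`: the end of a walk of this length. -/
def Walks (G : SimpleGraph (Fin n)) (L : ℕ → Set (Fin n)) (u : Fin n) (z d : ℕ) : Prop :=
  1 ≤ d ∧ Sem L z fun v => ∃ p : G.Walk u v, p.length = d - 1

/-- An arc of length 0 keeps the predicate "end of a walk of this length", and an arc of length 1
extends the walk by the edge provided by `sound_one`. -/
theorem Ready.searchable (h : Ready k G L s) (hw : Wide n k w) (u : Fin n) {B : ℕ}
    (h21 : s.reg 21 = B) (hB : B ≤ n * (4 * n)) :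
    Searchable w (4 * n) B (Walks G L u) s := by
  obtain ⟨hn, hk, hw⟩ := hw
  have h1 : n ≤ k * n := Nat.le_mul_of_pos_left _ hk
  have h2 : k * n ≤ k * n * n := Nat.le_mul_of_pos_right _ hn
  have h3 : n * n ≤ k * n * n := Nat.mul_le_mul_right _ h1
  have h4 : n * (4 * n) = 4 * (n * n) := by ring
  refine ⟨h21, h.setup.reg_three, by omega, fun a ha => ?_, h.arc_lt, ?_, ?_⟩
  · have := h.arcs
    have : (∑ x ∈ Finset.range (4 * n), s.arr a x + 1) * (4 * n) ≤ (10 * (k * n)) * (4 * n) :=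
      Nat.mul_le_mul_right _ (by rcases ha with rfl | rfl <;> omega)
    have e : (10 * (k * n)) * (4 * n) = 40 * (k * n * n) := by ring
    omega
  · rintro x y d hxy ⟨hd, hx⟩
    exact ⟨hd, h.sound_zero x y hxy _ hx⟩
  · rintro x y d hxy ⟨hd, hx⟩
    refine ⟨by omega, (h.sound_one x y hxy _ hx).mono ?_⟩
    rintro v ⟨u', ⟨p, hp⟩, huv⟩
    exact ⟨p.concat huv, by rw [SimpleGraph.Walk.length_concat, hp]; omega⟩

theorem Searched.reach {r B : ℕ} {Good : ℕ → ℕ → Prop} (h : Searched (4 * n) B r Good s s')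
    {x y : ℕ} (hxy : Reach n s x y) (hx : s'.arr 9 (B + x) ≠ 0) :
    s'.arr 9 (B + y) ≠ 0 ∧ s'.arr 9 (B + y) ≤ s'.arr 9 (B + x) := by
  induction hxy with
  | refl => exact ⟨hx, le_rfl⟩
  | tail _ hyz ih =>
    obtain ⟨k₁, k₂⟩ := h.closed_zero _ _ hyz ih.1
    exact ⟨k₁, k₂.trans ih.2⟩

/-- Each edge of the walk is replaced by its path up, across and down, along which the value grows
by at most one. -/
theorem Searched.walk {B : ℕ} {Good : ℕ → ℕ → Prop} (hr : Ready k G L s) {u v a : Fin n}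
    (h : Searched (4 * n) B (2 * u + 3) Good s s') (p : G.Walk a v) {d : ℕ}
    (ha : s'.arr 9 (B + (2 * a + 3)) ≠ 0) (had : s'.arr 9 (B + (2 * a + 3)) ≤ d) :
    s'.arr 9 (B + (2 * v + 3)) ≠ 0 ∧ s'.arr 9 (B + (2 * v + 3)) ≤ d + p.length := by
  induction p generalizing d with
  | nil => exact ⟨ha, had⟩
  | cons hab p ih =>
    obtain ⟨x, y, h₁, h₂, h₃⟩ := hr.covered _ _ hab
    obtain ⟨k₁, l₁⟩ := h.reach h₁ ha
    obtain ⟨k₂, l₂⟩ := h.closed_one _ _ h₂ k₁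
    obtain ⟨k₃, l₃⟩ := h.reach h₃ k₂
    obtain ⟨k₄, l₄⟩ := ih (d := d + 1) k₃ (by omega)
    exact ⟨k₄, by rw [SimpleGraph.Walk.length_cons]; omega⟩

/-- A nonzero value yields a walk of that length minus one, so it is not too small; a shortest walk
bounds it from above. Values are shifted by one so that zero can mean unreached. -/
theorem Searched.dist_eq {B : ℕ} (hr : Ready k G L s) {u : Fin n}
    (h : Searched (4 * n) B (2 * u + 3) (Walks G L u) s s') (v : Fin n) :
    (G.edist u v = ⊤ → s'.arr 9 (B + (2 * v + 3)) = 0) ∧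
    (G.edist u v ≠ ⊤ → s'.arr 9 (B + (2 * v + 3)) = (G.edist u v).toNat + 1) := by
  have hv := v.isLt
  have hwalk : s'.arr 9 (B + (2 * v + 3)) ≠ 0 →
      ∃ p : G.Walk u v, p.length = s'.arr 9 (B + (2 * v + 3)) - 1 := by
    intro h0
    obtain ⟨-, hsem⟩ := h.good (2 * v + 3) (by omega) h0
    have h1 : (2 * v.val + 3) % 2 ≠ 0 := by omega
    have h2 : 2 * v.val + 3 - 1 = 2 * v.val + 2 := by omega
    simp only [Sem, h1, h2, if_false, hr.leaf] at hsem
    exact hsem v rfl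
  constructor
  · intro htop
    by_contra h0
    obtain ⟨p, -⟩ := hwalk h0
    have := SimpleGraph.edist_le p
    rw [htop] at this
    exact absurd this (by simp)
  · intro htop
    obtain ⟨p, hp⟩ := SimpleGraph.exists_walk_of_edist_ne_top htop
    obtain ⟨k₁, k₂⟩ := h.walk hr p (d := 1) (by rw [h.root]; omega) h.root.le
    obtain ⟨q, hq⟩ := hwalk k₁
    have hle := SimpleGraph.edist_le q
    rw [← hp] at hle ⊢
    have := Nat.cast_le.1 hle
    simp only [ENat.toNat_natCast]
    omega

/-- Search from the vertex in register `20` and write down the distances. -/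
def searchInit : Cmd :=
  .seq (.assign 21 (.reg 20 * .reg 3)) (.seq (.assign 25 (2 * .reg 20 + 3))
    (.seq (.write 9 (.reg 21 + .reg 25) 1) (.seq (.write 10 0 (.reg 25))
      (.seq (.assign 22 1) (.seq (.assign 23 0) (.assign 24 0))))))

/-- Write the distance from the vertex in register `20` to the vertex in register `30`. -/
def writeDist : Cmd :=
  .seq (.assign 26 (.cell 9 (.reg 21 + (2 * .reg 30 + 3))))
    (.cond (.reg 26) (.write 2 (.reg 20 * .reg 0 + .reg 30) (.reg 26 - 1))
      (.write 2 (.reg 20 * .reg 0 + .reg 30) (.reg 0)))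

/-- Compute the distances from the vertex in register `20`. -/
def searchFrom : Cmd := .seq searchInit (.seq searchLoop (forCmd 30 0 writeDist))

/-- The cell for the distance from `u` to `v` in the output is correct. -/
def Correct (G : SimpleGraph (Fin n)) (s : State) (u v : Fin n) : Prop :=
  (G.edist u v = ⊤ → s.arr 2 (u * n + v) = n) ∧
  (G.edist u v ≠ ⊤ → s.arr 2 (u * n + v) = (G.edist u v).toNat)

theorem cell_inj {u v u' v' : Fin n} (h : u.val * n + v = u' * n + v') : u = u' ∧ v = v' := by
  have hn : 0 < n := v.pos
  have h1 := congrArg (· / n) h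
  simp only [Nat.add_comm (_ * n), Nat.add_mul_div_right _ _ hn, Nat.div_eq_of_lt v.isLt,
    Nat.div_eq_of_lt v'.isLt, zero_add] at h1
  rw [h1] at h
  exact ⟨Fin.ext h1, Fin.ext (by omega)⟩

/-- Each source has its own block of 4n cells in array 9. The blocks of later sources are still
zero, so nothing has to be cleared between searches. -/
theorem runs_searchFrom (hr : Ready k G L s) (hw : Wide n k w) {u : Fin n} (h20 : s.reg 20 = u)
    (h0 : ∀ p, u * (4 * n) ≤ p → s.arr 9 p = 0) :
    Runs w searchFrom s (1400 * (k * n)) fun s' => Ready k G L s' ∧ s'.reg 20 = u ∧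
      (∀ p, (u + 1) * (4 * n) ≤ p → s'.arr 9 p = 0) ∧ (∀ v, Correct G s' u v) ∧
      ∀ u' v, u' ≠ u → Correct G s u' v → Correct G s' u' v := by
  have hu := u.isLt
  have hBn : u.val * (4 * n) ≤ n * (4 * n) := Nat.mul_le_mul_right _ hu.le
  set B := u.val * (4 * n) with hB
  have hnk : n ≤ k * n := Nat.le_mul_of_pos_left _ hw.2.1
  have hpos : 1 ≤ n := hw.1
  have hword : n * (4 * n) + 40 * n + 40 ≤ 2 ^ w := by
    obtain ⟨-, hk, hw⟩ := hw
    have h2 : k * n ≤ k * n * n := Nat.le_mul_of_pos_right _ hpos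
    have h3 : n * n ≤ k * n * n := Nat.mul_le_mul_right _ hnk
    have h4 : n * (4 * n) = 4 * (n * n) := by ring
    omega
  have hun : u.val * n ≤ n * n := Nat.mul_le_mul_right _ hu.le
  have hnn : n * (4 * n) = 4 * (n * n) := by ring
  have e1 : 1 % 2 ^ w = 1 := Nat.mod_eq_of_lt (by omega)
  have e2 : 2 % 2 ^ w = 2 := Nat.mod_eq_of_lt (by omega)
  have e3 : 3 % 2 ^ w = 3 := Nat.mod_eq_of_lt (by omega)
  have e4 : B % 2 ^ w = B := Nat.mod_eq_of_lt (by omega)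
  have e5 : ∀ v < n, 2 * v % 2 ^ w = 2 * v := fun v hv => Nat.mod_eq_of_lt (by omega)
  have e6 : ∀ v < n, (2 * v + 3) % 2 ^ w = 2 * v + 3 := fun v hv => Nat.mod_eq_of_lt (by omega)
  have e7 : ∀ v < n, (B + (2 * v + 3)) % 2 ^ w = B + (2 * v + 3) := fun v hv =>
    Nat.mod_eq_of_lt (by omega)
  have e8 : u.val * n % 2 ^ w = u * n := Nat.mod_eq_of_lt (by omega)
  have e9 : ∀ v < n, (u.val * n + v) % 2 ^ w = u * n + v := fun v hv => Nat.mod_eq_of_lt (by omega)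
  have harcs := hr.arcs
  refine Runs.mono (B := 40 + ((70 * (∑ x ∈ Finset.range (4 * n), s.arr 5 x +
      ∑ x ∈ Finset.range (4 * n), s.arr 7 x + 2 * (4 * n)) + 4) +
      (∑ j ∈ Finset.range n, (30 + 8) + 6))) (Runs.seq (Runs.of_run (by simp [searchInit,
      Cmd.LoopFree]) (by decide) ?_)) ?_ fun _ h => h
  swap
  · simp only [Finset.sum_const, Finset.card_range, smul_eq_mul]; omega
  set s₁ := searchInit.run w s with hs₁
  have hs₁' : s₁ = ((((((s.setReg 21 B).setReg 25 (2 * u + 3)).setArr 9 (B + (2 * u + 3)) 1).setArr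
      10 0 (2 * u + 3)).setReg 22 1).setReg 23 0).setReg 24 0 := by
    simp [hs₁, searchInit, Cmd.run, Expr.eval_add, Expr.eval_mul, Expr.eval_reg, Expr.eval_zero,
      Expr.eval_one, Expr.eval_two, Expr.eval_three, h20, hr.setup.reg_three, e1, e2, e3, e4, ← hB,
      e5 u hu, e6 u hu, e7 u hu]
  have hreg₁ : ∀ x < 21, s₁.reg x = s.reg x := fun x hx => by
    simp [hs₁', show x ≠ 21 by omega, show x ≠ 25 by omega, show x ≠ 22 by omega,
      show x ≠ 23 by omega, show x ≠ 24 by omega]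
  have harr₁ : ∀ a, a ≠ 9 → a ≠ 10 → s₁.arr a = s.arr a := fun a h₁ h₂ => by
    simp [hs₁', h₁, h₂]
  have a9 : s₁.arr 9 = Function.update (s.arr 9) (B + (2 * u + 3)) 1 := by simp [hs₁']
  have a10 : s₁.arr 10 0 = 2 * u + 3 := by simp [hs₁']
  have hr₁ : Ready k G L s₁ := hr.congr (fun x hx => hreg₁ x (by omega))
    fun a _ _ => harr₁ a (by omega) (by omega)
  have d_iff : ∀ x, s₁.arr 9 (B + x) ≠ 0 ↔ x = 2 * u + 3 := by
    intro x
    by_cases hx : x = 2 * u + 3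
    · simp [a9, hx]
    · rw [a9, Function.update_of_ne (by omega), h0 _ (by omega)]; simp [hx]
  have d_root : s₁.arr 9 (B + (2 * u + 3)) = 1 := by rw [a9, Function.update_self]
  -- The value 1 stands for the trivial walk of length 0.
  have hgood : Walks G L u (2 * u + 3) 1 := by
    refine ⟨le_rfl, ?_⟩
    have h1 : (2 * u.val + 3) % 2 ≠ 0 := by omega
    have h2 : 2 * u.val + 3 - 1 = 2 * u.val + 2 := by omega
    simp only [Sem, h1, h2, if_false, hr.leaf]
    rintro v rfl
    exact ⟨.nil, rfl⟩
  have hQ : Queue (4 * n) B (2 * u + 3) (Walks G L u) s₁ s₁ 1 := by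
    refine ⟨by simp [hs₁'], fun _ _ => rfl, fun _ _ _ => rfl, fun _ _ => rfl, d_root, ?_, ?_, ?_,
      ?_, ?_, ?_, ?_⟩
    · intro i hi
      obtain rfl : i = 0 := by omega
      rw [a10]; omega
    · intro i hi
      obtain rfl : i = 0 := by omega
      rw [a10, d_root]; omega
    · intro i hi j hj _
      omega
    · intro x _ hx
      exact ⟨0, by omega, by rw [a10, (d_iff x).1 hx]⟩
    · intro x _ hx
      rw [(d_iff x).1 hx, d_root]; exact hgood
    · intro i j hij hj
      obtain rfl : i = j := by omega
      exact le_rfl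
    · intro i hi
      obtain rfl : i = 0 := by omega
      rw [a10, d_root]
  have hsearch : Search (4 * n) B (2 * u + 3) (Walks G L u) s₁ s₁ 1 0 0 := by
    refine ⟨hQ, by simp [hs₁'], by simp [hs₁'], by omega, le_rfl, ?_, ?_, fun i hi => by omega,
      fun i hi => by omega⟩
    · intro i hi j _ hj
      obtain rfl : i = j := by omega
      exact le_rfl
    · intro i hi j _ hj
      obtain rfl : i = j := by omega
      exact Nat.le_succ _
  have hloop := runs_searchLoop (hr₁.searchable hw u (by simp [hs₁']) hBn) hsearch
  rw [harr₁ 5 (by omega) (by omega), harr₁ 7 (by omega) (by omega)] at hloop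
  refine Runs.seq (hloop.mono le_rfl ?_)
  intro s₂ S₂
  have hreg₂ : ∀ x < 21, s₂.reg x = s.reg x := fun x hx => by
    rw [S₂.reg x (by omega), hreg₁ x hx]
  have r21 : s₂.reg 21 = B := by rw [S₂.reg 21 le_rfl]; simp [hs₁']
  have harr₂ : ∀ a, a ≠ 9 → a ≠ 10 → s₂.arr a = s.arr a := fun a h₁ h₂ => by
    rw [S₂.arr a h₁ h₂, harr₁ a h₁ h₂]
  refine (Runs.for (N := n) (fun j s' => (∀ x < 22, s'.reg x = s₂.reg x) ∧
    (∀ a, a ≠ 2 → s'.arr a = s₂.arr a) ∧ (∀ v : Fin n, v.val < j → Correct G s' u v) ∧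
    ∀ u' v, u' ≠ u → Correct G s u' v → Correct G s' u' v) (fun _ => 30) (by omega) (by omega)
    (by rw [hreg₂ 0 (by omega), hr.setup.reg_zero]) ?_ ?_).mono le_rfl ?_
  · refine ⟨fun x hx => by simp [show x ≠ 30 by omega], fun _ _ => rfl, fun v hv => by omega, ?_⟩
    intro u' v _ h
    unfold Correct at h ⊢
    rwa [State.arr_setReg, harr₂ 2 (by omega) (by omega)]
  · rintro j hj s₃ h30 h0' ⟨hreg, harr, hcor, hold⟩
    set v : Fin n := ⟨j, hj⟩ with hv
    have hd := S₂.dist_eq hr₁ v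
    set e := s₂.arr 9 (B + (2 * j + 3)) with he
    have r20 : s₃.reg 20 = u := by rw [hreg 20 (by omega), hreg₂ 20 (by omega), h20]
    have r21' : s₃.reg 21 = B := by rw [hreg 21 (by omega), r21]
    have hrun : writeDist.run w s₃ =
        (s₃.setReg 26 e).setArr 2 (u * n + j) (if e = 0 then n else e - 1) := by
      have h9 := harr 9 (by omega)
      by_cases hc : e = 0
      · simp [writeDist, Cmd.run, Expr.eval_add, Expr.eval_mul, Expr.eval_reg, Expr.eval_cell,
          Expr.eval_two, Expr.eval_three, h30, h0', r20, r21', e2, e3, e5 j hj, e6 j hj, e7 j hj,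
          e8, e9 j hj, h9, ← he, hc]
      · simp [writeDist, Cmd.run, Expr.eval_add, Expr.eval_mul, Expr.eval_reg, Expr.eval_cell,
          Expr.eval_two, Expr.eval_three, Expr.eval_sub, Expr.eval_one, h30, h0', r20, r21', e1, e2,
          e3, e5 j hj, e6 j hj, e7 j hj, e8, e9 j hj, h9, ← he, hc]
    refine Runs.of_run (by simp [writeDist, Cmd.LoopFree]) (by decide) ?_
    rw [hrun]
    set z := if e = 0 then n else e - 1 with hz
    have hout : ∀ u' v' : Fin n, (((s₃.setReg 26 e).setArr 2 (u * n + j) z).setReg 30 (j + 1)).arr 2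
        (u' * n + v') = if u' = u ∧ v' = v then z else s₃.arr 2 (u' * n + v') := by
      intro u' v'
      by_cases h : u' = u ∧ v' = v
      · obtain ⟨rfl, rfl⟩ := h
        simp [hv]
      · rw [if_neg h, State.arr_setReg, State.arr_setArr, if_pos rfl, Function.update_of_ne,
          State.arr_setReg]
        intro h'
        exact h (cell_inj (v := v') (v' := v) h')
    refine ⟨by simp [h30], by simp [h0'], fun x hx => ?_, fun a ha => ?_, fun v' hv' => ?_, ?_⟩
    · simp [show x ≠ 30 by omega, show x ≠ 26 by omega, hreg x hx]
    · simp [ha, harr a ha]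
    · unfold Correct
      rw [hout u v']
      by_cases hvv : v' = v
      · subst hvv
        rw [if_pos ⟨rfl, rfl⟩]
        refine ⟨fun ht => ?_, fun ht => ?_⟩
        · rw [hz, if_pos (hd.1 ht)]
        · have := hd.2 ht
          have he' : e = (G.edist u v).toNat + 1 := this
          rw [hz, if_neg (by omega), he', Nat.add_sub_cancel]
      · rw [if_neg fun h => hvv h.2]
        refine hcor v' ?_
        have : v'.val ≠ j := fun h => hvv (Fin.ext h)
        omega
    · intro u' v' hu' h
      unfold Correct
      rw [hout u' v', if_neg fun h => hu' h.1]
      exact hold u' v' hu' h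
  · rintro s' ⟨-, hreg, harr, hcor, hold⟩
    refine ⟨hr.congr (fun x hx => by rw [hreg x (by omega), hreg₂ x (by omega)])
      (fun a h₁ h₂ => by rw [harr a (by omega), harr₂ a (by omega) (by omega)]), ?_, ?_,
      fun v => hcor v v.isLt, hold⟩
    · rw [hreg 20 (by omega), hreg₂ 20 (by omega), h20]
    · intro p hp
      rw [add_mul, one_mul, ← hB] at hp
      rw [harr 9 (by omega), S₂.out p (by omega), a9, Function.update_of_ne (by omega),
        h0 p (by omega)]

end WordRAM

/-! ### The whole program -/

namespace WordRAM

variable {n k w : ℕ} {G : SimpleGraph (Fin n)}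

/-- All-pairs shortest paths: build the hub digraph and search from every vertex. -/
def apsp : Cmd :=
  .seq (.seq (.assign 3 (4 * .reg 0)) (.assign 5 (2 * .reg 0 + 2)))
    (.seq build (forCmd 20 0 searchFrom))

theorem building_nil {s : State} (hS : Setup k G s) (h4 : s.reg 4 = 0) (h5 : s.reg 5 = 2 * (n + 1))
    (harr : ∀ a, 3 ≤ a → ∀ p, s.arr a p = 0) :
    Building G s ([] : List (CWExpr (Fin n) k)) := by
  have hno : ∀ a, 3 ≤ a → ∀ x y, ¬ Arc (4 * n) a s x y := by
    rintro a ha x y ⟨-, j, hj, -⟩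
    rw [harr a ha] at hj
    exact absurd hj (Nat.not_lt_zero j)
  -- The singletons have their class numbers 2v + 2 reserved from the start, before the vertices are
  -- created, so hubs begin at 2(n + 1). The number 0 remains free to mark an empty cell.
  refine ⟨hS, by simpa using h4, ⟨fun _ => ∅, fun x => {v | x = 2 * v + 2}, 0, 0, ?_,
    Nat.zero_le _, trivial, fun _ _ => rfl⟩, by simp⟩
  refine ⟨h5, by simp, by simp, Nat.zero_le _, Nat.zero_le _, ?_, ?_, ?_, ?_, ?_, ?_⟩
  · simp [harr 5, harr 7]
  · rintro a (rfl | rfl) x y h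
    · exact (hno 5 (by omega) x y h).elim
    · exact (hno 7 (by omega) x y h).elim
  · exact fun x y h => (hno 5 (by omega) x y h).elim
  · exact fun x y h => (hno 7 (by omega) x y h).elim
  · intro v
    ext u
    simp [Fin.ext_iff, eq_comm]
  · exact fun p => Or.inl ⟨harr 3 le_rfl p, rfl⟩

theorem runs_apsp {s : State} {t : CWExpr (Fin n) k} (hw : Wide n k w)
    (hL : 3 * t.size + 3 < 2 ^ w) (hG : t.Generates G) (h0 : s.reg 0 = n) (h1 : s.reg 1 = k)
    (h2 : s.reg 2 = t.size) (hreg : ∀ x, 3 ≤ x → s.reg x = 0)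
    (hadj : ∀ u v : Fin n, s.arr 0 (u * n + v) ≠ 0 ↔ G.Adj u v)
    (hcode : ∀ j < 3 * t.size, s.arr 1 j = t.code.getD j 0) (harr : ∀ a, 3 ≤ a → ∀ p, s.arr a p = 0) :
    Runs w apsp s (300 * t.size + 2000 * (k * n * n)) fun s' => ∀ u v, Correct G s' u v := by
  have hn := hw.1
  have hk := hw.2.1
  have hnk : n ≤ k * n := Nat.le_mul_of_pos_left _ hk
  have hnn : k * n ≤ k * n * n := Nat.le_mul_of_pos_right _ hn
  have hw' := hw.2.2
  have e2 : 2 % 2 ^ w = 2 := Nat.mod_eq_of_lt (by omega)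
  have e4 : 4 % 2 ^ w = 4 := Nat.mod_eq_of_lt (by omega)
  have e5 : 4 * n % 2 ^ w = 4 * n := Nat.mod_eq_of_lt (by omega)
  have e6 : 2 * n % 2 ^ w = 2 * n := Nat.mod_eq_of_lt (by omega)
  have e7 : (2 * n + 2) % 2 ^ w = 2 * n + 2 := Nat.mod_eq_of_lt (by omega)
  refine Runs.mono (B := 10 + (300 * t.size + 400 * (k * n) * n + 4 +
    (∑ j ∈ Finset.range n, (1400 * (k * n) + 8) + 6))) (Runs.seq (Runs.of_run ⟨trivial, trivial⟩
    (by decide) ?_)) ?_ fun _ h => h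
  swap
  · have e₁ : 400 * (k * n) * n = 400 * (k * n * n) := by ring
    have e₂ : n * (1400 * (k * n) + 8) = 1400 * (k * n * n) + 8 * n := by ring
    simp only [Finset.sum_const, Finset.card_range, smul_eq_mul]
    omega
  have hrun : Cmd.run w (.seq (.assign 3 (4 * .reg 0)) (.assign 5 (2 * .reg 0 + 2))) s =
      (s.setReg 3 (4 * n)).setReg 5 (2 * n + 2) := by
    simp [Cmd.run, Expr.eval_add, Expr.eval_mul, Expr.eval_reg, Expr.eval_two, Expr.eval_four, h0,
      e2, e4, e5, e6, e7]
  rw [hrun]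
  set s₁ := (s.setReg 3 (4 * n)).setReg 5 (2 * n + 2) with hs₁
  have r2 : s₁.reg 2 = t.size := by simp [hs₁, h2]
  have hB : Building G s₁ ([] : List (CWExpr (Fin n) k)) := by
    refine building_nil ⟨by simp [hs₁, h0], by simp [hs₁, h1], by simp [hs₁], hadj⟩ ?_ ?_ harr
    · simp [hs₁, hreg 4]
    · simp [hs₁]; ring
  refine Runs.seq ((runs_build t hw (by rw [r2]; exact hL) hG r2 hcode
    (by simp [hs₁, hreg 6]) hB).mono le_rfl ?_)
  rintro s₂ ⟨hB₂, h9⟩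
  obtain ⟨L, hr⟩ := hB₂.ready hG.2.1
  refine (Runs.for (N := n) (fun j s' => Ready k G L s' ∧
    (∀ p, j * (4 * n) ≤ p → s'.arr 9 p = 0) ∧ ∀ u v : Fin n, u.val < j → Correct G s' u v) _
    (by omega) (by omega) hr.setup.reg_zero ?_ ?_).mono le_rfl ?_
  · refine ⟨hr.congr (fun x hx => by simp [show x ≠ 20 by omega]) fun _ _ _ => rfl,
      fun p _ => ?_, fun u v hu => by omega⟩
    rw [State.arr_setReg, h9]
    exact harr 9 (by omega) p
  · rintro j hj s₃ h20 - ⟨hr₃, hz, hc⟩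
    refine (runs_searchFrom hr₃ hw (u := ⟨j, hj⟩) h20 hz).mono le_rfl ?_
    rintro s₄ ⟨k₁, k₂, k₃, k₄, k₅⟩
    refine ⟨k₂, k₁.setup.reg_zero,
      k₁.congr (fun x hx => by simp [show x ≠ 20 by omega]) fun _ _ _ => rfl, k₃, ?_⟩
    intro u v hu
    by_cases huj : u = ⟨j, hj⟩
    · subst huj; exact k₄ v
    · refine k₅ u v huj (hc u v ?_)
      have : u.val ≠ j := fun h => huj (Fin.ext h)
      omega
  · rintro s' ⟨-, -, -, h⟩ u v
    exact h u v u.isLt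

/-- As M = n + k + l is at least 4, M⁸ is at least 4⁵M³ = 1024M³, where M³ bounds kn² as well as
16M. -/
theorem wide_of_pow_le {l : ℕ} (hn : 2 ≤ n) (hk : 1 ≤ k) (hl : 1 ≤ l)
    (h : (n + k + l) ^ 8 ≤ 2 ^ w) : Wide n k w ∧ 3 * l + 3 < 2 ^ w := by
  set M := n + k + l with hM
  have h4 : 4 ≤ M := by omega
  have h3 : k * n * n ≤ M * M * M :=
    Nat.mul_le_mul (Nat.mul_le_mul (by omega) (by omega)) (by omega)
  have h3' : 16 * M ≤ M * M * M := Nat.mul_le_mul_right _ (Nat.mul_le_mul h4 h4)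
  have h8 : 1024 * (M * M * M) ≤ M ^ 8 := by
    have e : M ^ 8 = M ^ 5 * (M * M * M) := by ring
    rw [e]
    exact Nat.mul_le_mul_right _ (Nat.pow_le_pow_left h4 5)
  exact ⟨⟨by omega, hk, by omega⟩, by omega⟩

end WordRAM

theorem mainTheorem4 :
    ∃ (P : WordRAM.Cmd) (b : ℕ), ∀ c : ℕ, ∃ C : ℝ,
      ∀ (n k : ℕ) (G : SimpleGraph (Fin n)) (t : CWExpr (Fin n) k) (w : ℕ),
        2 ≤ n → t.Generates G → t.size ≤ c * n ^ 2 → (n + k + t.size) ^ b ≤ 2 ^ w →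
          ∃ (s : WordRAM.State) (T : ℕ),
            WordRAM.Exec w P (apspInput G t) s T ∧ apspSolved G s ∧
              (T : ℝ) ≤ C * (k * n ^ 2 * Real.log n) := by
  -- The running time is at most (300c + 2000)kn²; the factor 2 is there because log n ≥ log 2 >
  -- 1/2.
  refine ⟨WordRAM.apsp, 8, fun c => ⟨2 * (300 * c + 2000), fun n k G t w hn hG hsize hw => ?_⟩⟩
  have hk : 1 ≤ k := by
    obtain ⟨v, hv⟩ := t.verts_nonempty
    obtain ⟨l, -⟩ := CWExpr.mem_verts_iff.1 hv
    exact l.pos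
  obtain ⟨hwide, hL⟩ := WordRAM.wide_of_pow_le hn hk t.size_pos hw
  obtain ⟨s, T, h₁, h₂, h₃⟩ := WordRAM.runs_apsp (s := apspInput G t) hwide hL hG rfl rfl rfl
    (fun x hx => by
      simp [apspInput, show x ≠ 0 by omega, show x ≠ 1 by omega, show x ≠ 2 by omega])
    (fun u v => by
      simp only [apspInput, if_true, ne_eq, ite_eq_right_iff, one_ne_zero, imp_false, not_not]
      constructor
      · rintro ⟨u', v', h, hadj⟩
        obtain ⟨rfl, rfl⟩ := WordRAM.cell_inj h
        exact hadj
      · exact fun hadj => ⟨u, v, rfl, hadj⟩)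
    (fun j _ => by simp [apspInput])
    (fun a ha p => by simp [apspInput, show a ≠ 0 by omega, show a ≠ 1 by omega])
  refine ⟨s, T, h₁, fun u v => ?_, ?_⟩
  · split_ifs with h
    · exact (h₃ u v).1 h
    · exact (h₃ u v).2 h
  · have hlog : (1 / 2 : ℝ) ≤ Real.log n := by
      have h2 : Real.log 2 ≤ Real.log n :=
        Real.log_le_log (by norm_num) (by exact_mod_cast hn)
      have := Real.log_two_gt_d9
      linarith
    have hT : T ≤ (300 * c + 2000) * (k * n ^ 2) := by
      have h4 : c * n ^ 2 ≤ c * (k * n ^ 2) :=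
        Nat.mul_le_mul_left _ (Nat.le_mul_of_pos_left _ hk)
      have h5 : k * n * n = k * n ^ 2 := by ring
      rw [h5] at h₂
      have h6 : (300 * c + 2000) * (k * n ^ 2) = 300 * (c * (k * n ^ 2)) + 2000 * (k * n ^ 2) := by
        ring
      omega
    have hT' : (T : ℝ) ≤ (300 * c + 2000) * (k * n ^ 2) := by exact_mod_cast hT
    have hpos : (0 : ℝ) ≤ (300 * c + 2000) * (k * n ^ 2) := by positivity
    nlinarith
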